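/- **Setting.** Fix $d\ge 3$. A model consists of a set $B$ of bodies, subsets $\mathrm{IOb}\subseteq \mathrm{Ob}\subseteq B$ (inertial observers, observers) and $\mathrm{Ph}\subseteq B$ (photons), a Euclidean ordered field $Q$ of quantities (an ordered field in which positive elements have square roots), disjoint from $B$, and a worldview relation $W\subseteq \mathrm{Ob}\times B\times Q^d$. Write $p=(p_\tau,p_\sigma)\in Q\times Q^{d-1}$, $|\cdot|$ for Euclidean length, and $\mu(p)=\sqrt{p_\tau^2-|p_\sigma|^2}$ if $p_\tau^2\ge|p_\sigma|^2$, $\mu(p)=-\sqrt{|p_\sigma|^2-p_\tau^2}$ otherwise; $p$ is spacelike if $|p_\tau|<|p_\sigma|$ and timelike if $|p_\tau|>|p_\sigma|$. Let $ev_m(p)=\{b: W(m,b,p)\}$, $Cd_m=\{p: ev_m(p)\ne\emptyset\}$, $Ev_m=\{ev_m(p):p\in Cd_m\}$, $wl_m(b)=\{p:W(m,b,p)\}$; events are the elements of $Ev=\bigcup_{m\in\mathrm{Ob}}Ev_m$. $loc_m(e)$ is the unique $p$ with $ev_m(p)=e$, if there is exactly one; $\mathrm{time}_m(e,e')=|loc_m(e)_\tau-loc_m(e')_\tau|$,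 $\mathrm{dist}_m(e,e')=|loc_m(e)_\sigma-loc_m(e')_\sigma|$; an equation or inequality includes that its terms are defined. $e\sim_m e'$ means that $e=ev_m(p)$, $e'=ev_m(q)$ for some $p,q$ with $p_\tau=q_\tau$. $w^k_m$ relates $p$ to $q$ iff $ev_k(p)=ev_m(q)\neq\emptyset$. Observer $m$ is co-moving with $k$ at $q$ iff $q\in Dom\,w^k_m$ and for all $\varepsilon>0$ there is $\delta>0$ with $|w^k_m(p)-p|\le\varepsilon|p-q|$ for all $p\in Dom\, w^k_m$ with $|p-q|<\delta$; it is co-moving with $k$ at the event $e$ iff this holds for some $q$ with $ev_k(q)=e$. The life-curve $lc^k_m$ is the set of pairs $(t,p)$ such that $k\in ev_k(q)=ev_m(p)$ and $q_\tau=t$ for some $q$. $\mathsf{AccRel}$ consists of the following axioms. *AxSelf$_0$*: for $m\in\mathrm{Ob}$: $m\in ev_m(p)$ iff $p\in Cd_m$ and $p_\sigma=0$. *AxSelf$_0^+$*: for $k\in\mathrm{Ob}$ the set $\{r_\tau:k\in ev_k(r)\}$ is order-convex and has at least two elements. *AxPh*: for $m\in\mathrm{IOb}$ and all $p,q$: $|p_\sigma-q_\sigma|=|p_\tau-q_\tau|$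 iff some photon is in $ev_m(p)\cap ev_m(q)$. *AxEv*: $Ev_m=Ev_k$ for $m,k\in\mathrm{IOb}$. *AxEvTr*: if $m\in\mathrm{Ob}$ and $m\in e\in Ev$, then $e\in Ev_m$. *AxSymDist*: if $m,k\in\mathrm{IOb}$, $e,e'\in Ev_m\cap Ev_k$, $e\sim_m e'$ and $e\sim_k e'$, then $\mathrm{dist}_m(e,e')=\mathrm{dist}_k(e,e')$. *AxCmv*: if $k\in\mathrm{Ob}$ and $k\in ev_k(q)$, some $m\in\mathrm{IOb}$ is co-moving with $k$ at $q$. *CONT*: every nonempty bounded subset of $Q$ that is definable with parameters by a first-order formula in the language $\{B,\mathrm{Ob},\mathrm{IOb},\mathrm{Ph},Q,+,\cdot,<,W\}$ has a supremum. **Acceleration.** $\mathbf a^k_m$ is the second derivative of $lc^k_m$, and $a_k(t)=-\mu(\mathbf a^k_m(t))$ for any $m\in\mathrm{IOb}$. Observer $k$ is *positively accelerated* iff $a_k(t)$ is defined and positive for all $t\in Dom\,lc^k_k$. Write $p\uparrow\uparrow q$ iff $p,q$ are both spacelike and $\lambda p_\sigma=q_\sigma$ for some $\lambda>0$ (or both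 are timelike and $p_\tau q_\tau>0$). **Spaceships.** A vertical plane is a plane in $Q^d$ parallel to the time axis. An event $e$ is at Minkowski distance $\lambda$ from $k$ iff there is an event $e'\ni k$ such that $e\sim_m e'$ and $\mathrm{dist}_m(e,e')=\lambda$ for every $m\in\mathrm{IOb}$ co-moving with $k$ at $e'$. Observers $b,k,c$ form a *Minkowski spaceship* iff $wl_m(b)\cup wl_m(k)\cup wl_m(c)$ lies in a vertical plane for some $m\in\mathrm{IOb}$, all events of $b$ are at one and the same Minkowski distance from $k$, and likewise all events of $c$ (possibly at another distance). **Simultaneity.** $e_1\sim^\mu_k e_2$ iff there is an event $e\ni k$ such that $e$, $e_1$, $e_2$ are pairwise $\sim_m$-simultaneous for all $m\in\mathrm{IOb}$ co-moving with $k$ at $e$. Event $e_1$ precedes $e_2$ according to $k$ iff $loc_m(e_1)_\tau\le loc_m(e_2)_\tau$ for all $m\in\mathrm{IOb}$ that are co-moving with $k$ at some event encountered by $k$. $e_1\sim^{ph}_k e_2$ iff there are an event $e\ni k$ and photons $ph_1\in e\cap e_1$, $ph_2\in e\cap e_2$ such that $e_1$ and $e_2$ precede $e$ according to $k$. For such a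 relation $\sim$, *the clock of $b$ runs slower than the clock of $c$ as seen by $\sim$* iff $\mathrm{time}_b(e_b,\bar e_b)<\mathrm{time}_c(e_c,\bar e_c)$ for all events with $b\in e_b\cap\bar e_b$, $c\in e_c\cap\bar e_c$, $e_b\sim e_c$, $\bar e_b\sim\bar e_c$ and $(e_b,e_c)\ne(\bar e_b,\bar e_c)$. **Theorem.** Let $d\ge3$ and assume $\mathsf{AccRel}$. Let observers $b,k,c$ form a Minkowski spaceship such that $b$ and $c$ never meet (no event contains both), and (i) $k$ is positively accelerated; (ii) the direction of the spaceship is the same as that of the acceleration of $k$: for all $m\in\mathrm{IOb}$ for which $wl_m(b)\cup wl_m(k)\cup wl_m(c)$ lies in a vertical plane, all $t\in Dom\,\mathbf a^k_m$ and all $p,q\in Cd_m$ with $c\in ev_m(p)$, $b\in ev_m(q)$ and $p-q$ spacelike, $\mathbf a^k_m(t)\uparrow\uparrow(p-q)$; (iii) $b$ is not too far behind $k$: for all $m\in\mathrm{IOb}$, $t\in Dom\,\mathbf a^k_m$ and $p,q\in Cd_m$ with $k\in ev_m(p)$, $b\in ev_m(q)$, $ev_m(p)\sim^\mu_k ev_m(q)$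 and $\mathbf a^k_m(t)\uparrow\uparrow(p-q)$, one has $-\mu(p-q)<1/a_k(\tau)$ for all $\tau\in Dom\,\mathbf a^k_m$. Then (1) the clock of $b$ runs slower than the clock of $c$ as seen by $\sim^\mu_k$; and (2) the clock of $b$ runs slower than the clock of $c$ as seen by each of $\sim^{ph}_k$, $\sim^{ph}_b$ and $\sim^{ph}_c$. -/

import Mathlib

/-! Coordinate space over an ordered field. -/

/-- Coordinate points of spacetime of dimension `d = n + 1`: index `0` is the time coordinate,
the indices `1, …, n` are the space coordinates. -/
abbrev Coord (Q : Type*) (n : ℕ) := Fin (n + 1) → Q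

section Geometry

variable {Q : Type*} [Field Q] [LinearOrder Q] {n : ℕ}

/-- The space component of a coordinate point (its time component is `p 0`). -/
def spaceComp (p : Coord Q n) : Fin n → Q := fun i => p i.succ

/-- The nonnegative square root. (In a Euclidean ordered field every `x ≥ 0` has one.) -/
noncomputable def eucSqrt (x : Q) : Q :=
  open Classical in if h : ∃ y : Q, 0 ≤ y ∧ y ^ 2 = x then h.choose else 0

/-- The Euclidean length of a tuple. -/
noncomputable def eucLen {r : ℕ} (v : Fin r → Q) : Q := eucSqrt (∑ i, v i ^ 2)

def Spacelike (p : Coord Q n) : Prop := |p 0| < eucLen (spaceComp p)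

def Timelike (p : Coord Q n) : Prop := eucLen (spaceComp p) < |p 0|

/-- The signed Minkowski length; it is negative exactly on spacelike vectors. -/
noncomputable def minkLen (p : Coord Q n) : Q :=
  if eucLen (spaceComp p) ^ 2 ≤ p 0 ^ 2 then
    eucSqrt (p 0 ^ 2 - eucLen (spaceComp p) ^ 2)
  else
    -eucSqrt (eucLen (spaceComp p) ^ 2 - p 0 ^ 2)

/-- `p` and `q` have the same direction: two spacelike vectors whose space components are
positive multiples of each other, or two timelike vectors pointing to the same side in time. -/
def SameDir (p q : Coord Q n) : Prop :=
  (Spacelike p ∧ Spacelike q ∧ ∃ l : Q, 0 < l ∧ l • spaceComp p = spaceComp q) ∨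
  (Timelike p ∧ Timelike q ∧ 0 < p 0 * q 0)

/-- `S` is a subset of a vertical plane, i.e. of a plane parallel to the time axis. -/
def InVerticalPlane (S : Set (Coord Q n)) : Prop :=
  ∃ o w : Coord Q n, spaceComp w ≠ 0 ∧
    ∀ p ∈ S, ∃ s r : Q, p = o + s • (Pi.single 0 1 : Coord Q n) + r • w

/-- The domain of a binary relation. -/
def relDom {X Y : Type*} (R : Set (X × Y)) : Set X := {x | ∃ y, (x, y) ∈ R}

/-- The binary relation `R` is a (partial) function. -/
def IsFunRel {X Y : Type*} (R : Set (X × Y)) : Prop :=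
  ∀ x y z, (x, y) ∈ R → (x, z) ∈ R → y = z

/-- The partial function `f` is differentiable at `t ∈ Dom f`, and the linear map
`s ↦ s • v` is a derivative of `f` at `t`. -/
def IsDerivRel (f : Set (Q × Coord Q n)) (t : Q) (v : Coord Q n) : Prop :=
  ∃ p, (t, p) ∈ f ∧ ∀ ε : Q, 0 < ε → ∃ δ : Q, 0 < δ ∧
    ∀ s q, (s, q) ∈ f → |s - t| < δ → eucLen (q - p - (s - t) • v) ≤ ε * |s - t|

/-- The derivative `f'` of a partial function `f`, as a partial function: it is defined where
`f` is differentiable with a unique derivative. -/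
def derivRel (f : Set (Q × Coord Q n)) : Set (Q × Coord Q n) :=
  {x | IsFunRel f ∧ IsDerivRel f x.1 x.2 ∧ ∀ w, IsDerivRel f x.1 w → w = x.2}

end Geometry

/-! The frame language and its models. -/

/-- A model of the frame language, with the set `B` of bodies and the set `Q` of quantities:
observers, inertial observers, photons, and the worldview relation, where `W m b p` says that
observer `m` coordinatizes body `b` at the coordinate point `p`. -/
structure RelFrame (B Q : Type*) (n : ℕ) where
  Ob : Set B
  IOb : Set B
  Ph : Set B
  W : B → B → Coord Q n → Prop
  iob_subset : IOb ⊆ Ob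
  ob_of_W : ∀ m b p, W m b p → m ∈ Ob

/-- The nonlogical symbols of the frame language. Addition and multiplication are operations on
quantities only and not on bodies, so they are represented by their graphs. -/
inductive FrameRelSymb (n : ℕ) : ℕ → Type
  | body : FrameRelSymb n 1
  | ob : FrameRelSymb n 1
  | iob : FrameRelSymb n 1
  | ph : FrameRelSymb n 1
  | qty : FrameRelSymb n 1
  | lt : FrameRelSymb n 2
  | add : FrameRelSymb n 3
  | mul : FrameRelSymb n 3
  | worldview : FrameRelSymb n (n + 3)

/-- The first-order frame language of spacetime dimension `n + 1`. -/
def frameLang (n : ℕ) : FirstOrder.Language := ⟨fun _ => Empty, FrameRelSymb n⟩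

namespace RelFrame

variable {B Q : Type*} {n : ℕ}

/-- The universe of the model: the disjoint union of the bodies and the quantities. -/
def Univ (_M : RelFrame B Q n) := B ⊕ Q

section Interp

variable [Field Q] [LinearOrder Q]

/-- The interpretation of the symbols of the frame language. -/
def interp (M : RelFrame B Q n) : {r : ℕ} → FrameRelSymb n r → (Fin r → B ⊕ Q) → Prop
  | _, .body, v => ∃ x : B, v 0 = .inl x
  | _, .ob, v => ∃ x ∈ M.Ob, v 0 = .inl x
  | _, .iob, v => ∃ x ∈ M.IOb, v 0 = .inl x
  | _, .ph, v => ∃ x ∈ M.Ph, v 0 = .inl x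
  | _, .qty, v => ∃ x : Q, v 0 = .inr x
  | _, .lt, v => ∃ x y : Q, v 0 = .inr x ∧ v 1 = .inr y ∧ x < y
  | _, .add, v => ∃ x y : Q, v 0 = .inr x ∧ v 1 = .inr y ∧ v 2 = .inr (x + y)
  | _, .mul, v => ∃ x y : Q, v 0 = .inr x ∧ v 1 = .inr y ∧ v 2 = .inr (x * y)
  | _, .worldview, v => ∃ (m b : B) (p : Coord Q n),
      v 0 = .inl m ∧ v 1 = .inl b ∧ (∀ i : Fin (n + 1), v i.succ.succ = .inr (p i)) ∧ M.W m b p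

instance (M : RelFrame B Q n) : (frameLang n).Structure M.Univ where
  funMap := fun f _ => Empty.elim f
  RelMap := fun R v => M.interp R v

end Interp

section Basic

variable (M : RelFrame B Q n)

/-- The event observed by `m` at `p`: the set of bodies coordinatized there. -/
def ev (m : B) (p : Coord Q n) : Set B := {b | M.W m b p}

/-- The nonempty events coordinatized by `m`. -/
def Ev (m : B) : Set (Set B) := {e | e.Nonempty ∧ ∃ p, M.ev m p = e}

/-- All observed events. -/
def AllEv : Set (Set B) := {e | ∃ m ∈ M.Ob, e ∈ M.Ev m}

/-- The coordinate domain of `m`. -/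
def Cd (m : B) : Set (Coord Q n) := {p | (M.ev m p).Nonempty}

/-- The world-line of the body `b` according to `m`. -/
def wl (m b : B) : Set (Coord Q n) := {p | M.W m b p}

/-- The worldview transformation between (the coordinate systems of) `k` and `m`. -/
def wvt (k m : B) : Set (Coord Q n × Coord Q n) :=
  {x | M.ev k x.1 = M.ev m x.2 ∧ (M.ev k x.1).Nonempty}

/-- The life-curve of `k` according to `m`. -/
def lc (k m : B) : Set (Q × Coord Q n) :=
  {x | ∃ q : Coord Q n, k ∈ M.ev k q ∧ M.ev k q = M.ev m x.2 ∧ q 0 = x.1}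

/-- The event `e` is localized by `m`, at the coordinate point `p`. -/
def LocIs (m : B) (e : Set B) (p : Coord Q n) : Prop := ∀ q, M.ev m q = e ↔ q = p

/-- The events `e₁` and `e₂` are simultaneous for `m`. -/
def Simult (m : B) (e₁ e₂ : Set B) : Prop :=
  ∃ p q : Coord Q n, M.ev m p = e₁ ∧ M.ev m q = e₂ ∧ p 0 = q 0

variable [Field Q] [LinearOrder Q]

/-- The time elapsed between `e₁` and `e₂` according to `m` is defined and equal to `x`. -/
def TimeIs (m : B) (e₁ e₂ : Set B) (x : Q) : Prop :=
  ∃ p q, M.LocIs m e₁ p ∧ M.LocIs m e₂ q ∧ x = |p 0 - q 0|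

/-- The spatial distance of `e₁` and `e₂` according to `m` is defined and equal to `x`. -/
def DistIs (m : B) (e₁ e₂ : Set B) (x : Q) : Prop :=
  ∃ p q, M.LocIs m e₁ p ∧ M.LocIs m e₂ q ∧ x = eucLen (spaceComp p - spaceComp q)

/-- `m` is a co-moving observer of `k` at the coordinate point `q`. -/
def CoMoving (m k : B) (q : Coord Q n) : Prop :=
  q ∈ relDom (M.wvt k m) ∧ ∀ ε : Q, 0 < ε → ∃ δ : Q, 0 < δ ∧
    ∀ p ∈ relDom (M.wvt k m), eucLen (p - q) < δ →
      ∃ p', (∀ r, (p, r) ∈ M.wvt k m ↔ r = p') ∧ eucLen (p' - p) ≤ ε * eucLen (p - q)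

/-- `m` is a co-moving observer of `k` at the event `e`. -/
def CoMovingAt (m k : B) (e : Set B) : Prop := ∃ q, M.ev k q = e ∧ M.CoMoving m k q

/-! The axioms. -/

/-- The ordered field of quantities is Euclidean: positive elements have square roots. -/
def AxEOF (_M : RelFrame B Q n) : Prop := ∀ x : Q, 0 < x → ∃ y : Q, y ^ 2 = x

/-- An observer coordinatizes itself at a coordinate point iff the point is in its coordinate
domain and has the origin as its space component. -/
def AxSelf₀ : Prop :=
  ∀ m ∈ M.Ob, ∀ p : Coord Q n, m ∈ M.ev m p ↔ p ∈ M.Cd m ∧ spaceComp p = 0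

/-- The set of time instances at which an observer encounters an event is connected and has at
least two elements. -/
def AxSelfPlus₀ : Prop :=
  ∀ k ∈ M.Ob, (∃ p q : Coord Q n, p 0 ≠ q 0 ∧ k ∈ M.ev k p ∧ k ∈ M.ev k q) ∧
    Set.OrdConnected {t : Q | ∃ r : Coord Q n, k ∈ M.ev k r ∧ r 0 = t}

/-- For inertial observers, there is a photon through two points iff their slope is `1`. -/
def AxPh : Prop :=
  ∀ m ∈ M.IOb, ∀ p q : Coord Q n,
    eucLen (spaceComp p - spaceComp q) = |p 0 - q 0| ↔
      (M.Ph ∩ M.ev m p ∩ M.ev m q).Nonempty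

/-- Inertial observers coordinatize the same events. -/
def AxEv : Prop := ∀ m ∈ M.IOb, ∀ k ∈ M.IOb, M.Ev m = M.Ev k

/-- Every observer encounters the events in which it has been observed. -/
def AxEvTr : Prop := ∀ m ∈ M.Ob, ∀ e ∈ M.AllEv, m ∈ e → e ∈ M.Ev m

/-- Inertial observers agree on the spatial distance of events which are simultaneous for both
of them. -/
def AxSymDist : Prop :=
  ∀ m ∈ M.IOb, ∀ k ∈ M.IOb, ∀ e₁ ∈ M.Ev m ∩ M.Ev k, ∀ e₂ ∈ M.Ev m ∩ M.Ev k,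
    M.Simult m e₁ e₂ → M.Simult k e₁ e₂ → ∃ x, M.DistIs m e₁ e₂ x ∧ M.DistIs k e₁ e₂ x

/-- At every event encountered by an observer there is a co-moving inertial observer. -/
def AxCmv : Prop := ∀ k ∈ M.Ob, ∀ q, k ∈ M.ev k q → ∃ m ∈ M.IOb, M.CoMoving m k q

/-- The continuity schema: every nonempty bounded set of quantities that is definable with
parameters by a first-order formula of the frame language has a supremum. -/
def CONT : Prop :=
  ∀ S : Set Q,
    (Set.univ : Set M.Univ).Definable₁ (frameLang n) {u : M.Univ | ∃ x ∈ S, u = Sum.inr x} →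
    S.Nonempty → BddAbove S → ∃ s, IsLUB S s

/-- The theory `AccRel` of accelerated observers, over an ordered field of quantities. -/
structure AccRel : Prop where
  axEOF : M.AxEOF
  axSelf₀ : M.AxSelf₀
  axSelfPlus₀ : M.AxSelfPlus₀
  axPh : M.AxPh
  axEv : M.AxEv
  axEvTr : M.AxEvTr
  axSymDist : M.AxSymDist
  axCmv : M.AxCmv
  cont : M.CONT

/-! Acceleration. -/

/-- The relative velocity of `k` according to `m`, as a partial function of time. -/
def relVel (k m : B) : Set (Q × Coord Q n) := derivRel (M.lc k m)

/-- The relative acceleration of `k` according to `m`, as a partial function of time. -/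
def relAcc (k m : B) : Set (Q × Coord Q n) := derivRel (M.relVel k m)

/-- The acceleration of `k` at `t` is defined and equal to `x`: it is the unsigned Minkowski
length of the relative acceleration according to any inertial observer. -/
def AccIs (k : B) (t x : Q) : Prop :=
  ∀ m ∈ M.IOb, ∃ a, (t, a) ∈ M.relAcc k m ∧ x = -minkLen a

/-- `k` is positively accelerated. -/
def PositivelyAccelerated (k : B) : Prop :=
  ∀ t ∈ relDom (M.lc k k), ∃ x, M.AccIs k t x ∧ 0 < x

/-! Minkowski spaceships. -/

/-- The event `e` is at Minkowski distance `l` from `k`. -/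
def AtMinkDist (k : B) (e : Set B) (l : Q) : Prop :=
  ∃ e' ∈ M.AllEv, k ∈ e' ∧ ∀ m ∈ M.IOb, M.CoMovingAt m k e' →
    M.Simult m e e' ∧ M.DistIs m e e' l

/-- The body `b` is at constant Minkowski distance from `k`. -/
def ConstMinkDist (k b : B) : Prop := ∃ l : Q, ∀ e ∈ M.AllEv, b ∈ e → M.AtMinkDist k e l

/-- In the coordinate system of `m` the world-lines of `b`, `k` and `c` lie in one vertical
plane. -/
def CoplanarFor (m b k c : B) : Prop := InVerticalPlane (M.wl m b ∪ M.wl m k ∪ M.wl m c)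

/-- The observers `b`, `k`, `c` form a Minkowski spaceship. -/
def MinkowskiSpaceship (b k c : B) : Prop :=
  (∃ m ∈ M.IOb, M.CoplanarFor m b k c) ∧ M.ConstMinkDist k b ∧ M.ConstMinkDist k c

/-- The direction of the spaceship (from `b` to `c`) is the same as that of the acceleration of
`k`, for the inertial observers for which the spaceship moves in a vertical plane. -/
def DirectionOfAcceleration (b k c : B) : Prop :=
  ∀ m ∈ M.IOb, M.CoplanarFor m b k c → ∀ t a, (t, a) ∈ M.relAcc k m →
    ∀ p ∈ M.Cd m, ∀ q ∈ M.Cd m, c ∈ M.ev m p → b ∈ M.ev m q → Spacelike (p - q) →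
      SameDir a (p - q)

/-! Simultaneity for accelerated observers. -/

/-- Minkowski simultaneity: `e₁` and `e₂` are simultaneous, with each other and with an event `e`
encountered by `k`, for every inertial observer co-moving with `k` at `e`. -/
def MinkSim (k : B) (e₁ e₂ : Set B) : Prop :=
  ∃ e ∈ M.AllEv, k ∈ e ∧ ∀ m ∈ M.IOb, M.CoMovingAt m k e →
    M.Simult m e e₁ ∧ M.Simult m e e₂ ∧ M.Simult m e₁ e₂

/-- The event `e₁` precedes the event `e₂` according to `k`: it is not later for any inertial
observer which is co-moving with `k` at some point of its life. -/
def Precedes (k : B) (e₁ e₂ : Set B) : Prop :=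
  ∀ m ∈ M.IOb, (∃ e, k ∈ e ∧ M.CoMovingAt m k e) →
    ∃ p q, M.LocIs m e₁ p ∧ M.LocIs m e₂ q ∧ p 0 ≤ q 0

/-- Photon simultaneity. -/
def PhotonSim (k : B) (e₁ e₂ : Set B) : Prop :=
  ∃ e ∈ M.AllEv, k ∈ e ∧ (∃ ph ∈ M.Ph, ph ∈ e ∧ ph ∈ e₁) ∧ (∃ ph ∈ M.Ph, ph ∈ e ∧ ph ∈ e₂) ∧
    M.Precedes k e₁ e ∧ M.Precedes k e₂ e

/-- `b` is not too far behind the positively accelerated observer `k`: whenever `b` is behind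
`k`, its Minkowski distance is less than `1 / a` for every value `a` of the acceleration
of `k`. -/
def NotTooFarBehind (b k : B) : Prop :=
  ∀ m ∈ M.IOb, ∀ t a, (t, a) ∈ M.relAcc k m →
    ∀ p ∈ M.Cd m, ∀ q ∈ M.Cd m, k ∈ M.ev m p → b ∈ M.ev m q →
      M.MinkSim k (M.ev m p) (M.ev m q) → SameDir a (p - q) →
        ∀ τ ∈ relDom (M.relAcc k m), ∃ x, M.AccIs k τ x ∧ -minkLen (p - q) < 1 / x

/-- The clock of `b` runs slower than the clock of `c` as seen by means of the simultaneity
relation `S`. The degenerate case, in which only one event of each clock is observed, is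
excluded. -/
def RunsSlower (S : Set B → Set B → Prop) (b c : B) : Prop :=
  ∀ e₁ ∈ M.AllEv, ∀ e₁' ∈ M.AllEv, ∀ e₂ ∈ M.AllEv, ∀ e₂' ∈ M.AllEv,
    b ∈ e₁ → b ∈ e₁' → c ∈ e₂ → c ∈ e₂' → S e₁ e₂ → S e₁' e₂' → (e₁ ≠ e₁' ∨ e₂ ≠ e₂') →
      ∃ x y, M.TimeIs b e₁ e₁' x ∧ M.TimeIs c e₂ e₂' y ∧ x < y

end Basic

end RelFrame

/-! Everything reduces to curves in a two-dimensional Minkowski plane. By `AxPh` and `AxEv` the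
worldview transformation between inertial observers is a bijection preserving the null relation in
both directions. For `2 ≤ n` such a bijection is affine up to a map of the scalars, and `AxSymDist`
excludes scalar maps and dilations, so it is a Poincaré transformation (`PreservesNull.poincare`,
`AccRel.poincare`). Hence one inertial frame `m` suffices. By `AxCmv` every observer has in it a
derivative by its proper time, a unit timelike vector, and simultaneity for any co-moving observer
is orthogonality to that vector.

The field is not assumed complete, but all functions that occur are definable, and `CONT` gives real
induction for definable predicates. From it follow monotonicity from the sign of a derivative,
existence of maxima, constancy of sign of a nonvanishing derivative, and the comparison of two
clocks through the rates of matched functions (`CONT.clock_comparison`).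

In the plane of the spaceship take null coordinates `U`, `V`. A unit speed curve has `U' = r` and
`V' = 1/r` with `r > 0`, and acceleration `α` in the positive direction means `r' = α r`. The point
simultaneous with `k` at its time `t`, at signed distance `x`, is `(U + x r, V - x / r)`. Its
coordinates have derivatives `r (1 + α x)` and `(1 + α x) / r`, and hypothesis (iii) says that `1 +
α x > 0`. A curve keeping the signed distance `x` therefore has the same `r` as `k` at simultaneous
events, and the time of `k` passes along it at the rate `1 / (1 + α x)`
(`TimelikeCurve.KeepsDist.hasD_tm`). If `b` is at `x` and `c` at `y > x`, this rate is greater along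
`b`, which gives (1).

For (2), light going right has constant `V` and light going left has constant `U`. Events of `b` and
`c` on a right-going ray belong to an earlier time of `k` for `b` than for `c`; as `r` increases,
`V' = 1/r` is greater along `b`. On a left-going ray the order of times is reversed and `U' = r` is
greater along `b`. Either way less time passes for `b`. When `k` is strictly between `b` and `c`,
the two comparisons are chained through the clock of `k`.

Two points remain. A constant unsigned distance must give a constant side of `k`; this is definable
connectedness (`TimelikeCurve.not_at_neg`). And hypothesis (ii) says something only if some events
of `b` and `c` are spacelike separated. Since `b` and `c` never meet, two different matched pairs of
events produce such a separation (`TimelikeCurve.exists_spacelike`), so without one the claim is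
vacuous. -/

open Filter Topology Set

set_option linter.unusedSectionVars false

namespace RelFrame

/-! ### Definable predicates and functions of quantities. -/

section Definability

variable {B Q : Type*} {n : ℕ} [Field Q] [LinearOrder Q] (M : RelFrame B Q n)

/-- Definability with parameters of a subset of a power of the universe of the model. -/
abbrev DefSet {ι : Type*} (S : Set (ι → M.Univ)) : Prop :=
  (Set.univ : Set M.Univ).Definable (frameLang n) S

/-- A tuple of quantities, as a tuple of elements of the universe of the model. -/
def qtuple {ι : Type*} (x : ι → Q) : ι → M.Univ := fun i => Sum.inr (x i)

/-- A predicate on tuples of quantities is definable with parameters. -/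
def DefPred {ι : Type*} (P : (ι → Q) → Prop) : Prop :=
  ∃ S : Set (ι → M.Univ), M.DefSet S ∧ ∀ x : ι → Q, M.qtuple x ∈ S ↔ P x

/-- A quantity valued function on tuples of quantities is definable with parameters. -/
def DefFun {ι : Type*} (f : (ι → Q) → Q) : Prop :=
  M.DefPred fun w : ι ⊕ Fin 1 → Q => w (.inr 0) = f (fun i => w (.inl i))

theorem defSet_interp {ι : Type*} {r : ℕ} (R : FrameRelSymb n r) (g : Fin r → ι) :
    M.DefSet {v | M.interp R fun i => v (g i)} := by
  refine Set.Definable.mono (A := ∅) ?_ (Set.empty_subset _)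
  rw [Set.empty_definable_iff]
  refine ⟨FirstOrder.Language.Relations.formula (L := frameLang n) (R : (frameLang n).Relations r)
    (fun i => FirstOrder.Language.Term.var (g i)), ?_⟩
  ext v
  exact (FirstOrder.Language.Formula.realize_rel (L := frameLang n) (M := M.Univ) (v := v)
    (R := (R : (frameLang n).Relations r))
    (ts := fun i => FirstOrder.Language.Term.var (g i))).symm

theorem defSet_eq_const {ι : Type*} (i : ι) (a : M.Univ) :
    M.DefSet {v : ι → M.Univ | v i = a} := by
  refine ⟨FirstOrder.Language.Term.equal (FirstOrder.Language.Term.var i)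
    (((frameLang n).con (⟨a, trivial⟩ : (Set.univ : Set M.Univ))).term), ?_⟩
  ext v
  rw [mem_ofPred_eq, mem_ofPred_eq, FirstOrder.Language.Formula.realize_equal]
  rfl

theorem defSet_eq {ι : Type*} (i j : ι) : M.DefSet {v : ι → M.Univ | v i = v j} := by
  refine ⟨FirstOrder.Language.Term.equal (FirstOrder.Language.Term.var i)
    (FirstOrder.Language.Term.var j), ?_⟩
  ext v
  rw [mem_ofPred_eq, mem_ofPred_eq, FirstOrder.Language.Formula.realize_equal]
  rfl

theorem defSet_exists {ι : Type*} (m : ℕ) {S : Set (ι ⊕ Fin m → M.Univ)} (h : M.DefSet S) :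
    M.DefSet {v : ι → M.Univ | ∃ w : Fin m → M.Univ, Sum.elim v w ∈ S} := by
  have h1 := Set.Definable.image_comp_sumInl_fin m h
  convert h1 using 1
  ext v
  constructor
  · rintro ⟨w, hw⟩
    exact ⟨_, hw, rfl⟩
  · rintro ⟨w, hw, rfl⟩
    refine ⟨fun i => w (.inr i), ?_⟩
    convert hw using 1
    ext i
    cases i <;> rfl

variable {M}
variable {ι κ : Type*}

theorem DefPred.congr {P P' : (ι → Q) → Prop} (h : M.DefPred P) (e : ∀ v, P v ↔ P' v) :
    M.DefPred P' := by
  obtain ⟨S, hS, h⟩ := h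
  exact ⟨S, hS, fun x => (h x).trans (e x)⟩

theorem DefPred.not {P : (ι → Q) → Prop} (h : M.DefPred P) : M.DefPred fun v => ¬ P v := by
  obtain ⟨S, hS, h⟩ := h
  exact ⟨Sᶜ, hS.compl, fun x => by simp [← h]⟩

theorem DefPred.and {P R : (ι → Q) → Prop} (h : M.DefPred P) (h' : M.DefPred R) :
    M.DefPred fun v => P v ∧ R v := by
  obtain ⟨S, hS, h⟩ := h
  obtain ⟨T, hT, h'⟩ := h'
  exact ⟨S ∩ T, hS.inter hT, fun x => by simp [← h, ← h']⟩

theorem DefPred.or {P R : (ι → Q) → Prop} (h : M.DefPred P) (h' : M.DefPred R) :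
    M.DefPred fun v => P v ∨ R v := by
  obtain ⟨S, hS, h⟩ := h
  obtain ⟨T, hT, h'⟩ := h'
  exact ⟨S ∪ T, hS.union hT, fun x => by simp [← h, ← h']⟩

theorem DefPred.imp {P R : (ι → Q) → Prop} (h : M.DefPred P) (h' : M.DefPred R) :
    M.DefPred fun v => P v → R v :=
  (h.not.or h').congr fun v => by tauto

theorem DefPred.comap {P : (ι → Q) → Prop} (h : M.DefPred P) (g : ι → κ) :
    M.DefPred fun v : κ → Q => P fun i => v (g i) := by
  obtain ⟨S, hS, h⟩ := h
  exact ⟨_, hS.preimage_comp g, fun x => (h fun i => x (g i))⟩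

theorem DefPred.forall_finite {m : ℕ} {P : Fin m → (ι → Q) → Prop} (h : ∀ i, M.DefPred (P i)) :
    M.DefPred fun v => ∀ i, P i v := by
  choose S hS h using h
  exact ⟨⋂ i, S i, Set.definable_iInter_of_finite hS, fun x => by simp [← h]⟩

theorem DefPred.exists_tuple {m : ℕ} {P : (ι → Q) → (Fin m → Q) → Prop}
    (h : M.DefPred fun w : ι ⊕ Fin m → Q => P (fun i => w (.inl i)) (fun i => w (.inr i))) :
    M.DefPred fun v => ∃ x, P v x := by
  obtain ⟨S, hS, h⟩ := h
  -- The set behind a `DefPred` is controlled only on tuples of quantities, whereas a first-order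
  -- quantifier ranges over bodies too, so it has to be relativized to quantities.
  have h1 : M.DefSet {v : ι ⊕ Fin m → M.Univ | ∀ i : Fin m, ∃ x : Q, v (.inr i) = Sum.inr x} := by
    have h2 : M.DefSet (⋂ i : Fin m, {v : ι ⊕ Fin m → M.Univ |
        M.interp (.qty) fun _ => v (.inr i)}) :=
      Set.definable_iInter_of_finite fun i => M.defSet_interp .qty fun _ => Sum.inr i
    convert h2 using 1
    ext v
    rw [mem_ofPred_eq, mem_iInter]
    rfl
  refine ⟨_, M.defSet_exists m (hS.inter h1), fun x => ?_⟩
  constructor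
  · rintro ⟨w, hw, hq⟩
    choose y hy using hq
    refine ⟨y, (h (Sum.elim x y)).1 ?_⟩
    convert hw using 1
    refine (funext fun i => ?_)
    rcases i with i | i
    · rfl
    · exact (hy i).symm
  · rintro ⟨y, hy⟩
    have h3 := (h (Sum.elim x y)).2 hy
    refine ⟨fun i => Sum.inr (y i), ?_, fun i => ⟨y i, rfl⟩⟩
    convert h3 using 1
    refine (funext fun i => ?_)
    rcases i with i | i <;> rfl

theorem DefPred.exists {P : (ι → Q) → Q → Prop}
    (h : M.DefPred fun w : ι ⊕ Fin 1 → Q => P (fun i => w (.inl i)) (w (.inr 0))) :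
    M.DefPred fun v => ∃ x, P v x :=
  (DefPred.exists_tuple (m := 1) (P := fun v x => P v (x 0)) h).congr fun v =>
    ⟨fun ⟨x, hx⟩ => ⟨x 0, hx⟩, fun ⟨x, hx⟩ => ⟨fun _ => x, hx⟩⟩

theorem DefPred.forall {P : (ι → Q) → Q → Prop}
    (h : M.DefPred fun w : ι ⊕ Fin 1 → Q => P (fun i => w (.inl i)) (w (.inr 0))) :
    M.DefPred fun v => ∀ x, P v x :=
  (DefPred.exists (P := fun v x => ¬ P v x) h.not).not.congr fun _ => by simp

/-- Substitution of definable functions into a definable predicate. -/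
theorem DefPred.subst {m : ℕ} {P : (Fin m → Q) → Prop} (h : M.DefPred P)
    {f : Fin m → (ι → Q) → Q} (hf : ∀ j, M.DefFun (f j)) :
    M.DefPred fun v => P fun j => f j v := by
  -- Definable functions are given by their graphs only, so substitution quantifies over the
  -- intermediate values.
  have h1 : M.DefPred fun v : ι → Q => ∃ y : Fin m → Q, P y ∧ ∀ j, y j = f j v := by
    refine DefPred.exists_tuple (P := fun v y => P y ∧ ∀ j, y j = f j v)
      ((h.comap Sum.inr).and (DefPred.forall_finite fun j => ?_))
    have h2 := (hf j).comap (κ := ι ⊕ Fin m)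
      (Sum.elim (fun i => Sum.inl i) fun _ => Sum.inr j)
    exact h2
  refine h1.congr fun v => ⟨fun ⟨y, hy, e⟩ => ?_, fun h => ⟨_, h, fun j => rfl⟩⟩
  rwa [show (fun j => f j v) = y from funext fun j => (e j).symm]

theorem defFun_proj (i : ι) : M.DefFun fun v : ι → Q => v i :=
  ⟨_, M.defSet_eq (.inr 0) (.inl i), fun x => by
    rw [mem_ofPred_eq]
    exact Sum.inr_injective.eq_iff⟩

theorem defFun_const (c : Q) : M.DefFun fun _ : ι → Q => c :=
  ⟨_, M.defSet_eq_const (.inr 0) (.inr c), fun x => by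
    rw [mem_ofPred_eq]
    exact Sum.inr_injective.eq_iff⟩

theorem defPred_lt_aux : M.DefPred fun v : Fin 2 → Q => v 0 < v 1 :=
  ⟨_, M.defSet_interp .lt id, fun x => by simp [interp, qtuple]⟩

theorem DefPred.lt {f g : (ι → Q) → Q} (hf : M.DefFun f) (hg : M.DefFun g) :
    M.DefPred fun v => f v < g v :=
  defPred_lt_aux.subst (f := ![f, g]) (by intro j; fin_cases j <;> assumption)

theorem DefPred.eq {f g : (ι → Q) → Q} (hf : M.DefFun f) (hg : M.DefFun g) :
    M.DefPred fun v => f v = g v :=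
  ((DefPred.lt hf hg).or (DefPred.lt hg hf)).not.congr fun v => by
    rw [← ne_iff_lt_or_gt, not_ne_iff]

theorem DefPred.le {f g : (ι → Q) → Q} (hf : M.DefFun f) (hg : M.DefFun g) :
    M.DefPred fun v => f v ≤ g v :=
  (DefPred.lt hg hf).not.congr fun _ => not_lt

theorem DefPred.eq₁ {F : Q → Q} (hF : M.DefFun fun v : Fin 1 → Q => F (v 0))
    {f g : (ι → Q) → Q} (hf : M.DefFun f) (hg : M.DefFun g) :
    M.DefPred fun v => g v = F (f v) := by
  have h1 : M.DefPred fun v : Fin 2 → Q => v 0 = F (v 1) :=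
    hF.comap (Sum.elim (fun _ => 1) fun _ => 0)
  exact h1.subst (f := ![g, f]) (by intro j; fin_cases j <;> assumption)

theorem DefFun.comap {f : (ι → Q) → Q} (hf : M.DefFun f) (g : ι → κ) :
    M.DefFun fun v : κ → Q => f fun i => v (g i) :=
  DefPred.comap hf (Sum.map g id)

theorem DefFun.comp {F : Q → Q} (hF : M.DefFun fun v : Fin 1 → Q => F (v 0))
    {f : (ι → Q) → Q} (hf : M.DefFun f) : M.DefFun fun v => F (f v) :=
  DefPred.eq₁ hF (hf.comap Sum.inl) (defFun_proj (Sum.inr 0))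

theorem DefFun.add {f g : (ι → Q) → Q} (hf : M.DefFun f) (hg : M.DefFun g) :
    M.DefFun fun v => f v + g v := by
  have h1 : M.DefPred fun v : Fin 3 → Q => v 2 = v 0 + v 1 :=
    ⟨_, M.defSet_interp .add id, fun x => by simp [interp, qtuple]⟩
  exact h1.subst (f := ![fun v : ι ⊕ Fin 1 → Q => f fun i => v (Sum.inl i),
    fun v => g fun i => v (Sum.inl i), fun v => v (Sum.inr 0)]) (by
      intro j
      fin_cases j
      · exact hf.comap _
      · exact hg.comap _
      · exact defFun_proj _)

theorem DefFun.mul {f g : (ι → Q) → Q} (hf : M.DefFun f) (hg : M.DefFun g) :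
    M.DefFun fun v => f v * g v := by
  have h1 : M.DefPred fun v : Fin 3 → Q => v 2 = v 0 * v 1 :=
    ⟨_, M.defSet_interp .mul id, fun x => by simp [interp, qtuple]⟩
  exact h1.subst (f := ![fun v : ι ⊕ Fin 1 → Q => f fun i => v (Sum.inl i),
    fun v => g fun i => v (Sum.inl i), fun v => v (Sum.inr 0)]) (by
      intro j
      fin_cases j
      · exact hf.comap _
      · exact hg.comap _
      · exact defFun_proj _)

theorem DefFun.neg {f : (ι → Q) → Q} (hf : M.DefFun f) : M.DefFun fun v => -f v := by
  simpa using (defFun_const (-1)).mul hf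

theorem DefFun.sub {f g : (ι → Q) → Q} (hf : M.DefFun f) (hg : M.DefFun g) :
    M.DefFun fun v => f v - g v := by
  simpa [sub_eq_add_neg] using hf.add hg.neg

theorem DefFun.inv {f : (ι → Q) → Q} (hf : M.DefFun f) : M.DefFun fun v => (f v)⁻¹ := by
  have h1 : M.DefFun fun v : ι ⊕ Fin 1 → Q => f fun i => v (.inl i) := hf.comap _
  have h2 : M.DefFun fun v : ι ⊕ Fin 1 → Q => v (.inr 0) := defFun_proj _
  -- The first disjunct covers the convention `0⁻¹ = 0`.
  refine (((DefPred.eq h1 (defFun_const 0)).and (DefPred.eq h2 (defFun_const 0))).or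
    (DefPred.eq (h1.mul h2) (defFun_const 1))).congr fun v => ?_
  by_cases h : (f fun i => v (.inl i)) = 0
  · simp [h]
  · simp only [h, false_and, false_or]
    exact ⟨fun e => eq_inv_of_mul_eq_one_right e, fun e => by rw [e, mul_inv_cancel₀ h]⟩

theorem DefFun.sum {m : ℕ} {f : Fin m → (ι → Q) → Q} (hf : ∀ i, M.DefFun (f i)) :
    M.DefFun fun v => ∑ i, f i v := by
  classical
  suffices h : ∀ s : Finset (Fin m), M.DefFun fun v => ∑ i ∈ s, f i v from h _
  intro s
  induction s using Finset.induction_on with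
  | empty => simpa using defFun_const 0
  | insert a s ha ih => simpa [Finset.sum_insert ha] using (hf a).add ih

/-- A function given by a definable graph relation is definable. -/
theorem DefFun.of_graph {f : (ι → Q) → Q} {G : (ι → Q) → Q → Prop}
    (hG : M.DefPred fun w : ι ⊕ Fin 1 → Q => G (fun i => w (.inl i)) (w (.inr 0)))
    (h : ∀ v y, G v y ↔ y = f v) : M.DefFun f :=
  hG.congr fun _ => h _ _

/-- The coincidence of the events observed by two observers is definable. -/
theorem defPred_ev_eq (k m : B) :
    M.DefPred fun v : Fin (n + 1) ⊕ Fin (n + 1) → Q =>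
      M.ev k (fun i => v (.inl i)) = M.ev m (fun i => v (.inr i)) := by
  -- The three extra variables are a body and the two observers, the latter pinned by parameters.
  -- The events differ iff some body lies in exactly one of them; the complement of this is wanted.
  set ι := (Fin (n + 1) ⊕ Fin (n + 1)) ⊕ Fin 3 with hι
  let g1 : Fin (n + 3) → ι := Fin.cons (.inr 1) (Fin.cons (.inr 0) fun i => .inl (.inl i))
  let g2 : Fin (n + 3) → ι := Fin.cons (.inr 2) (Fin.cons (.inr 0) fun i => .inl (.inr i))
  have hW1 := M.defSet_interp .worldview g1
  have hW2 := M.defSet_interp .worldview g2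
  have hb := M.defSet_interp .body fun _ => (.inr 0 : ι)
  have hk := M.defSet_eq_const (.inr 1 : ι) (Sum.inl k)
  have hm := M.defSet_eq_const (.inr 2 : ι) (Sum.inl m)
  have key := M.defSet_exists 3 ((hb.inter (hk.inter hm)).inter
    ((hW1.inter hW2.compl).union (hW2.inter hW1.compl)))
  refine ⟨_, key.compl, fun x => ?_⟩
  have e1 : ∀ (b : B) , M.interp .worldview (fun i => (Sum.elim (fun i => Sum.inr (x i))
      ![Sum.inl b, Sum.inl k, Sum.inl m] : ι → B ⊕ Q) (g1 i)) ↔ M.W k b fun i => x (.inl i) := by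
    intro b
    simp only [interp, g1]
    constructor
    · rintro ⟨m', b', p, h0, h1, h2, h3⟩
      have h0 : k = m' := Sum.inl_injective h0
      have h1 : b = b' := Sum.inl_injective h1
      have h2 : (fun i => x (.inl i)) = p := funext fun i => Sum.inr_injective (h2 i)
      rwa [h0, h1, h2]
    · intro h
      exact ⟨k, b, _, rfl, rfl, fun i => rfl, h⟩
  have e2 : ∀ (b : B) , M.interp .worldview (fun i => (Sum.elim (fun i => Sum.inr (x i))
      ![Sum.inl b, Sum.inl k, Sum.inl m] : ι → B ⊕ Q) (g2 i)) ↔ M.W m b fun i => x (.inr i) := by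
    intro b
    simp only [interp, g2]
    constructor
    · rintro ⟨m', b', p, h0, h1, h2, h3⟩
      have h0 : m = m' := Sum.inl_injective h0
      have h1 : b = b' := Sum.inl_injective h1
      have h2 : (fun i => x (.inr i)) = p := funext fun i => Sum.inr_injective (h2 i)
      rwa [h0, h1, h2]
    · intro h
      exact ⟨m, b, _, rfl, rfl, fun i => rfl, h⟩
  constructor
  · intro h
    ext b
    by_contra hne
    refine h ⟨![Sum.inl b, Sum.inl k, Sum.inl m], ⟨⟨b, rfl⟩, rfl, rfl⟩, ?_⟩
    have h1 := e1 b
    have h2 := e2 b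
    simp only [ev, mem_ofPred_eq] at hne
    by_cases h3 : M.W k b fun i => x (.inl i)
    · exact Or.inl ⟨h1.2 h3, fun h4 => hne ⟨fun _ => h2.1 h4, fun _ => h3⟩⟩
    · refine Or.inr ⟨h2.2 ?_, fun h4 => h3 (h1.1 h4)⟩
      by_contra h5
      exact hne ⟨fun h => absurd h h3, fun h => absurd h h5⟩
  · rintro h ⟨w, ⟨⟨b, hb⟩, hk, hm⟩, hh⟩
    have hw : w = ![Sum.inl b, Sum.inl k, Sum.inl m] := by
      ext i
      fin_cases i
      · exact hb
      · exact hk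
      · exact hm
    subst hw
    have h1 := e1 b
    have h2 := e2 b
    have h3 : (M.W k b fun i => x (.inl i)) ↔ M.W m b fun i => x (.inr i) := by
      have := congrArg (fun s => b ∈ s) h
      simpa [ev] using this
    rcases hh with ⟨h4, h5⟩ | ⟨h4, h5⟩
    · exact h5 (h2.2 (h3.1 (h1.1 h4)))
    · exact h5 (h1.2 (h3.2 (h2.1 h4)))

/-- The continuity schema for definable predicates. -/
theorem CONT.exists_isLUB (h : M.CONT) {P : Q → Prop}
    (hP : M.DefPred fun v : Fin 1 → Q => P (v 0)) (hne : ∃ x, P x) (hbd : ∃ c, ∀ x, P x → x ≤ c) :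
    ∃ s, IsLUB {x | P x} s := by
  refine h {x | P x} ?_ hne (by obtain ⟨c, hc⟩ := hbd; exact ⟨c, fun x hx => hc x hx⟩)
  obtain ⟨S, hS, hP⟩ := hP
  have h1 := hS.inter (M.defSet_interp .qty fun _ => (0 : Fin 1))
  unfold Set.Definable₁
  convert h1 using 1
  ext v
  simp only [mem_ofPred_eq, mem_inter_iff]
  constructor
  · rintro ⟨x, hx, hv⟩
    refine ⟨?_, x, hv⟩
    convert (hP fun _ => x).2 hx using 1
    refine (funext fun i => ?_)
    rw [Subsingleton.elim i 0]
    exact hv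
  · rintro ⟨hv, x, hx⟩
    refine ⟨x, (hP fun _ => x).1 ?_, hx⟩
    convert hv using 1
    refine (funext fun i => ?_)
    rw [Subsingleton.elim i 0]
    exact hx.symm

end Definability

end RelFrame

/-! ### Derivatives within a set over an ordered field. -/

section Calculus

variable {Q : Type*} [Field Q] [LinearOrder Q] [IsStrictOrderedRing Q] [TopologicalSpace Q]
  [OrderTopology Q]

/-- `y` is a derivative of `f` at `t` within `S`. -/
def HasD (f : Q → Q) (S : Set Q) (y t : Q) : Prop :=
  Tendsto (fun s => (f s - f t) / (s - t)) (𝓝[S \ {t}] t) (𝓝 y)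

variable {f g : Q → Q} {S T : Set Q} {y z t : Q}

theorem tendsto_nhdsWithin_iff_abs {l : Q} :
    Tendsto f (𝓝[S] t) (𝓝 l) ↔
      ∀ ε > 0, ∃ δ > 0, ∀ s ∈ S, |s - t| < δ → |f s - l| < ε := by
  rw [((nhdsWithin_hasBasis (nhds_basis_abs_sub_lt t) S).tendsto_iff (nhds_basis_abs_sub_lt l))]
  constructor
  · intro h ε hε
    obtain ⟨δ, hδ, h⟩ := h ε hε
    exact ⟨δ, hδ, fun s hs hst => h s ⟨hst, hs⟩⟩
  · intro h ε hε
    obtain ⟨δ, hδ, h⟩ := h ε hε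
    exact ⟨δ, hδ, fun s hs => h s hs.2 hs.1⟩

/-- The form without filters and division serves twice: it is first-order, and it has the shape of
the estimates in `IsDerivRel` and `CoMoving`. -/
theorem hasD_iff : HasD f S y t ↔ ∀ ε > 0, ∃ δ > 0, ∀ s ∈ S, |s - t| < δ →
    |f s - f t - (s - t) * y| ≤ ε * |s - t| := by
  unfold HasD
  rw [tendsto_nhdsWithin_iff_abs]
  have key : ∀ s, s ≠ t → |f s - f t - (s - t) * y| = |(f s - f t) / (s - t) - y| * |s - t| := by
    intro s hs
    have : s - t ≠ 0 := sub_ne_zero.2 hs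
    rw [← abs_mul, sub_mul ((f s - f t) / (s - t)), div_mul_cancel₀ _ this, mul_comm y]
  constructor
  · intro h ε hε
    obtain ⟨δ, hδ, h⟩ := h ε hε
    refine ⟨δ, hδ, fun s hs hst => ?_⟩
    by_cases e : s = t
    · simp [e]
    · rw [key s e]
      exact mul_le_mul_of_nonneg_right (h s ⟨hs, e⟩ hst).le (abs_nonneg _)
  · intro h ε hε
    obtain ⟨δ, hδ, h⟩ := h (ε / 2) (by positivity)
    refine ⟨δ, hδ, fun s hs hst => ?_⟩
    have h1 := h s hs.1 hst
    rw [key s hs.2] at h1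
    have h2 : 0 < |s - t| := abs_pos.2 (sub_ne_zero.2 hs.2)
    exact (le_of_mul_le_mul_right h1 h2).trans_lt (half_lt_self hε)

theorem HasD.mono (h : HasD f S y t) (hT : T ⊆ S) : HasD f T y t :=
  h.mono_left (nhdsWithin_mono _ (Set.sdiff_subset_sdiff_left hT))

theorem HasD.congr (h : HasD f S y t) (e : ∀ s ∈ S, f s = g s) (ht : t ∈ S) : HasD g S y t := by
  refine Tendsto.congr' ?_ h
  filter_upwards [self_mem_nhdsWithin] with s hs
  rw [e s hs.1, e t ht]

theorem hasD_const (c : Q) : HasD (fun _ => c) S 0 t := by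
  simpa [HasD] using tendsto_const_nhds

theorem HasD.add (hf : HasD f S y t) (hg : HasD g S z t) :
    HasD (fun s => f s + g s) S (y + z) t := by
  refine (Tendsto.add hf hg).congr fun s => ?_
  rw [← add_div]
  congr 1
  ring

theorem HasD.neg (hf : HasD f S y t) : HasD (fun s => -f s) S (-y) t := by
  refine (Tendsto.neg hf).congr fun s => ?_
  rw [← neg_div]
  congr 1
  ring

theorem HasD.sub (hf : HasD f S y t) (hg : HasD g S z t) :
    HasD (fun s => f s - g s) S (y - z) t := by
  simpa only [sub_eq_add_neg] using hf.add hg.neg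

theorem HasD.const_mul (c : Q) (hf : HasD f S y t) : HasD (fun s => c * f s) S (c * y) t := by
  refine (Tendsto.const_mul c hf).congr fun s => ?_
  rw [← mul_div_assoc]
  congr 1
  ring

theorem HasD.sum {m : ℕ} {F : Fin m → Q → Q} {Y : Fin m → Q} (h : ∀ i, HasD (F i) S (Y i) t) :
    HasD (fun s => ∑ i, F i s) S (∑ i, Y i) t := by
  refine (tendsto_finsetSum _ fun i _ => h i).congr fun s => ?_
  rw [← Finset.sum_div, Finset.sum_sub_distrib]

theorem HasD.tendsto_diff (hf : HasD f S y t) : Tendsto f (𝓝[S \ {t}] t) (𝓝 (f t)) := by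
  have h1 : Tendsto (fun s => s - t) (𝓝[S \ {t}] t) (𝓝 0) := by
    have : Tendsto (fun s => s - t) (𝓝 t) (𝓝 (t - t)) := tendsto_id.sub_const t
    rw [sub_self] at this
    exact this.mono_left nhdsWithin_le_nhds
  have h2 := (Tendsto.mul hf h1).add_const (f t)
  rw [mul_zero, zero_add] at h2
  refine h2.congr' ?_
  filter_upwards [self_mem_nhdsWithin] with s hs
  rw [div_mul_cancel₀ _ (sub_ne_zero.2 hs.2)]
  ring

theorem HasD.near (hf : HasD f S y t) {ε : Q} (hε : 0 < ε) :
    ∃ δ > 0, ∀ s ∈ S, |s - t| < δ → |f s - f t| < ε := by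
  obtain ⟨δ, hδ, h⟩ := tendsto_nhdsWithin_iff_abs.1 hf.tendsto_diff ε hε
  refine ⟨δ, hδ, fun s hs hst => ?_⟩
  by_cases e : s = t
  · simpa [e] using hε
  · exact h s ⟨hs, e⟩ hst

theorem HasD.inv (hf : HasD f S y t) (h0 : f t ≠ 0) :
    HasD (fun s => (f s)⁻¹) S (-y / f t ^ 2) t := by
  have h1 := ((Tendsto.neg hf).mul (hf.tendsto_diff.inv₀ h0)).mul_const (f t)⁻¹
  have e : -y * (f t)⁻¹ * (f t)⁻¹ = -y / f t ^ 2 := by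
    field_simp
  rw [e] at h1
  refine h1.congr' ?_
  have h2 : ∀ᶠ s in 𝓝[S \ {t}] t, f s ≠ 0 := hf.tendsto_diff.eventually_ne h0
  filter_upwards [self_mem_nhdsWithin, h2] with s hs hs0
  have : s - t ≠ 0 := sub_ne_zero.2 hs.2
  field_simp
  ring

theorem HasD.unique (hf : HasD f S y t) (hg : HasD f S z t) (hne : (𝓝[S \ {t}] t).NeBot) :
    y = z :=
  tendsto_nhds_unique hf hg

theorem HasD.comp_add (c : Q) (hf : HasD f S y (c + t)) (hT : ∀ s ∈ T, c + s ∈ S) :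
    HasD (fun s => f (c + s)) T y t := by
  rw [hasD_iff] at hf ⊢
  intro ε hε
  obtain ⟨δ, hδ, h⟩ := hf ε hε
  refine ⟨δ, hδ, fun s hs hst => ?_⟩
  have := h (c + s) (hT s hs) (by simpa using hst)
  simpa using this

theorem HasD.comp_neg (hf : HasD f S y (-t)) (hT : ∀ s ∈ T, -s ∈ S) :
    HasD (fun s => f (-s)) T (-y) t := by
  rw [hasD_iff] at hf ⊢
  intro ε hε
  obtain ⟨δ, hδ, h⟩ := hf ε hε
  refine ⟨δ, hδ, fun s hs hst => ?_⟩
  have e : -s - -t = -(s - t) := by ring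
  have := h (-s) (hT s hs) (by rwa [e, abs_neg])
  rw [e, abs_neg, neg_mul, ← mul_neg] at this
  exact this

/-- A positive derivative at one point gives comparison with the value at that point only;
monotonicity on an interval needs `CONT`. -/
theorem HasD.pos_near (hf : HasD f S y t) (hy : 0 < y) :
    ∃ δ > 0, ∀ s ∈ S, |s - t| < δ → (t < s → f t < f s) ∧ (s < t → f s < f t) := by
  obtain ⟨δ, hδ, h⟩ := tendsto_nhdsWithin_iff_abs.1 hf y hy
  have key : ∀ s ∈ S, |s - t| < δ → s ≠ t → 0 < (f s - f t) / (s - t) := by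
    intro s hs hst hne
    have := (abs_lt.1 (h s ⟨hs, hne⟩ hst)).1
    linarith
  refine ⟨δ, hδ, fun s hs hst => ⟨fun hlt => ?_, fun hlt => ?_⟩⟩
  · have := key s hs hst hlt.ne'
    rw [div_pos_iff_of_pos_right (sub_pos.2 hlt)] at this
    linarith
  · have := key s hs hst hlt.ne
    rcases div_pos_iff.1 this with h1 | h1 <;> linarith [h1.1, h1.2]

/-- This makes derivatives unique on order-convex sets with more than one point, end points
included. -/
theorem nhdsWithin_diff_neBot (hS : S.OrdConnected) (ht : t ∈ S) (hne : ∃ s ∈ S, s ≠ t) :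
    (𝓝[S \ {t}] t).NeBot := by
  obtain ⟨s, hs, hst⟩ := hne
  rw [(nhdsWithin_hasBasis (nhds_basis_abs_sub_lt t) (S \ {t})).neBot_iff]
  intro δ hδ
  rcases lt_or_gt_of_ne hst with h | h
  · refine ⟨max s (t - δ / 2), ?_, hS.out hs ht ⟨le_max_left _ _, max_le h.le (by linarith)⟩, ?_⟩
    · change |_| < δ
      rw [abs_lt]
      constructor
      · have := le_max_right s (t - δ / 2); linarith
      · have : max s (t - δ / 2) ≤ t := max_le h.le (by linarith)
        linarith
    · have : max s (t - δ / 2) < t := max_lt h (by linarith)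
      exact this.ne
  · refine ⟨min s (t + δ / 2), ?_, hS.out ht hs ⟨le_min h.le (by linarith), min_le_left _ _⟩, ?_⟩
    · change |_| < δ
      rw [abs_lt]
      constructor
      · have : t ≤ min s (t + δ / 2) := le_min h.le (by linarith)
        linarith
      · have := min_le_right s (t + δ / 2); linarith
    · have : t < min s (t + δ / 2) := lt_min h (by linarith)
      exact this.ne'

end Calculus

namespace RelFrame

/-! ### Calculus of definable functions from the continuity schema. -/

section DefinableCalculus

variable {B Q : Type*} {n : ℕ} [Field Q] [LinearOrder Q] [IsStrictOrderedRing Q]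
  {M : RelFrame B Q n}

theorem DefFun.abs {ι : Type*} {f : (ι → Q) → Q} (hf : M.DefFun f) : M.DefFun fun v => |f v| := by
  have h1 : M.DefFun fun v : ι ⊕ Fin 1 → Q => f fun i => v (.inl i) := hf.comap _
  have h2 : M.DefFun fun v : ι ⊕ Fin 1 → Q => v (.inr 0) := defFun_proj _
  refine (((DefPred.le (defFun_const 0) h1).and (DefPred.eq h2 h1)).or
    ((DefPred.lt h1 (defFun_const 0)).and (DefPred.eq h2 h1.neg))).congr fun v => ?_
  rcases le_or_gt 0 (f fun i => v (.inl i)) with h | h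
  · simp [h, abs_of_nonneg h, not_lt.2 h]
  · simp [h, abs_of_neg h, not_le.2 h]

/-- Definability of a unary function. -/
abbrev DefFun₁ (M : RelFrame B Q n) (F : Q → Q) : Prop := M.DefFun fun v : Fin 1 → Q => F (v 0)

/-- Definability of a unary predicate. -/
abbrev DefPred₁ (M : RelFrame B Q n) (P : Q → Prop) : Prop :=
  M.DefPred fun v : Fin 1 → Q => P (v 0)

theorem DefPred₁.comp {ι : Type*} {P : Q → Prop} (hP : M.DefPred₁ P) {f : (ι → Q) → Q}
    (hf : M.DefFun f) : M.DefPred fun v => P (f v) :=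
  DefPred.subst hP (f := fun _ => f) fun _ => hf

/-- Real induction for definable predicates. -/
theorem CONT.real_induction (hC : M.CONT) {P : Q → Prop} (hP : M.DefPred₁ P) {a b : Q}
    (hleft : ∀ x, a ≤ x → x ≤ b → (∀ z, a ≤ z → z < x → P z) → P x)
    (hright : ∀ x, a ≤ x → x < b → (∀ z, a ≤ z → z ≤ x → P z) →
      ∃ y, x < y ∧ ∀ z, x < z → z < y → z ≤ b → P z) :
    ∀ x, a ≤ x → x ≤ b → P x := by
  intro x0 hax0 hx0b
  have hab : a ≤ b := hax0.trans hx0b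
  -- The points up to which `P` holds form a definable set, so it has a supremum `σ`. It contains
  -- `a`, because there the premise of `hleft` is vacuous; `hleft` gives `P σ`, and `hright` leads
  -- beyond `σ` unless `σ = b`.
  have hd : M.DefPred₁ fun x => (a ≤ x ∧ x ≤ b) ∧ ∀ z, (a ≤ z ∧ z ≤ x) → P z := by
    refine ((DefPred.le (defFun_const a) (defFun_proj 0)).and
      (DefPred.le (defFun_proj 0) (defFun_const b))).and (DefPred.forall ?_)
    exact ((DefPred.le (defFun_const a) (defFun_proj _)).and
      (DefPred.le (defFun_proj _) (defFun_proj _))).imp (hP.comp (defFun_proj _))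
  obtain ⟨σ, hσ⟩ := hC.exists_isLUB (P := fun x => (a ≤ x ∧ x ≤ b) ∧ ∀ z, (a ≤ z ∧ z ≤ x) → P z) hd
    ⟨a, ⟨le_rfl, hab⟩, fun z hz => hleft z hz.1 (hz.2.trans hab) fun w h1 h2 =>
      absurd (h2.trans_le hz.2) (not_lt.2 h1)⟩ ⟨b, fun x hx => hx.1.2⟩
  have haσ : a ≤ σ := hσ.1 ⟨⟨le_rfl, hab⟩, fun z hz => hleft z hz.1 (hz.2.trans hab) fun w h1 h2 =>
      absurd (h2.trans_le hz.2) (not_lt.2 h1)⟩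
  have hσb : σ ≤ b := hσ.2 fun x hx => hx.1.2
  have hlt : ∀ z, a ≤ z → z < σ → P z := by
    intro z hz hzσ
    obtain ⟨x, hx, hzx⟩ := (lt_isLUB_iff hσ).1 hzσ
    exact hx.2 z ⟨hz, hzx.le⟩
  have hle : ∀ z, a ≤ z → z ≤ σ → P z := by
    intro z hz hzσ
    rcases hzσ.lt_or_eq with h | h
    · exact hlt z hz h
    · rw [h]
      exact hleft σ haσ hσb hlt
  rcases hσb.lt_or_eq with h | h
  · obtain ⟨y, hy, hyP⟩ := hright σ haσ h hle
    exfalso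
    obtain ⟨x, hx1, hx2⟩ := exists_between (lt_min hy h)
    have : x ≤ σ := by
      refine hσ.1 ⟨⟨haσ.trans hx1.le, (hx2.trans_le (min_le_right _ _)).le⟩, fun z hz => ?_⟩
      rcases le_or_gt z σ with h1 | h1
      · exact hle z hz.1 h1
      · exact hyP z h1 (hz.2.trans_lt (hx2.trans_le (min_le_left _ _)))
          (hz.2.trans (hx2.trans_le (min_le_right _ _)).le)
    exact absurd hx1 (not_lt.2 this)
  · exact hle x0 hax0 (h ▸ hx0b)

variable [TopologicalSpace Q] [OrderTopology Q]

/-- Through this, derivatives of definable functions are again definable, and `CONT` becomes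
applicable to velocities. -/
theorem DefPred₁.hasD {S : Set Q} (hS : M.DefPred₁ fun x => x ∈ S) {f : Q → Q}
    (hf : M.DefFun₁ f) {ι : Type*} {u w : (ι → Q) → Q} (hu : M.DefFun u) (hw : M.DefFun w) :
    M.DefPred fun v => HasD f S (u v) (w v) := by
  have key : M.DefPred fun v => ∀ ε, 0 < ε → ∃ δ, 0 < δ ∧ ∀ s, s ∈ S → |s - w v| < δ →
      |f s - f (w v) - (s - w v) * u v| ≤ ε * |s - w v| := by
    refine DefPred.forall ((DefPred.lt (defFun_const 0) (defFun_proj _)).imp (DefPred.exists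
      ((DefPred.lt (defFun_const 0) (defFun_proj _)).and (DefPred.forall ?_))))
    have hu' : M.DefFun fun v : ((ι ⊕ Fin 1) ⊕ Fin 1) ⊕ Fin 1 → Q =>
        u (fun i => v (.inl (.inl (.inl i)))) := hu.comap _
    have hw' : M.DefFun fun v : ((ι ⊕ Fin 1) ⊕ Fin 1) ⊕ Fin 1 → Q =>
        w (fun i => v (.inl (.inl (.inl i)))) := hw.comap _
    have hs : M.DefFun fun v : ((ι ⊕ Fin 1) ⊕ Fin 1) ⊕ Fin 1 → Q => v (.inr 0) := defFun_proj _
    refine (hS.comp hs).imp ((DefPred.lt (hs.sub hw').abs (defFun_proj _)).imp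
      (DefPred.le (((DefFun.comp hf hs).sub (DefFun.comp hf hw')).sub
        ((hs.sub hw').mul hu')).abs ((defFun_proj _).mul (hs.sub hw').abs)))
  exact key.congr fun v => hasD_iff.symm

/-- A function which is increasing at its zeros stays positive. -/
theorem CONT.pos_of_hasD_pos_at_zeros (hC : M.CONT) {f : Q → Q} (hf : M.DefFun₁ f) {a b : Q}
    (hD : ∀ x, a ≤ x → x ≤ b → ∃ y, HasD f (Icc a b) y x ∧ (f x = 0 → 0 < y)) (ha : 0 ≤ f a) :
    ∀ x, a < x → x ≤ b → 0 < f x := by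
  have key := hC.real_induction (P := fun x => a < x → 0 < f x) (a := a) (b := b)
    ((DefPred.lt (defFun_const a) (defFun_proj 0)).imp (DefPred.lt (defFun_const 0) hf)) ?_ ?_
  · exact fun x h1 h2 => key x h1.le h2 h1
  -- A negative value at `x` contradicts positivity on the left by continuity. A zero at `x`
  -- contradicts it because the positive derivative makes `f` negative just before.
  · intro x hax hxb h hlt
    obtain ⟨y, hy, h0⟩ := hD x hax hxb
    by_contra hneg
    rcases (not_lt.1 hneg).lt_or_eq with hneg | hz
    · obtain ⟨δ, hδ, hn⟩ := hy.near (ε := -f x) (by linarith)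
      obtain ⟨z, hz1, hz2⟩ := exists_between (max_lt hlt (sub_lt_self x hδ))
      have hz3 := (le_max_left _ _).trans_lt hz1
      have hz4 := (le_max_right _ _).trans_lt hz1
      have h1 := h z hz3.le hz2 hz3
      have h2 := hn z ⟨hz3.le, hz2.le.trans hxb⟩ (by rw [abs_lt]; constructor <;> linarith)
      rw [abs_lt] at h2
      linarith [h2.2]
    · obtain ⟨δ, hδ, hn⟩ := hy.pos_near (h0 hz)
      obtain ⟨z, hz1, hz2⟩ := exists_between (max_lt hlt (sub_lt_self x hδ))
      have hz3 := (le_max_left _ _).trans_lt hz1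
      have hz4 := (le_max_right _ _).trans_lt hz1
      have h1 := h z hz3.le hz2 hz3
      have h2 := (hn z ⟨hz3.le, hz2.le.trans hxb⟩ (by rw [abs_lt]; constructor <;> linarith)).2 hz2
      linarith
  · intro x hax hxb h
    obtain ⟨y, hy, h0⟩ := hD x hax hxb.le
    have hx0 : 0 ≤ f x := by
      rcases hax.lt_or_eq with h1 | h1
      · exact (h x hax le_rfl h1).le
      · rwa [← h1]
    rcases hx0.lt_or_eq with hpos | hz
    · obtain ⟨δ, hδ, hn⟩ := hy.near hpos
      refine ⟨x + δ, by linarith, fun z hz1 hz2 hzb _ => ?_⟩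
      have h2 := hn z ⟨hax.trans hz1.le, hzb⟩ (by rw [abs_lt]; constructor <;> linarith)
      rw [abs_lt] at h2
      linarith [h2.1]
    · obtain ⟨δ, hδ, hn⟩ := hy.pos_near (h0 hz.symm)
      refine ⟨x + δ, by linarith, fun z hz1 hz2 hzb _ => ?_⟩
      have h2 := (hn z ⟨hax.trans hz1.le, hzb⟩ (by rw [abs_lt]; constructor <;> linarith)).1 hz1
      linarith

/-- `f - f a` vanishes at `a` and increases at each of its zeros, so it is positive afterwards; no
mean value theorem is needed. -/
theorem CONT.strictMonoOn (hC : M.CONT) {f : Q → Q} (hf : M.DefFun₁ f) {J : Set Q}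
    (hJ : J.OrdConnected) (hD : ∀ x ∈ J, ∃ y, HasD f J y x ∧ 0 < y) : StrictMonoOn f J := by
  intro a ha b hb hab
  have h1 := hC.pos_of_hasD_pos_at_zeros (f := fun x => f x - f a) (a := a) (b := b)
    (hf.sub (defFun_const _)) (fun x hax hxb => by
      obtain ⟨y, hy, h0⟩ := hD x (hJ.out ha hb ⟨hax, hxb⟩)
      refine ⟨y, ?_, fun _ => h0⟩
      simpa using (hy.mono (hJ.out ha hb)).sub (hasD_const (f a))) (by simp) b hab le_rfl
  simpa using h1

/-- A definable continuous function on a closed interval attains its maximum. -/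
theorem CONT.exists_max (hC : M.CONT) {f : Q → Q} (hf : M.DefFun₁ f) {a b : Q} (hab : a ≤ b)
    (hc : ∀ x, a ≤ x → x ≤ b → ∀ ε > 0, ∃ δ > 0, ∀ s ∈ Icc a b, |s - x| < δ → |f s - f x| < ε) :
    ∃ m ∈ Icc a b, ∀ z ∈ Icc a b, f z ≤ f m := by
  by_contra hno
  push Not at hno
  -- The induction is on "some value of `f` exceeds all values on `[a, x]`". At `x = b` that value
  -- would exceed itself.
  have key := hC.real_induction (a := a) (b := b)
    (P := fun x => ∃ y, (a ≤ y ∧ y ≤ b) ∧ ∀ z, (a ≤ z ∧ z ≤ x) → f z < f y) ?_ ?_ ?_ b hab le_rfl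
  · obtain ⟨y, hy, h⟩ := key
    exact lt_irrefl _ (h y hy)
  · refine DefPred.exists (((DefPred.le (defFun_const _) (defFun_proj _)).and
        (DefPred.le (defFun_proj _) (defFun_const _))).and (DefPred.forall ?_))
    exact ((DefPred.le (defFun_const _) (defFun_proj _)).and
        (DefPred.le (defFun_proj _) (defFun_proj _))).imp
        (DefPred.lt (hf.comp (defFun_proj _)) (hf.comp (defFun_proj _)))
  · intro x hax hxb h
    obtain ⟨y, hy, hxy⟩ := hno x ⟨hax, hxb⟩
    obtain ⟨δ, hδ, hn⟩ := hc x hax hxb (f y - f x) (by linarith)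
    have hnear : ∀ z, a ≤ z → z ≤ x → x - δ < z → f z < f y := by
      intro z h1 h2 h3
      have h4 := hn z ⟨h1, h2.trans hxb⟩ (by rw [abs_lt]; constructor <;> linarith)
      rw [abs_lt] at h4
      linarith [h4.2]
    rcases hax.lt_or_eq with hlt | rfl
    · obtain ⟨w, hw1, hw2⟩ := exists_between (max_lt hlt (sub_lt_self x hδ))
      have hw3 := (le_max_left _ _).trans_lt hw1
      have hw4 := (le_max_right _ _).trans_lt hw1
      obtain ⟨y', hy', h'⟩ := h w hw3.le hw2
      rcases le_total (f y) (f y') with hyy | hyy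
      · refine ⟨y', hy', fun z hz => ?_⟩
        rcases le_or_gt z w with h5 | h5
        · exact h' z ⟨hz.1, h5⟩
        · exact (hnear z hz.1 hz.2 (hw4.trans h5)).trans_le hyy
      · refine ⟨y, hy, fun z hz => ?_⟩
        rcases le_or_gt z w with h5 | h5
        · exact (h' z ⟨hz.1, h5⟩).trans_le hyy
        · exact hnear z hz.1 hz.2 (hw4.trans h5)
    · exact ⟨y, hy, fun z hz => hnear z hz.1 hz.2 (by linarith [hz.1])⟩
  · intro x hax hxb h
    obtain ⟨y, hy, hyP⟩ := h x hax le_rfl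
    have hxy := hyP x ⟨hax, le_rfl⟩
    obtain ⟨δ, hδ, hn⟩ := hc x hax hxb.le (f y - f x) (by linarith)
    refine ⟨x + δ, by linarith, fun z hz1 hz2 hzb => ⟨y, hy, fun w hw => ?_⟩⟩
    rcases le_or_gt w x with h1 | h1
    · exact hyP w ⟨hw.1, h1⟩
    · have h4 := hn w ⟨hw.1, hw.2.trans hzb⟩ (by rw [abs_lt]; constructor <;> linarith [hw.2])
      rw [abs_lt] at h4
      linarith [h4.2]

/-- A derivative without zeros has constant sign. -/
theorem CONT.deriv_pos (hC : M.CONT) {f f' : Q → Q} (hf : M.DefFun₁ f) {J : Set Q}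
    (hJ : J.OrdConnected) (hD : ∀ x ∈ J, HasD f J (f' x) x) (h0 : ∀ x ∈ J, f' x ≠ 0)
    {a : Q} (ha : a ∈ J) (hpos : 0 < f' a) : ∀ x ∈ J, 0 < f' x := by
  -- Darboux's argument: if `g'` is positive at `u` and negative at `v > u`, a maximum on `[u, v]`
  -- is interior in the direction needed, and either sign of `g'` there yields a larger value
  -- nearby. The opposite order of signs is treated with `-f`.
  have key : ∀ (g g' : Q → Q), M.DefFun₁ g → (∀ x ∈ J, HasD g J (g' x) x) →
      (∀ x ∈ J, g' x ≠ 0) → ∀ u ∈ J, ∀ v ∈ J, u < v → 0 < g' u → g' v < 0 → False := by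
    intro g g' hg hD h0 u hu v hv huv hpu hnv
    have hI : Icc u v ⊆ J := hJ.out hu hv
    obtain ⟨m, hm, hmax⟩ := hC.exists_max hg huv.le fun x h1 h2 ε hε =>
      ((hD x (hI ⟨h1, h2⟩)).mono hI).near hε
    rcases lt_or_gt_of_ne (h0 m (hI hm)) with hneg | hp
    · have hum : u < m := by
        rcases hm.1.lt_or_eq with h | h
        · exact h
        · rw [← h] at hneg; exact absurd hneg (not_lt.2 hpu.le)
      obtain ⟨δ, hδ, hn⟩ := ((hD m (hI hm)).neg).pos_near (neg_pos.2 hneg)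
      obtain ⟨z, hz1, hz2⟩ := exists_between (max_lt hum (sub_lt_self m hδ))
      have hz3 := (le_max_left _ _).trans_lt hz1
      have hz4 := (le_max_right _ _).trans_lt hz1
      have hzI : z ∈ Icc u v := ⟨hz3.le, hz2.le.trans hm.2⟩
      have h1 := (hn z (hI hzI) (by rw [abs_lt]; constructor <;> linarith)).2 hz2
      linarith [hmax z hzI]
    · have hmv : m < v := by
        rcases hm.2.lt_or_eq with h | h
        · exact h
        · rw [h] at hp; exact absurd hp (not_lt.2 hnv.le)
      obtain ⟨δ, hδ, hn⟩ := (hD m (hI hm)).pos_near hp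
      obtain ⟨z, hz1, hz2⟩ := exists_between (lt_min hmv (lt_add_of_pos_right m hδ))
      have hz3 := hz2.trans_le (min_le_left _ _)
      have hz4 := hz2.trans_le (min_le_right _ _)
      have hzI : z ∈ Icc u v := ⟨hm.1.trans hz1.le, hz3.le⟩
      have h1 := (hn z (hI hzI) (by rw [abs_lt]; constructor <;> linarith)).1 hz1
      linarith [hmax z hzI]
  intro x hx
  by_contra hneg
  have hneg : f' x < 0 := lt_of_le_of_ne (not_lt.1 hneg) (h0 x hx)
  rcases lt_trichotomy a x with h | h | h
  · exact key f f' hf hD h0 a ha x hx h hpos hneg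
  · rw [h] at hpos; exact absurd hpos (not_lt.2 hneg.le)
  · exact key (fun s => -f s) (fun s => -f' s) hf.neg (fun s hs => (hD s hs).neg)
      (fun s hs => neg_ne_zero.2 (h0 s hs)) x hx a ha h (neg_pos.2 hneg) (neg_neg_of_pos hpos)

/-- Comparison of two clocks: if matched events are given by `G s = H σ`, and the rate of `G`
exceeds that of `H` at matched events, then less time passes for the first clock. -/
theorem CONT.clock_comparison (hC : M.CONT) {G H g h : Q → Q} (hG : M.DefFun₁ G)
    (hH : M.DefFun₁ H) {s₁ s₂ σ₁ σ₂ : Q} (hσ : σ₁ < σ₂)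
    (hGD : ∀ s ∈ Icc s₁ s₂, HasD G (Icc s₁ s₂) (g s) s)
    (hHD : ∀ s ∈ Icc σ₁ σ₂, HasD H (Icc σ₁ σ₂) (h s) s)
    (hmono : StrictMonoOn G (Icc s₁ s₂)) (h1 : G s₁ = H σ₁) (h2 : G s₂ = H σ₂)
    (hgh : ∀ s ∈ Icc s₁ s₂, ∀ σ ∈ Icc σ₁ σ₂, G s = H σ → h σ < g s) : s₂ - s₁ < σ₂ - σ₁ := by
  by_contra hle
  rw [not_lt] at hle
  -- With `H` shifted to start at `s₁`, the difference starts at zero and increases at its zeros.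
  -- Hence `G` is above `H σ₂ = G s₂` at `s₁ + (σ₂ - σ₁)`, which by assumption is at most `s₂`: a
  -- contradiction to monotonicity.
  have h3 := hC.pos_of_hasD_pos_at_zeros (f := fun s => G s - H (σ₁ - s₁ + s)) (a := s₁)
    (b := s₁ + (σ₂ - σ₁)) ?_ ?_ ?_ (s₁ + (σ₂ - σ₁)) (by linarith) le_rfl
  · have h4 : G (s₁ + (σ₂ - σ₁)) ≤ G s₂ :=
      hmono.monotoneOn ⟨by linarith, by linarith⟩ ⟨by linarith, le_rfl⟩ (by linarith)
    have h5 : σ₁ - s₁ + (s₁ + (σ₂ - σ₁)) = σ₂ := by ring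
    rw [h5] at h3
    linarith
  · exact hG.sub (hH.comp ((defFun_const _).add (defFun_proj _)))
  · intro x hx1 hx2
    have hx : x ∈ Icc s₁ s₂ := ⟨hx1, by linarith⟩
    have hx' : σ₁ - s₁ + x ∈ Icc σ₁ σ₂ := ⟨by linarith, by linarith⟩
    refine ⟨g x - h (σ₁ - s₁ + x), ((hGD x hx).mono ?_).sub ((hHD _ hx').comp_add _ ?_), ?_⟩
    · exact Icc_subset_Icc le_rfl (by linarith)
    · intro s hs
      exact ⟨by linarith [hs.1], by linarith [hs.2]⟩
    · intro h0
      have := hgh x hx _ hx' (by linarith)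
      linarith
  · have h5 : σ₁ - s₁ + s₁ = σ₁ := by ring
    rw [h5]
    linarith

end DefinableCalculus

end RelFrame

/-! ### The Minkowski form, null lines, and generation by null vectors. -/

section Minkowski

variable {Q : Type*} [Field Q] [LinearOrder Q] [IsStrictOrderedRing Q] {n : ℕ}

/-- The Minkowski form. -/
def mink (p q : Coord Q n) : Q := p 0 * q 0 - spaceComp p ⬝ᵥ spaceComp q

@[simp] theorem spaceComp_add (p q : Coord Q n) :
    spaceComp (p + q) = spaceComp p + spaceComp q := rfl
@[simp] theorem spaceComp_sub (p q : Coord Q n) :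
    spaceComp (p - q) = spaceComp p - spaceComp q := rfl
@[simp] theorem spaceComp_neg (p : Coord Q n) : spaceComp (-p) = -spaceComp p := rfl
@[simp] theorem spaceComp_smul (c : Q) (p : Coord Q n) : spaceComp (c • p) = c • spaceComp p := rfl
@[simp] theorem spaceComp_zero : spaceComp (0 : Coord Q n) = 0 := rfl
@[simp] theorem spaceComp_cons (c : Q) (s : Fin n → Q) :
    spaceComp (Fin.cons c s : Coord Q n) = s := rfl

theorem coord_ext {p q : Coord Q n} (h0 : p 0 = q 0) (h1 : spaceComp p = spaceComp q) : p = q := by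
  ext i
  refine Fin.cases h0 (fun j => ?_) i
  exact congrFun h1 j

theorem mink_comm (p q : Coord Q n) : mink p q = mink q p := by
  simp only [mink, dotProduct_comm, mul_comm]

theorem mink_add_left (p q r : Coord Q n) : mink (p + q) r = mink p r + mink q r := by
  simp only [mink, spaceComp_add, add_dotProduct, Pi.add_apply]; ring

theorem mink_add_right (p q r : Coord Q n) : mink p (q + r) = mink p q + mink p r := by
  simp only [mink, spaceComp_add, dotProduct_add, Pi.add_apply]; ring

theorem mink_sub_left (p q r : Coord Q n) : mink (p - q) r = mink p r - mink q r := by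
  simp only [mink, spaceComp_sub, sub_dotProduct, Pi.sub_apply]; ring

theorem mink_sub_right (p q r : Coord Q n) : mink p (q - r) = mink p q - mink p r := by
  simp only [mink, spaceComp_sub, dotProduct_sub, Pi.sub_apply]; ring

theorem mink_smul_left (c : Q) (p q : Coord Q n) : mink (c • p) q = c * mink p q := by
  simp only [mink, spaceComp_smul, smul_dotProduct, Pi.smul_apply, smul_eq_mul]; ring

theorem mink_smul_right (c : Q) (p q : Coord Q n) : mink p (c • q) = c * mink p q := by
  simp only [mink, spaceComp_smul, dotProduct_smul, Pi.smul_apply, smul_eq_mul]; ring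

theorem mink_zero_left (q : Coord Q n) : mink 0 q = 0 := by simp [mink]

theorem mink_neg_left (p q : Coord Q n) : mink (-p) q = -mink p q := by
  simp only [mink, spaceComp_neg, neg_dotProduct, Pi.neg_apply]; ring

theorem mink_neg_right (p q : Coord Q n) : mink p (-q) = -mink p q := by
  simp only [mink, spaceComp_neg, dotProduct_neg, Pi.neg_apply]; ring

theorem eq_zero_of_dotProduct_self {m : ℕ} {v : Fin m → Q} (h : v ⬝ᵥ v = 0) : v = 0 := by
  ext i
  have h1 : ∀ i ∈ Finset.univ, v i * v i = 0 :=
    (Finset.sum_eq_zero_iff_of_nonneg fun i _ => mul_self_nonneg _).1 h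
  exact mul_self_eq_zero.1 (h1 i (Finset.mem_univ _))

theorem dotProduct_self_nonneg' {m : ℕ} (v : Fin m → Q) : 0 ≤ v ⬝ᵥ v :=
  Finset.sum_nonneg fun _ _ => mul_self_nonneg _

/-- A null vector with zero time component vanishes. -/
theorem eq_zero_of_mink_self {p : Coord Q n} (h : mink p p = 0) (h0 : p 0 = 0) : p = 0 := by
  refine coord_ext h0 (eq_zero_of_dotProduct_self ?_)
  simp only [mink, h0] at h
  linarith

/-- The null relation. -/
def Lightlike (p q : Coord Q n) : Prop := mink (p - q) (p - q) = 0

theorem mink_self_sub (p q : Coord Q n) :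
    mink (p - q) (p - q) = mink p p - 2 * mink p q + mink q q := by
  rw [mink_sub_left, mink_sub_right, mink_sub_right, mink_comm q p]; ring

theorem mink_self_add (p q : Coord Q n) :
    mink (p + q) (p + q) = mink p p + 2 * mink p q + mink q q := by
  rw [mink_add_left, mink_add_right, mink_add_right, mink_comm q p]; ring

theorem Lightlike.symm {p q : Coord Q n} (h : Lightlike p q) : Lightlike q p := by
  unfold Lightlike at *
  rw [← neg_sub, mink_neg_left, mink_neg_right, neg_neg, h]

theorem lightlike_refl (p : Coord Q n) : Lightlike p p := by
  simp [Lightlike, mink_zero_left]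

/-- Orthogonal null vectors are parallel. -/
theorem null_parallel {x y : Coord Q n} (hx0 : x ≠ 0) (hx : mink x x = 0) (hy : mink y y = 0)
    (hxy : mink x y = 0) : ∃ c : Q, y = c • x := by
  have h0 : x 0 ≠ 0 := fun h => hx0 (eq_zero_of_mink_self hx h)
  -- Matching the time components leaves a null vector with zero time component.
  refine ⟨y 0 / x 0, sub_eq_zero.1 (eq_zero_of_mink_self ?_ ?_)⟩
  · rw [mink_self_sub, mink_smul_right, mink_smul_left, mink_smul_right, mink_comm y x, hx, hy, hxy]
    ring
  · simp [h0]

theorem lightlike_iff_mink_eq_zero {a u v : Coord Q n} (hu : mink u u = 0) (hv : mink v v = 0) :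
    Lightlike (a + u) (a + v) ↔ mink u v = 0 := by
  unfold Lightlike
  rw [add_sub_add_left_eq_sub, mink_self_sub, hu, hv]
  constructor <;> intro h <;> linarith

theorem lightlike_add_self {a u : Coord Q n} : Lightlike (a + u) a ↔ mink u u = 0 := by
  simp [Lightlike]

/-- A null line consists of the points null related to two given points of it, so null lines are
visible to any bijection preserving the null relation. -/
theorem mem_null_line_iff {a u q : Coord Q n} (hu0 : u ≠ 0) (hu : mink u u = 0) :
    (Lightlike q a ∧ Lightlike q (a + u)) ↔ ∃ c : Q, q = a + c • u := by
  constructor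
  · rintro ⟨h1, h2⟩
    have e : q - (a + u) = (q - a) - u := by abel
    unfold Lightlike at h1 h2
    rw [e, mink_self_sub, h1, hu] at h2
    obtain ⟨c, hc⟩ := null_parallel hu0 hu h1 (by rw [mink_comm]; linarith)
    exact ⟨c, by rw [← hc]; abel⟩
  · rintro ⟨c, rfl⟩
    refine ⟨lightlike_add_self.2 (by rw [mink_smul_left, mink_smul_right, hu]; ring),
      (lightlike_iff_mink_eq_zero (by rw [mink_smul_left, mink_smul_right, hu]; ring) hu).2
        (by rw [mink_smul_left, hu]; ring)⟩

/-- There is a unique point on the null line through `b` and `b'` which is lightlike related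
to `r`. -/
def UniqueLink (r b b' : Coord Q n) : Prop :=
  ∃! q, (Lightlike q b ∧ Lightlike q b') ∧ Lightlike r q

theorem uniqueLink_iff {r b u : Coord Q n} (hu0 : u ≠ 0) (hu : mink u u = 0) :
    UniqueLink r b (b + u) ↔ ∃! c : Q, Lightlike r (b + c • u) := by
  unfold UniqueLink
  simp only [mem_null_line_iff hu0 hu]
  constructor
  · rintro ⟨q, ⟨⟨c, rfl⟩, hc⟩, h⟩
    refine ⟨c, hc, fun d hd => ?_⟩
    have := h _ ⟨⟨d, rfl⟩, hd⟩
    rw [add_right_inj] at this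
    exact smul_left_injective Q hu0 this
  · rintro ⟨c, hc, h⟩
    refine ⟨_, ⟨⟨c, rfl⟩, hc⟩, ?_⟩
    rintro q ⟨⟨d, rfl⟩, hd⟩
    rw [h d hd]

/-- Sliding a point along `u` slides its links on the other line by the same amount, so uniqueness
of the link is the same for all points of the first line. With `uniqueLink_of_not_parallel` this
detects parallelism of null lines from the null relation alone. -/
theorem uniqueLink_of_parallel {a b u r₁ r₂ : Coord Q n} (hu0 : u ≠ 0) (hu : mink u u = 0)
    (h1 : Lightlike r₁ a ∧ Lightlike r₁ (a + u)) (h2 : Lightlike r₂ a ∧ Lightlike r₂ (a + u))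
    (h : UniqueLink r₁ b (b + u)) : UniqueLink r₂ b (b + u) := by
  obtain ⟨x, rfl⟩ := (mem_null_line_iff hu0 hu).1 h1
  obtain ⟨y, rfl⟩ := (mem_null_line_iff hu0 hu).1 h2
  rw [uniqueLink_iff hu0 hu] at h ⊢
  have key : ∀ c d : Q, c - x = d - y → (Lightlike (a + x • u) (b + c • u) ↔
      Lightlike (a + y • u) (b + d • u)) := by
    intro c d hcd
    have : a + x • u - (b + c • u) = a + y • u - (b + d • u) := by
      have e : c = d - y + x := by linarith
      rw [e]
      module
    unfold Lightlike
    rw [this]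
  obtain ⟨c, hc, hcu⟩ := h
  refine ⟨c - x + y, (key c _ (by ring)).1 hc, fun d hd => ?_⟩
  have := hcu (d - y + x) ((key _ d (by ring)).2 hd)
  linarith

/-- The link equation is linear in the parameter on the second line, with coefficient proportional
to `mink (a - b) w + x * mink v w`. The position `x` on the first line can be chosen to make this
sum `1` or `0`; in the latter case there is no link or every point is one. -/
theorem uniqueLink_of_not_parallel {a b v w : Coord Q n} (hv : mink v v = 0)
    (hw : mink w w = 0) (hvw : mink v w ≠ 0) :
    (∃ r, (Lightlike r a ∧ Lightlike r (a + v)) ∧ UniqueLink r b (b + w)) ∧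
    ∃ r, (Lightlike r a ∧ Lightlike r (a + v)) ∧ ¬ UniqueLink r b (b + w) := by
  have hv0 : v ≠ 0 := by rintro rfl; exact hvw (mink_zero_left _)
  have hw0 : w ≠ 0 := by rintro rfl; exact hvw (by rw [mink_comm, mink_zero_left])
  simp only [mem_null_line_iff hv0 hv, uniqueLink_iff hw0 hw]
  have key : ∀ x c : Q, Lightlike (a + x • v) (b + c • w) ↔
      mink (a - b) (a - b) + 2 * x * mink (a - b) v
        = 2 * c * (mink (a - b) w + x * mink v w) := by
    intro x c
    have e : a + x • v - (b + c • w) = (a - b) + x • v - c • w := by abel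
    unfold Lightlike
    rw [e, mink_self_sub, mink_self_add]
    simp only [mink_smul_left, mink_smul_right, hv, hw, mink_add_left]
    constructor <;> intro h <;> linarith
  constructor
  · refine ⟨_, ⟨(1 - mink (a - b) w) / mink v w, rfl⟩, ?_⟩
    simp only [key, div_mul_cancel₀ _ hvw]
    refine ⟨(mink (a - b) (a - b) + 2 * ((1 - mink (a - b) w) / mink v w) * mink (a - b) v) / 2,
      ?_, fun d hd => ?_⟩
    · simp only
      ring
    · rw [hd]
      ring
  · refine ⟨_, ⟨-mink (a - b) w / mink v w, rfl⟩, ?_⟩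
    simp only [key, div_mul_cancel₀ _ hvw]
    rintro ⟨c, hc, hu⟩
    have h1 := hu (c + 1) (by simp only [add_neg_cancel, mul_zero] at hc ⊢; exact hc)
    linarith

/-- The vector with time component `c` and space component `c • s`. -/
def nullVec (c : Q) (s : Fin n → Q) : Coord Q n := Fin.cons c (c • s)

theorem mink_nullVec_self (c : Q) {s : Fin n → Q} (hs : s ⬝ᵥ s = 1) :
    mink (nullVec c s) (nullVec c s) = 0 := by
  simp [mink, nullVec, hs]

theorem mink_nullVec_right (p : Coord Q n) (c : Q) (s : Fin n → Q) :
    mink p (nullVec c s) = c * (p 0 - spaceComp p ⬝ᵥ s) := by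
  simp only [mink, nullVec, Fin.cons_zero, spaceComp_cons, dotProduct_smul, smul_eq_mul]
  ring

theorem nullVec_add_neg (c : Q) (s : Fin n → Q) :
    nullVec c s + nullVec c (-s) = (2 * c) • (Pi.single 0 1 : Coord Q n) := by
  refine coord_ext ?_ ?_
  · simp [nullVec]; ring
  · ext i; simp [nullVec, spaceComp]

theorem nullVec_sub_neg (c : Q) (s : Fin n → Q) :
    nullVec c s - nullVec c (-s) = (Fin.cons 0 ((2 * c) • s) : Coord Q n) := by
  refine coord_ext ?_ ?_
  · simp [nullVec]
  · ext i; simp [nullVec, spaceComp]; ring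

/-- The null vectors which are not orthogonal to a given null vector generate the whole space. -/
theorem addSubgroup_eq_top (hn : 2 ≤ n) {u : Coord Q n} (hu0 : u ≠ 0) (hu : mink u u = 0)
    (A : AddSubgroup (Coord Q n)) (hA : ∀ v, mink v v = 0 → mink u v ≠ 0 → v ∈ A) : A = ⊤ := by
  have h0 : u 0 ≠ 0 := fun h => hu0 (eq_zero_of_mink_self hu h)
  have hsq : spaceComp u ⬝ᵥ spaceComp u = u 0 ^ 2 := by
    simp only [mink] at hu; linarith
  -- The null vectors over `s` and `-s` have a sum on the time axis and a difference along `s`. The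
  -- scalar `c` is carried along because `A` is only a subgroup.
  have step : ∀ (s : Fin n → Q), s ⬝ᵥ s = 1 → (spaceComp u ⬝ᵥ s) ^ 2 ≠ u 0 ^ 2 → ∀ c : Q,
      (Fin.cons 0 (c • s) : Coord Q n) ∈ A ∧ c • (Pi.single 0 1 : Coord Q n) ∈ A := by
    intro s hs hne c
    rcases eq_or_ne c 0 with rfl | hc
    · refine ⟨?_, by simp⟩
      have : (Fin.cons 0 ((0 : Q) • s) : Coord Q n) = 0 := coord_ext rfl (by ext; simp)
      rw [this]
      exact A.zero_mem
    have hc2 : c / 2 ≠ 0 := by simpa using hc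
    have h1 : nullVec (c / 2) s ∈ A := by
      refine hA _ (mink_nullVec_self _ hs) ?_
      rw [mink_nullVec_right]
      refine mul_ne_zero hc2 fun h => hne ?_
      rw [sub_eq_zero.1 h]
    have h2 : nullVec (c / 2) (-s) ∈ A := by
      refine hA _ (mink_nullVec_self _ (by simpa using hs)) ?_
      rw [mink_nullVec_right, dotProduct_neg]
      refine mul_ne_zero hc2 fun h => hne ?_
      rw [show u 0 = -(spaceComp u ⬝ᵥ s) by linarith, neg_sq]
    have e : 2 * (c / 2) = c := by ring
    constructor
    · have := A.sub_mem h1 h2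
      rwa [nullVec_sub_neg, e] at this
    · have := A.add_mem h1 h2
      rwa [nullVec_add_neg, e] at this
  have hpos : 0 < u 0 ^ 2 := by positivity
  have main : ∀ (i : Fin n) (c : Q), (Fin.cons 0 (Pi.single i c) : Coord Q n) ∈ A ∧
      c • (Pi.single 0 1 : Coord Q n) ∈ A := by
    intro i c
    by_cases hi : (spaceComp u i) ^ 2 = u 0 ^ 2
    · obtain ⟨j, hj⟩ : ∃ j : Fin n, j ≠ i := by
        have : Nontrivial (Fin n) := Fin.nontrivial_iff_two_le.2 hn
        exact exists_ne i
      -- Here `u` points along the axis `i` in space, so a null vector over this axis may be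
      -- orthogonal to `u`. It is replaced by the units `(3/5, ±4/5)` in the plane of `i` and
      -- another axis `j`. They add up to `6/5` along `i`, whence the factor `5/6` below.
      have hs : ∀ ε : Q, ε ^ 2 = 1 →
          (Pi.single i (3 / 5) + Pi.single j (ε * (4 / 5)) : Fin n → Q) ⬝ᵥ
          (Pi.single i (3 / 5) + Pi.single j (ε * (4 / 5)) : Fin n → Q) = 1 := by
        intro ε hε
        simp [dotProduct_add, hj, hj.symm]
        linear_combination (16 / 25) * hε
      have huj : spaceComp u j = 0 := by
        have h1 : spaceComp u ⬝ᵥ spaceComp u = ∑ k, spaceComp u k * spaceComp u k := rfl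
        rw [hsq, ← hi, ← Finset.add_sum_erase _ _ (Finset.mem_univ i)] at h1
        have h2 : ∑ k ∈ Finset.univ.erase i, spaceComp u k * spaceComp u k = 0 := by linarith
        have h3 := (Finset.sum_eq_zero_iff_of_nonneg fun i _ => mul_self_nonneg _).1 h2 j
          (Finset.mem_erase.2 ⟨hj, Finset.mem_univ _⟩)
        exact mul_self_eq_zero.1 h3
      have hd : ∀ ε : Q, (spaceComp u ⬝ᵥ
          (Pi.single i (3 / 5) + Pi.single j (ε * (4 / 5)) : Fin n → Q)) ^ 2 ≠ u 0 ^ 2 := by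
        intro ε
        simp only [dotProduct_add, dotProduct_single, huj, zero_mul, add_zero, mul_pow, hi]
        intro h
        nlinarith
      have h1 := step _ (hs 1 (by norm_num)) (hd 1) (c * (5 / 6))
      have h2 := step _ (hs (-1) (by norm_num)) (hd (-1)) (c * (5 / 6))
      refine ⟨?_, (step _ (hs 1 (by norm_num)) (hd 1) c).2⟩
      have := A.add_mem h1.1 h2.1
      convert this using 1
      refine coord_ext (by simp) ?_
      ext k
      by_cases hki : k = i
      · subst hki
        simp [hj.symm]
        ring
      · by_cases hkj : k = j
        · subst hkj
          simp [hki]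
        · simp [hki, hkj]
    · have := step (Pi.single i 1) (by simp) (by simpa using hi) c
      rwa [show c • (Pi.single i 1 : Fin n → Q) = Pi.single i c by
        rw [← Pi.single_smul]; simp] at this
  rw [AddSubgroup.eq_top_iff']
  intro w
  have hw : w = w 0 • (Pi.single 0 1 : Coord Q n) +
      ∑ i, (Fin.cons 0 (Pi.single i (spaceComp w i)) : Coord Q n) := by
    refine coord_ext (by simp [Finset.sum_apply]) ?_
    ext k
    simp only [spaceComp, Pi.add_apply, Pi.smul_apply, Finset.sum_apply, Fin.cons_succ]
    simp [Finset.sum_pi_single]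
  rw [hw]
  exact A.add_mem (main ⟨0, by omega⟩ _).2 (A.sum_mem fun i _ => (main i _).1)

end Minkowski

/-! ### The Alexandrov–Zeeman theorem over a Euclidean field. -/

section AlexandrovZeeman

variable {Q : Type*} [Field Q] [LinearOrder Q] [IsStrictOrderedRing Q] {n : ℕ}

/-- A bijection preserving the null relation in both directions. -/
def PreservesNull (f : Coord Q n ≃ Coord Q n) : Prop :=
  ∀ p q, Lightlike p q ↔ Lightlike (f p) (f q)

variable {f : Coord Q n ≃ Coord Q n}

theorem PreservesNull.null (hf : PreservesNull f) {a u : Coord Q n} (hu : mink u u = 0) :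
    mink (f (a + u) - f a) (f (a + u) - f a) = 0 :=
  (hf _ _).1 (lightlike_add_self.2 hu)

theorem PreservesNull.ne_zero {a u : Coord Q n} (hu0 : u ≠ 0) : f (a + u) - f a ≠ 0 := by
  intro h
  have := f.injective (sub_eq_zero.1 h)
  exact hu0 (by simpa using this)

theorem PreservesNull.uniqueLink (hf : PreservesNull f) {r b b' : Coord Q n} :
    UniqueLink r b b' ↔ UniqueLink (f r) (f b) (f b') := by
  unfold UniqueLink
  constructor
  · rintro ⟨q, hq, h⟩
    refine ⟨f q, by simpa only [← hf _ _] using hq, fun q' hq' => ?_⟩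
    obtain ⟨q', rfl⟩ := f.surjective q'
    simp only [← hf _ _] at hq'
    rw [h q' hq']
  · rintro ⟨q, hq, h⟩
    obtain ⟨q, rfl⟩ := f.surjective q
    simp only [← hf _ _] at hq
    refine ⟨q, hq, fun q' hq' => f.injective (h _ ?_)⟩
    simpa only [← hf _ _] using hq'

/-- Parallel null lines are mapped to parallel null lines. -/
theorem PreservesNull.parallel (hf : PreservesNull f) {u : Coord Q n} (hu0 : u ≠ 0)
    (hu : mink u u = 0) (a b : Coord Q n) :
    mink (f (a + u) - f a) (f (b + u) - f b) = 0 := by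
  by_contra hne
  obtain ⟨⟨r₁, h1, h1'⟩, r₂, h2, h2'⟩ := uniqueLink_of_not_parallel (a := f a) (b := f b)
    (hf.null hu) (hf.null hu) hne
  obtain ⟨r₁, rfl⟩ := f.surjective r₁
  obtain ⟨r₂, rfl⟩ := f.surjective r₂
  rw [add_sub_cancel, ← hf.uniqueLink] at h1' h2'
  rw [add_sub_cancel, ← hf, ← hf] at h1 h2
  exact h2' (uniqueLink_of_parallel hu0 hu h1 h2 h1')

/-- The images of opposite sides are parallel by `PreservesNull.parallel`, so the image
quadrilateral closes as `v' + α • u' = u' + β • v'`. Pairing with the null vector `v'`, which is not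
orthogonal to `u'`, gives `α = 1`. -/
theorem PreservesNull.parallelogram (hf : PreservesNull f) {u v : Coord Q n}
    (hu : mink u u = 0) (hv : mink v v = 0) (huv : mink u v ≠ 0) (a : Coord Q n) :
    f (a + v + u) - f (a + v) = f (a + u) - f a := by
  have hu0 : u ≠ 0 := by rintro rfl; exact huv (mink_zero_left _)
  have hv0 : v ≠ 0 := by rintro rfl; exact huv (by rw [mink_comm, mink_zero_left])
  have hu' := hf.null (a := a) hu
  have hv' := hf.null (a := a) hv
  have huv' : mink (f (a + u) - f a) (f (a + v) - f a) ≠ 0 := by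
    rw [Ne, ← lightlike_iff_mink_eq_zero (a := f a) hu' hv', add_sub_cancel, add_sub_cancel, ← hf,
      lightlike_iff_mink_eq_zero hu hv]
    exact huv
  obtain ⟨α, hα⟩ := null_parallel (PreservesNull.ne_zero hu0) hu' (hf.null (a := a + v) hu)
    (hf.parallel hu0 hu a (a + v))
  obtain ⟨β, hβ⟩ := null_parallel (PreservesNull.ne_zero hv0) hv' (hf.null (a := a + u) hv)
    (hf.parallel hv0 hv a (a + u))
  have e : a + u + v = a + v + u := by abel
  rw [e] at hβ
  set u' := f (a + u) - f a
  set v' := f (a + v) - f a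
  have h1 : v' + α • u' = u' + β • v' := by
    rw [← hα, ← hβ]
    simp only [u', v']
    abel
  have h2 : (α - 1) * mink u' v' = 0 := by
    have h3 := congrArg (fun w => mink w v') h1
    simp only [mink_add_left, mink_smul_left] at h3
    rw [hv'] at h3
    linarith
  have h4 : α = 1 := by
    rcases mul_eq_zero.1 h2 with h | h
    · linarith
    · exact absurd h huv'
  rw [hα, h4, one_smul]

/-- The shifts `w` that leave the image displacement of `u` unchanged form a subgroup. It contains
the null vectors not orthogonal to `u`, hence is everything. -/
theorem PreservesNull.translate (hn : 2 ≤ n) (hf : PreservesNull f) {u : Coord Q n}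
    (hu : mink u u = 0) (a w : Coord Q n) : f (a + w + u) - f (a + w) = f (a + u) - f a := by
  rcases eq_or_ne u 0 with rfl | hu0
  · simp
  let A : AddSubgroup (Coord Q n) :=
    { carrier := {w | ∀ a, f (a + w + u) - f (a + w) = f (a + u) - f a}
      add_mem' := by
        intro x y hx hy a
        rw [← add_assoc, hy, hx]
      zero_mem' := by intro a; simp
      neg_mem' := by
        intro x hx a
        have := hx (a + -x)
        rw [neg_add_cancel_right] at this
        exact this.symm }
  have h : A = ⊤ := addSubgroup_eq_top hn hu0 hu A fun v hv huv a => hf.parallelogram hu hv huv a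
  have hw : w ∈ A := by rw [h]; trivial
  exact hw a

theorem exists_null_vector (hn : 2 ≤ n) : ∃ s : Fin n → Q, s ⬝ᵥ s = 1 :=
  ⟨Pi.single ⟨0, by omega⟩ 1, by simp⟩

theorem nullVec_one_ne_zero (s : Fin n → Q) : (nullVec 1 s : Coord Q n) ≠ 0 := by
  intro h
  have := congrFun h 0
  simp [nullVec] at this

theorem addSubgroup_eq_top_of_null (hn : 2 ≤ n) (A : AddSubgroup (Coord Q n))
    (hA : ∀ v, mink v v = 0 → v ∈ A) : A = ⊤ := by
  obtain ⟨s, hs⟩ := exists_null_vector (Q := Q) hn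
  exact addSubgroup_eq_top hn (nullVec_one_ne_zero s) (mink_nullVec_self 1 hs) A fun v hv _ => hA v hv

theorem PreservesNull.additive (hn : 2 ≤ n) (hf : PreservesNull f) (a w : Coord Q n) :
    f (a + w) = f a + (f w - f 0) := by
  let A : AddSubgroup (Coord Q n) :=
    { carrier := {w | ∀ a, f (a + w) = f a + (f w - f 0)}
      add_mem' := by
        intro x y hx hy a
        rw [← add_assoc, hy, hx, hy x]
        abel
      zero_mem' := by intro a; simp
      neg_mem' := by
        intro x hx a
        have h1 := hx (a + -x)
        have h2 := hx (-x)
        rw [neg_add_cancel_right] at h1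
        rw [neg_add_cancel] at h2
        have h3 : f x - f 0 = f 0 - f (-x) := by
          nth_rewrite 2 [h2]
          abel
        rw [h1, h3]
        abel }
  have h : A = ⊤ := addSubgroup_eq_top_of_null hn A fun v hv a => by
    have := hf.translate hn hv 0 a
    rw [zero_add, zero_add] at this
    rw [← this]
    abel
  have hw : w ∈ A := by rw [h]; trivial
  exact hw a

/-- The homogeneous part of a bijection preserving the null relation. -/
structure NullHom (F : Coord Q n →+ Coord Q n) : Prop where
  inj : Function.Injective F
  surj : Function.Surjective F
  null : ∀ x, mink x x = 0 ↔ mink (F x) (F x) = 0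

variable {F : Coord Q n →+ Coord Q n}

theorem NullHom.mink_eq_zero_iff (hF : NullHom F) {u v : Coord Q n} (hu : mink u u = 0)
    (hv : mink v v = 0) : mink u v = 0 ↔ mink (F u) (F v) = 0 := by
  have h1 := hF.null (u + v)
  have hu' := (hF.null u).1 hu
  have hv' := (hF.null v).1 hv
  rw [map_add, mink_self_add, mink_self_add, hu, hv, hu', hv'] at h1
  constructor
  · intro h
    have := h1.1 (by rw [h]; ring)
    linarith
  · intro h
    have := h1.2 (by rw [h]; ring)
    linarith

theorem NullHom.smul (hF : NullHom F) {u : Coord Q n} (hu0 : u ≠ 0) (hu : mink u u = 0) (c : Q) :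
    ∃ d : Q, F (c • u) = d • F u := by
  have hcu : mink (c • u) (c • u) = 0 := by rw [mink_smul_left, mink_smul_right, hu]; ring
  exact null_parallel (fun h => hu0 (hF.inj (by rw [h, map_zero]))) ((hF.null u).1 hu)
    ((hF.null _).1 hcu) ((hF.mink_eq_zero_iff hu hcu).1 (by rw [mink_smul_right, hu]; ring))

theorem NullHom.smul_surj (hF : NullHom F) {u : Coord Q n} (hu0 : u ≠ 0) (hu : mink u u = 0)
    (d : Q) : ∃ c : Q, F (c • u) = d • F u := by
  obtain ⟨w, hw⟩ := hF.surj (d • F u)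
  have hu' := (hF.null u).1 hu
  have hwn : mink w w = 0 := by
    rw [hF.null, hw, mink_smul_left, mink_smul_right, hu']; ring
  obtain ⟨c, rfl⟩ := null_parallel hu0 hu hwn (by
    rw [hF.mink_eq_zero_iff hu hwn, hw, mink_smul_right, hu']; ring)
  exact ⟨c, hw⟩

/-- Orthogonality to null vectors is preserved. -/
theorem NullHom.orthogonal (hF : NullHom F) {u w : Coord Q n} (hu : mink u u = 0)
    (hw : mink w u = 0) : mink (F w) (F u) = 0 := by
  rcases eq_or_ne u 0 with rfl | hu0
  · rw [map_zero, mink_comm, mink_zero_left]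
  by_contra hne
  have hu' := (hF.null u).1 hu
  -- If `F w` is not orthogonal to `F u`, this multiple of `F u` turns `F w` into a null vector.
  -- Then `w + c • u` is null, so `w` is null as well, and for two null vectors orthogonality is
  -- already known to be preserved.
  obtain ⟨c, hc⟩ := hF.smul_surj hu0 hu (-mink (F w) (F w) / (2 * mink (F w) (F u)))
  have h1 : mink (F (w + c • u)) (F (w + c • u)) = 0 := by
    rw [map_add, hc, mink_self_add]
    simp only [mink_smul_left, mink_smul_right, hu']
    field_simp
    ring
  rw [← hF.null, mink_self_add, mink_smul_left, mink_smul_right, mink_smul_right, hw, hu] at h1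
  have hwn : mink w w = 0 := by linarith
  exact hne ((hF.mink_eq_zero_iff hwn hu).1 hw)

theorem exists_orthogonal_unit (hE : ∀ x : Q, 0 < x → ∃ y : Q, y ^ 2 = x) (hn : 2 ≤ n)
    (W : Fin n → Q) : ∃ e : Fin n → Q, e ⬝ᵥ e = 1 ∧ W ⬝ᵥ e = 0 := by
  obtain ⟨m, rfl⟩ : ∃ m, n = m + 2 := ⟨n - 2, by omega⟩
  obtain ⟨e, he0, he⟩ : ∃ e : Fin (m + 2) → Q, e ≠ 0 ∧ W ⬝ᵥ e = 0 := by
    by_cases h : W 0 = 0 ∧ W 1 = 0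
    · exact ⟨Pi.single 0 1, by simp, by simp [h.1]⟩
    · refine ⟨Pi.single 0 (-W 1) + Pi.single 1 (W 0), fun h0 => h ?_, ?_⟩
      · have h1 := congrFun h0 0
        have h2 := congrFun h0 1
        simp at h1 h2
        exact ⟨h2, h1⟩
      · rw [dotProduct_add, dotProduct_single, dotProduct_single]; ring
  have hpos : 0 < e ⬝ᵥ e := lt_of_le_of_ne (dotProduct_self_nonneg' e)
    fun h => he0 (eq_zero_of_dotProduct_self h.symm)
  obtain ⟨r, hr⟩ := hE _ hpos
  have hr0 : r ≠ 0 := by rintro rfl; rw [← hr] at hpos; simp at hpos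
  refine ⟨r⁻¹ • e, ?_, by rw [dotProduct_smul, he, smul_zero]⟩
  rw [dotProduct_smul, smul_dotProduct, ← hr, smul_eq_mul, smul_eq_mul]
  field_simp

/-- For `a = nullVec 1 t` the ratio condition reads `t ⬝ᵥ W = x - 1` with `W = x • s - r`. A unit
`t` with this property exists because `(x - 1) ^ 2 < W ⬝ᵥ W`: the rest of its length is placed
orthogonally to `W`, which uses a second space dimension and a square root. -/
theorem exists_null_ratio (hE : ∀ x : Q, 0 < x → ∃ y : Q, y ^ 2 = x) (hn : 2 ≤ n)
    {s r : Fin n → Q} (hs : s ⬝ᵥ s = 1) (hr : r ⬝ᵥ r = 1) (hsr : s ≠ r) {x : Q} (hx : 0 < x) :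
    ∃ a : Coord Q n, mink a a = 0 ∧ mink a (nullVec 1 r) = x * mink a (nullVec 1 s) ∧
      mink a (nullVec 1 s) ≠ 0 := by
  set W := x • s - r with hW
  obtain ⟨e, he, hWe⟩ := exists_orthogonal_unit hE hn W
  have h1 : 0 < 1 - s ⬝ᵥ r := by
    have h2 : 0 < (s - r) ⬝ᵥ (s - r) := lt_of_le_of_ne (dotProduct_self_nonneg' _)
      fun h => hsr (sub_eq_zero.1 (eq_zero_of_dotProduct_self h.symm))
    simp only [sub_dotProduct, dotProduct_sub, hs, hr, dotProduct_comm r s] at h2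
    linarith
  have hWW : W ⬝ᵥ W = (x - 1) ^ 2 + 2 * x * (1 - s ⬝ᵥ r) := by
    simp only [hW, sub_dotProduct, dotProduct_sub, smul_dotProduct, dotProduct_smul, smul_eq_mul,
      hs, hr, dotProduct_comm r s]
    ring
  have hpos : 0 < 2 * x * (1 - s ⬝ᵥ r) := by positivity
  have hWpos : 0 < W ⬝ᵥ W := by rw [hWW]; positivity
  obtain ⟨y, hy⟩ := hE (1 - (x - 1) ^ 2 / (W ⬝ᵥ W)) (by
    rw [sub_pos, div_lt_one hWpos, hWW]; linarith)
  set t := ((x - 1) / (W ⬝ᵥ W)) • W + y • e with ht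
  have htt : t ⬝ᵥ t = 1 := by
    simp only [ht, add_dotProduct, dotProduct_add, smul_dotProduct, dotProduct_smul, smul_eq_mul,
      he, hWe, dotProduct_comm e W]
    field_simp at hy ⊢
    linear_combination hy
  have htW : t ⬝ᵥ W = x - 1 := by
    simp only [ht, add_dotProduct, smul_dotProduct, smul_eq_mul, dotProduct_comm e W, hWe]
    field_simp
    ring
  have hrat : mink (nullVec 1 t) (nullVec 1 r) = x * mink (nullVec 1 t) (nullVec 1 s) := by
    rw [mink_nullVec_right, mink_nullVec_right]
    simp only [hW, dotProduct_sub, dotProduct_smul, smul_eq_mul] at htW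
    simp only [nullVec, Fin.cons_zero, spaceComp_cons, one_smul]
    linarith
  refine ⟨nullVec 1 t, mink_nullVec_self 1 htt, hrat, fun h0 => hsr ?_⟩
  have hts : ∀ z : Fin n → Q, z ⬝ᵥ z = 1 → mink (nullVec 1 t) (nullVec 1 z) = 0 → z = t := by
    intro z hz h
    obtain ⟨c, hc⟩ := null_parallel (nullVec_one_ne_zero t) (mink_nullVec_self 1 htt)
      (mink_nullVec_self 1 hz) h
    have hc1 : c = 1 := by
      have := congrFun hc 0
      simpa [nullVec] using this.symm
    have := congrArg spaceComp hc
    simpa [nullVec, hc1] using this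
  rw [hts s hs h0, hts r hr (by rw [hrat, h0, mul_zero])]

theorem exists_eq_smul_nullVec {u : Coord Q n} (hu : mink u u = 0) :
    u = 0 ∨ ∃ (c : Q) (s : Fin n → Q), s ⬝ᵥ s = 1 ∧ u = c • nullVec 1 s := by
  by_cases h0 : u 0 = 0
  · exact Or.inl (eq_zero_of_mink_self hu h0)
  · refine Or.inr ⟨u 0, (u 0)⁻¹ • spaceComp u, ?_, ?_⟩
    · rw [dotProduct_smul, smul_dotProduct, smul_eq_mul, smul_eq_mul]
      simp only [mink] at hu
      rw [← sub_eq_zero.1 hu]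
      field_simp
    · refine coord_ext (by simp [nullVec]) ?_
      simp [nullVec, smul_smul, h0]

/-- The homogeneous part is semilinear. -/
theorem NullHom.semilinear (hE : ∀ x : Q, 0 < x → ∃ y : Q, y ^ 2 = x) (hn : 2 ≤ n)
    (hF : NullHom F) : ∃ φ : Q → Q, Function.Surjective φ ∧ ∀ (c : Q) w, F (c • w) = φ c • F w := by
  have h1 : ∀ s : Fin n → Q, s ⬝ᵥ s = 1 → ∀ c : Q, ∃ d : Q,
      F (c • nullVec 1 s) = d • F (nullVec 1 s) := fun s hs c =>
    hF.smul (nullVec_one_ne_zero s) (mink_nullVec_self 1 hs) c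
  choose! φ hφ using h1
  have hFne : ∀ s, F (nullVec 1 s) ≠ 0 := fun s h =>
    nullVec_one_ne_zero s (hF.inj (by rw [h, map_zero]))
  have hφ1 : ∀ s : Fin n → Q, s ⬝ᵥ s = 1 → φ s 1 = 1 := by
    intro s hs
    refine smul_left_injective Q (hFne s) ?_
    simp only
    rw [← hφ s hs, one_smul, one_smul]
  -- Choose a null `a` orthogonal to `x • nullVec 1 s - nullVec 1 r` and to all its multiples.
  -- Orthogonality to `a` survives `F`; the case `c = 1` eliminates the unknown products. Taking `x
  -- = 1` shows that `φ` does not depend on the direction, and then general `x` that it is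
  -- multiplicative.
  have key : ∀ s r : Fin n → Q, s ⬝ᵥ s = 1 → r ⬝ᵥ r = 1 → s ≠ r → ∀ x, 0 < x → ∀ c,
      φ s (c * x) = φ r c * φ s x := by
    intro s r hs hr hsr x hx c
    obtain ⟨a, ha, har, has⟩ := exists_null_ratio hE hn hs hr hsr hx
    have hort : ∀ c : Q, φ s (c * x) * mink (F (nullVec 1 s)) (F a)
        = φ r c * mink (F (nullVec 1 r)) (F a) := by
      intro c
      have h2 := hF.orthogonal (u := a) (w := (c * x) • nullVec 1 s - c • nullVec 1 r) ha (by
        rw [mink_sub_left, mink_smul_left, mink_smul_left, mink_comm _ a, mink_comm _ a, har]; ring)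
      rw [map_sub, hφ s hs, hφ r hr, mink_sub_left, mink_smul_left, mink_smul_left] at h2
      linarith
    have h3 := hort 1
    rw [one_mul, hφ1 r hr, one_mul] at h3
    have h4 := hort c
    rw [← h3] at h4
    have h5 : mink (F (nullVec 1 s)) (F a) ≠ 0 := by
      rw [Ne, ← hF.mink_eq_zero_iff (mink_nullVec_self 1 hs) ha, mink_comm]
      exact has
    refine mul_right_cancel₀ h5 ?_
    rw [h4]
    ring
  obtain ⟨s, hs⟩ := exists_null_vector (Q := Q) hn
  have hs' : (-s) ⬝ᵥ (-s) = 1 := by simpa using hs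
  have hss : s ≠ -s := by
    intro h
    have h2 : s ⬝ᵥ s = s ⬝ᵥ (-s) := by rw [← h]
    rw [dotProduct_neg, hs] at h2
    linarith
  have hall : ∀ r : Fin n → Q, r ⬝ᵥ r = 1 → φ r = φ s := by
    intro r hr
    by_cases hrs : r = s
    · rw [hrs]
    · ext c
      have := key r s hr hs hrs 1 one_pos c
      rwa [mul_one, hφ1 r hr, mul_one] at this
  have hmulpos : ∀ x, 0 < x → ∀ c, φ s (c * x) = φ s c * φ s x := by
    intro x hx c
    rw [key s (-s) hs hs' hss x hx c, hall _ hs']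
  have hneg : ∀ c, φ s (-c) = -φ s c := by
    intro c
    refine smul_left_injective Q (hFne s) ?_
    simp only
    rw [← hφ s hs, neg_smul, map_neg, hφ s hs, neg_smul]
  have hzero : φ s 0 = 0 := by
    have := hneg 0
    rw [neg_zero] at this
    linarith
  have hmul : ∀ x c, φ s (c * x) = φ s c * φ s x := by
    intro x c
    rcases lt_trichotomy x 0 with h | h | h
    · have := hmulpos (-x) (by linarith) c
      rw [mul_neg, hneg, hneg, mul_neg] at this
      linarith
    · rw [h, mul_zero, hzero, mul_zero]
    · exact hmulpos x h c
  refine ⟨φ s, fun d => ?_, fun c w => ?_⟩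
  · obtain ⟨c, hc⟩ := hF.smul_surj (nullVec_one_ne_zero s) (mink_nullVec_self 1 hs) d
    refine ⟨c, smul_left_injective Q (hFne s) ?_⟩
    simp only
    rw [← hφ s hs, hc]
  · let A : AddSubgroup (Coord Q n) :=
      { carrier := {w | ∀ c : Q, F (c • w) = φ s c • F w}
        add_mem' := by
          intro x y hx hy c
          rw [smul_add, map_add, hx, hy, map_add, smul_add]
        zero_mem' := by intro c; simp
        neg_mem' := by
          intro x hx c
          rw [smul_neg, map_neg, hx, map_neg, smul_neg] }
    have h : A = ⊤ := addSubgroup_eq_top_of_null hn A fun v hv c => by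
      rcases exists_eq_smul_nullVec hv with rfl | ⟨d, r, hr, rfl⟩
      · simp
      · rw [smul_smul, hφ r hr, hφ r hr, hall r hr, hmul, smul_smul]
    have hw : w ∈ A := by rw [h]; trivial
    exact hw c

/-- Lengths of the multiples of one spatial vector with spatial image give `φ c = c` or `φ c = -c`,
and `φ (c + 1) = φ c + 1` leaves only the identity. The same vector later fixes the dilation factor.
-/
theorem NullHom.map_smul_of_dist (hE : ∀ x : Q, 0 < x → ∃ y : Q, y ^ 2 = x) (hn : 2 ≤ n)
    (hF : NullHom F) (hs : ∀ w : Coord Q n, w 0 = 0 → F w 0 = 0 →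
      spaceComp w ⬝ᵥ spaceComp w = spaceComp (F w) ⬝ᵥ spaceComp (F w)) :
    (∀ (c : Q) w, F (c • w) = c • F w) ∧
      ∃ w, w ≠ 0 ∧ w 0 = 0 ∧ mink (F w) (F w) = mink w w := by
  obtain ⟨φ, hφs, hφ⟩ := hF.semilinear hE hn
  -- Two space directions and surjectivity of `φ` allow the time components of the images to cancel.
  obtain ⟨w, hw0, hw, hFw⟩ : ∃ w : Coord Q n, w ≠ 0 ∧ w 0 = 0 ∧ F w 0 = 0 := by
    obtain ⟨m, rfl⟩ : ∃ m, n = m + 2 := ⟨n - 2, by omega⟩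
    set e₁ : Coord Q (m + 2) := Pi.single 1 1
    set e₂ : Coord Q (m + 2) := Pi.single 2 1
    by_cases h : F e₁ 0 = 0
    · exact ⟨e₁, by simp [e₁], by simp [e₁], h⟩
    · obtain ⟨x, hx⟩ := hφs (-(F e₂ 0) / F e₁ 0)
      refine ⟨x • e₁ + e₂, fun h0 => ?_, ?_, ?_⟩
      · have := congrFun h0 2
        have h12 : (2 : Fin (m + 2 + 1)) ≠ 1 := by
          simp [Fin.ext_iff, Nat.mod_eq_of_lt]
        simp [e₁, e₂, h12] at this
      · have h2 : (0 : Fin (m + 2 + 1)) ≠ 2 := by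
          simp [Fin.ext_iff, Nat.mod_eq_of_lt]
        simp [e₁, e₂, h2]
      · rw [map_add, hφ, hx]
        simp only [Pi.add_apply, Pi.smul_apply, smul_eq_mul]
        field_simp
        ring
  have hpos : 0 < spaceComp w ⬝ᵥ spaceComp w := lt_of_le_of_ne (dotProduct_self_nonneg' _)
    fun h => hw0 (coord_ext hw (eq_zero_of_dotProduct_self h.symm))
  have hd := hs w hw hFw
  have hsq : ∀ c, φ c = c ∨ φ c = -c := by
    intro c
    have h1 := hs (c • w) (by simp [hw]) (by rw [hφ]; simp [hFw])
    rw [hφ] at h1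
    simp only [spaceComp_smul, smul_dotProduct, dotProduct_smul, smul_eq_mul, ← hd] at h1
    have h2 : (φ c * φ c - c * c) * (spaceComp w ⬝ᵥ spaceComp w) = 0 := by linarith
    rcases mul_eq_zero.1 h2 with h | h
    · exact mul_self_eq_mul_self_iff.1 (sub_eq_zero.1 h)
    · exact absurd h hpos.ne'
  have hFw0 : F w ≠ 0 := fun h => hw0 (hF.inj (by rw [h, map_zero]))
  have hφ1 : φ 1 = 1 := by
    refine smul_left_injective Q hFw0 ?_
    simp only
    rw [← hφ, one_smul, one_smul]
  have hφa : ∀ c, φ (c + 1) = φ c + 1 := by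
    intro c
    refine smul_left_injective Q hFw0 ?_
    simp only
    rw [← hφ, add_smul, map_add, hφ, one_smul, add_smul, one_smul]
  have hid : ∀ c, φ c = c := by
    intro c
    rcases hsq c with h | h
    · exact h
    · have h1 := hφa c
      rcases hsq (c + 1) with h2 | h2 <;> rw [h2, h] at h1 <;> linarith
  exact ⟨fun c x => by rw [hφ, hid], w, hw0, hw, by simp only [mink, hw, hFw, hd]⟩

/-- A linear map preserving null vectors multiplies the Minkowski form by a constant. -/
theorem mink_map_self (hE : ∀ x : Q, 0 < x → ∃ y : Q, y ^ 2 = x) (hn : 2 ≤ n)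
    (L : Coord Q n →ₗ[Q] Coord Q n)
    (hL : ∀ x, mink x x = 0 → mink (L x) (L x) = 0) (w : Coord Q n) :
    mink (L w) (L w) =
      mink (L (Pi.single 0 1)) (L (Pi.single 0 1)) * mink w w := by
  set e : Coord Q n := Pi.single 0 1
  have hes : spaceComp e = 0 := by ext i; simp [e, spaceComp]
  have he0 : e 0 = 1 := by simp [e]
  -- Every vector lies in a plane spanned by `e` and a spatial unit vector `z`, where the null
  -- vectors `e + z` and `e - z` determine the transformed form up to its value at `e`.
  obtain ⟨s, r, hs, hw⟩ : ∃ (s : Fin n → Q) (r : Q), s ⬝ᵥ s = 1 ∧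
      w = w 0 • e + r • (Fin.cons 0 s : Coord Q n) := by
    rcases (dotProduct_self_nonneg' (spaceComp w)).lt_or_eq with h | h
    · obtain ⟨r, hr⟩ := hE _ h
      have hr0 : r ≠ 0 := by rintro rfl; rw [← hr] at h; simp at h
      refine ⟨r⁻¹ • spaceComp w, r, ?_, coord_ext ?_ ?_⟩
      · rw [dotProduct_smul, smul_dotProduct, ← hr, smul_eq_mul, smul_eq_mul]
        field_simp
      · simp [he0]
      · simp [hes, smul_smul, hr0]
    · obtain ⟨s, hs⟩ := exists_null_vector (Q := Q) hn
      refine ⟨s, 0, hs, coord_ext ?_ ?_⟩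
      · simp [he0]
      · simp [hes, eq_zero_of_dotProduct_self h.symm]
  set z : Coord Q n := Fin.cons 0 s with hz
  have hzz : mink z z = -1 := by simp [mink, hz, hs]
  have hez : mink e z = 0 := by simp [mink, hz, hes]
  have hee : mink e e = 1 := by simp [mink, hes, he0]
  have h1 := hL (e + z) (by rw [mink_self_add, hee, hez, hzz]; ring)
  have h2 := hL (e - z) (by rw [mink_self_sub, hee, hez, hzz]; ring)
  rw [map_add, mink_self_add] at h1
  rw [map_sub, mink_self_sub] at h2
  rw [hw]
  simp only [map_add, map_smul, mink_self_add, mink_smul_left, mink_smul_right, hee, hez, hzz]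
  have h3 : mink (L e) (L z) = 0 := by linarith
  have h4 : mink (L z) (L z) = -mink (L e) (L e) := by linarith
  rw [h3, h4]
  ring

/-- The Alexandrov–Zeeman theorem: a bijection preserving the null relation, and the distance of
points which are simultaneous and have simultaneous images, is a Poincaré transformation. -/
theorem PreservesNull.poincare (hE : ∀ x : Q, 0 < x → ∃ y : Q, y ^ 2 = x) (hn : 2 ≤ n)
    (hf : PreservesNull f) (hs : ∀ p q : Coord Q n, p 0 = q 0 → f p 0 = f q 0 →
      spaceComp (p - q) ⬝ᵥ spaceComp (p - q) = spaceComp (f p - f q) ⬝ᵥ spaceComp (f p - f q)) :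
    ∃ L : Coord Q n →ₗ[Q] Coord Q n, (∀ x y, mink (L x) (L y) = mink x y) ∧
      ∀ p q, f p - f q = L (p - q) := by
  let F : Coord Q n →+ Coord Q n :=
    { toFun := fun w => f w - f 0
      map_zero' := sub_self _
      map_add' := by
        intro x y
        rw [hf.additive hn]
        abel }
  have hFd : ∀ p q, f p - f q = F (p - q) := by
    intro p q
    rw [map_sub]
    simp [F]
  have hF : NullHom F :=
    { inj := fun x y h => f.injective (by simpa [F] using h)
      surj := fun y => ⟨f.symm (y + f 0), by simp [F]⟩
      null := fun x => by
        have := hf x 0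
        unfold Lightlike at this
        rwa [hFd, sub_zero] at this }
  obtain ⟨hsm, w, hw0, hwt, hw⟩ := hF.map_smul_of_dist hE hn (by
    intro w h0 h1
    have := hs w 0 (by simpa using h0) (by
      have : (f w - f 0) 0 = 0 := h1
      simpa [sub_eq_zero] using this)
    rwa [hFd, sub_zero] at this)
  let L : Coord Q n →ₗ[Q] Coord Q n := { F with map_smul' := fun c x => hsm c x }
  have hLF : ∀ x, L x = F x := fun _ => rfl
  have hq := mink_map_self hE hn L fun x hx => (hF.null x).1 hx
  have hone : mink (L (Pi.single 0 1)) (L (Pi.single 0 1)) = 1 := by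
    have h1 := hq w
    rw [hLF w, hw] at h1
    have h2 : mink w w ≠ 0 := fun h => hw0 (eq_zero_of_mink_self h hwt)
    exact mul_right_cancel₀ h2 (by rw [← h1, one_mul])
  have hqq : ∀ x, mink (L x) (L x) = mink x x := fun x => by rw [hq, hone, one_mul]
  refine ⟨L, fun x y => ?_, hFd⟩
  have h1 := hqq (x + y)
  rw [map_add, mink_self_add, mink_self_add, hqq, hqq] at h1
  linarith

end AlexandrovZeeman

namespace RelFrame

/-! ### Timelike curves in a Minkowski plane and their clocks. -/

section Planar

variable {B Q : Type*} {n : ℕ} [Field Q] [LinearOrder Q] [IsStrictOrderedRing Q]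
  [TopologicalSpace Q] [OrderTopology Q]

/-- A definable future directed timelike curve in a Minkowski plane, in null coordinates
`(U, V)`, parametrized by proper time. -/
structure TimelikeCurve (M : RelFrame B Q n) where
  J : Set Q
  U : Q → Q
  V : Q → Q
  r : Q → Q
  ordConnected : J.OrdConnected
  nontrivial : ∀ s ∈ J, ∃ s' ∈ J, s' ≠ s
  defJ : M.DefPred₁ fun s => s ∈ J
  defU : M.DefFun₁ U
  defV : M.DefFun₁ V
  hasU : ∀ s ∈ J, HasD U J (r s) s
  hasV : ∀ s ∈ J, HasD V J (r s)⁻¹ s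
  r_pos : ∀ s ∈ J, 0 < r s

/-- A timelike curve in a Minkowski plane which is accelerated in the positive direction; the
acceleration is `α`. -/
structure AccCurve (M : RelFrame B Q n) extends TimelikeCurve M where
  α : Q → Q
  defr : M.DefFun₁ r
  hasr : ∀ s ∈ J, HasD r J (α s * r s) s
  α_pos : ∀ s ∈ J, 0 < α s

variable {M : RelFrame B Q n}

/-- The point `(u, v)` is simultaneous with the point of the curve at time `t`, at signed
distance `x`. -/
def AccCurve.At (K : AccCurve M) (x t u v : Q) : Prop :=
  t ∈ K.J ∧ u = K.U t + x * K.r t ∧ v = K.V t - x * (K.r t)⁻¹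

/-- The signed distance `x` does not reach back to the Rindler horizon. -/
def AccCurve.Good (K : AccCurve M) (x : Q) : Prop := ∀ t ∈ K.J, 0 < 1 + K.α t * x

theorem TimelikeCurve.monoU (C : TimelikeCurve M) (hC : M.CONT) : StrictMonoOn C.U C.J :=
  hC.strictMonoOn C.defU C.ordConnected fun s hs => ⟨_, C.hasU s hs, C.r_pos s hs⟩

theorem TimelikeCurve.monoV (C : TimelikeCurve M) (hC : M.CONT) : StrictMonoOn C.V C.J :=
  hC.strictMonoOn C.defV C.ordConnected fun s hs => ⟨_, C.hasV s hs, inv_pos.2 (C.r_pos s hs)⟩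

/-- With `hasB` this shows what `Good x` is for: the point at signed distance `x` then advances in
both null coordinates as the time of `K` passes. -/
theorem AccCurve.hasA (K : AccCurve M) (x : Q) {t : Q} (ht : t ∈ K.J) :
    HasD (fun t => K.U t + x * K.r t) K.J (K.r t * (1 + K.α t * x)) t := by
  convert (K.hasU t ht).add ((K.hasr t ht).const_mul x) using 1
  ring

theorem AccCurve.hasB (K : AccCurve M) (x : Q) {t : Q} (ht : t ∈ K.J) :
    HasD (fun t => K.V t - x * (K.r t)⁻¹) K.J ((K.r t)⁻¹ * (1 + K.α t * x)) t := by
  have h0 := (K.r_pos t ht).ne'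
  convert (K.hasV t ht).sub (((K.hasr t ht).inv h0).const_mul x) using 1
  field_simp
  ring

theorem AccCurve.monoA (K : AccCurve M) (hC : M.CONT) {x : Q} (hx : K.Good x) :
    StrictMonoOn (fun t => K.U t + x * K.r t) K.J :=
  hC.strictMonoOn (K.defU.add ((defFun_const x).mul K.defr)) K.ordConnected
    fun t ht => ⟨_, K.hasA x ht, mul_pos (K.r_pos t ht) (hx t ht)⟩

theorem AccCurve.monoB (K : AccCurve M) (hC : M.CONT) {x : Q} (hx : K.Good x) :
    StrictMonoOn (fun t => K.V t - x * (K.r t)⁻¹) K.J :=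
  hC.strictMonoOn (K.defV.sub ((defFun_const x).mul K.defr.inv)) K.ordConnected
    fun t ht => ⟨_, K.hasB x ht, mul_pos (inv_pos.2 (K.r_pos t ht)) (hx t ht)⟩

theorem AccCurve.monor (K : AccCurve M) (hC : M.CONT) : StrictMonoOn K.r K.J :=
  hC.strictMonoOn K.defr K.ordConnected
    fun t ht => ⟨_, K.hasr t ht, mul_pos (K.α_pos t ht) (K.r_pos t ht)⟩

theorem AccCurve.Good.mono {K : AccCurve M} {x y : Q} (hx : K.Good x) (hxy : x ≤ y) :
    K.Good y := fun t ht => by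
  have := mul_le_mul_of_nonneg_left hxy (K.α_pos t ht).le
  linarith [hx t ht]

theorem AccCurve.good_zero (K : AccCurve M) : K.Good 0 := fun t ht => by simp

theorem AccCurve.good_of_nonneg (K : AccCurve M) {x : Q} (hx : 0 ≤ x) : K.Good x :=
  K.good_zero.mono hx

variable {K : AccCurve M} {x y t t' u v u' v' : Q}

/-- Along the distance `x` both null coordinates increase, so `V` decides if `t ≤ t'` and `U`
otherwise. Only `x` has to be good; the other point may a priori lie beyond the horizon. -/
theorem AccCurve.At.le_of_right (hC : M.CONT) (hx : K.Good x) (h : K.At x t u v)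
    (h' : K.At y t' u' v') (hu : u ≤ u') (hv : v' ≤ v) : x ≤ y := by
  obtain ⟨ht, rfl, rfl⟩ := h
  obtain ⟨ht', rfl, rfl⟩ := h'
  have hp := K.r_pos t' ht'
  rcases le_or_gt t t' with h | h
  · have h1 : K.V t - x * (K.r t)⁻¹ ≤ K.V t' - x * (K.r t')⁻¹ :=
      (K.monoB hC hx).monotoneOn ht ht' h
    have h2 : x * (K.r t')⁻¹ ≤ y * (K.r t')⁻¹ := by linarith
    exact le_of_mul_le_mul_right h2 (inv_pos.2 hp)
  · have h1 : K.U t' + x * K.r t' ≤ K.U t + x * K.r t :=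
      (K.monoA hC hx).monotoneOn ht' ht h.le
    have h2 : x * K.r t' ≤ y * K.r t' := by linarith
    exact le_of_mul_le_mul_right h2 hp

/-- If the times differed, the two null coordinates would give opposite strict inequalities between
`x` and `y`. Again only one distance is assumed good, so `l` and `-l` can be told apart. -/
theorem AccCurve.At.unique (hC : M.CONT) (hx : K.Good x) (h : K.At x t u v)
    (h' : K.At y t' u v) : x = y ∧ t = t' := by
  obtain ⟨ht, rfl, rfl⟩ := h
  obtain ⟨ht', hu, hv⟩ := h'
  have hp := K.r_pos t' ht'
  rcases lt_trichotomy t t' with h | h | h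
  · have h1 : K.V t - x * (K.r t)⁻¹ < K.V t' - x * (K.r t')⁻¹ := K.monoB hC hx ht ht' h
    have h2 : K.U t + x * K.r t < K.U t' + x * K.r t' := K.monoA hC hx ht ht' h
    have h3 : x * (K.r t')⁻¹ < y * (K.r t')⁻¹ := by linarith
    have h4 : y * K.r t' < x * K.r t' := by linarith
    exact absurd (lt_of_mul_lt_mul_right h3 (inv_pos.2 hp).le)
      (not_lt.2 (lt_of_mul_lt_mul_right h4 hp.le).le)
  · subst h
    have h4 : x * K.r t = y * K.r t := by linarith
    exact ⟨mul_right_cancel₀ hp.ne' h4, rfl⟩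
  · have h1 : K.V t' - x * (K.r t')⁻¹ < K.V t - x * (K.r t)⁻¹ := K.monoB hC hx ht' ht h
    have h2 : K.U t' + x * K.r t' < K.U t + x * K.r t := K.monoA hC hx ht' ht h
    have h3 : y * (K.r t')⁻¹ < x * (K.r t')⁻¹ := by linarith
    have h4 : x * K.r t' < y * K.r t' := by linarith
    exact absurd (lt_of_mul_lt_mul_right h3 (inv_pos.2 hp).le)
      (not_lt.2 (lt_of_mul_lt_mul_right h4 hp.le).le)

theorem AccCurve.At.eq_of_time_eq (h : K.At x t u v) (h' : K.At x t u' v') : u = u' ∧ v = v' :=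
  ⟨h.2.1.trans h'.2.1.symm, h.2.2.trans h'.2.2.symm⟩

theorem AccCurve.At.lt_of_right (hC : M.CONT) (hx : K.Good x) (h : K.At x t u v)
    (h' : K.At y t' u' v') (hu : u ≤ u') (hv : v' ≤ v) (hne : u ≠ u' ∨ v ≠ v') : x < y := by
  refine lt_of_le_of_ne (h.le_of_right hC hx h' hu hv) ?_
  rintro rfl
  rcases lt_trichotomy t t' with h1 | h1 | h1
  · have h2 := K.monoB hC hx h.1 h'.1 h1
    simp only [← h.2.2, ← h'.2.2] at h2
    exact absurd h2 (not_lt.2 hv)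
  · subst h1
    obtain ⟨e1, e2⟩ := h.eq_of_time_eq h'
    rcases hne with h | h
    · exact h e1
    · exact h e2
  · have h2 := K.monoA hC hx h'.1 h.1 h1
    simp only [← h.2.1, ← h'.2.1] at h2
    exact absurd h2 (not_lt.2 hu)

/-- Signals to the right arrive later. -/
theorem AccCurve.At.time_lt_of_V_eq (hC : M.CONT) (hx : K.Good x) (hxy : x < y)
    (h : K.At x t u v) (h' : K.At y t' u' v) : t < t' := by
  by_contra hle
  have h1 : K.V t' - y * (K.r t')⁻¹ ≤ K.V t - y * (K.r t)⁻¹ :=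
    (K.monoB hC (hx.mono hxy.le)).monotoneOn h'.1 h.1 (not_lt.1 hle)
  have h2 := mul_lt_mul_of_pos_right hxy (inv_pos.2 (K.r_pos t h.1))
  have h3 := h.2.2
  have h4 := h'.2.2
  linarith

/-- Signals to the left arrive later. -/
theorem AccCurve.At.time_lt_of_U_eq (hC : M.CONT) (hx : K.Good x) (hxy : x < y)
    (h : K.At x t u v) (h' : K.At y t' u v') : t' < t := by
  by_contra hle
  have h1 : K.U t + y * K.r t ≤ K.U t' + y * K.r t' :=
    (K.monoA hC (hx.mono hxy.le)).monotoneOn h.1 h'.1 (not_lt.1 hle)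
  have h2 := mul_lt_mul_of_pos_right hxy (K.r_pos t h.1)
  have h3 := h.2.1
  have h4 := h'.2.1
  linarith

/-- A definable predicate which is locally constant on a definable interval is constant. -/
theorem CONT.connected (hC : M.CONT) {P : Q → Prop} (hP : M.DefPred₁ P) {J : Set Q}
    (hJ : J.OrdConnected)
    (h1 : ∀ s ∈ J, P s → ∃ δ > 0, ∀ s' ∈ J, |s' - s| < δ → P s')
    (h2 : ∀ s ∈ J, ¬ P s → ∃ δ > 0, ∀ s' ∈ J, |s' - s| < δ → ¬ P s') {a b : Q} (ha : a ∈ J)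
    (hb : b ∈ J) (hPa : P a) : P b := by
  have key : ∀ R : Q → Prop, M.DefPred₁ R →
      (∀ s ∈ J, R s → ∃ δ > 0, ∀ s' ∈ J, |s' - s| < δ → R s') →
      (∀ s ∈ J, ¬ R s → ∃ δ > 0, ∀ s' ∈ J, |s' - s| < δ → ¬ R s') → ∀ a ∈ J, ∀ b ∈ J, a ≤ b →
      R a → R b := by
    intro R hR h1 h2 a ha b hb hab hRa
    refine hC.real_induction hR (a := a) (b := b) ?_ ?_ b hab le_rfl
    · intro z haz hzb hlt
      by_contra hz
      rcases haz.lt_or_eq with h | rfl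
      · obtain ⟨δ, hδ, hn⟩ := h2 z (hJ.out ha hb ⟨haz, hzb⟩) hz
        obtain ⟨w, hw1, hw2⟩ := exists_between (max_lt h (sub_lt_self z hδ))
        have hw3 := (le_max_left _ _).trans_lt hw1
        have hw4 := (le_max_right _ _).trans_lt hw1
        exact hn w (hJ.out ha hb ⟨hw3.le, hw2.le.trans hzb⟩)
          (by rw [abs_lt]; constructor <;> linarith) (hlt w hw3.le hw2)
      · exact hz hRa
    · intro z haz hzb hle
      obtain ⟨δ, hδ, hn⟩ := h1 z (hJ.out ha hb ⟨haz, hzb.le⟩) (hle z haz le_rfl)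
      exact ⟨z + δ, by linarith, fun w hw1 hw2 hwb => hn w (hJ.out ha hb ⟨haz.trans hw1.le, hwb⟩)
        (by rw [abs_lt]; constructor <;> linarith)⟩
  rcases le_total a b with h | h
  · exact key P hP h1 h2 a ha b hb h hPa
  · by_contra hPb
    exact key (fun s => ¬ P s) hP.not h2 (fun s hs hn => by simpa using h1 s hs (not_not.1 hn))
      b hb a ha h hPb hPa

theorem AccCurve.defAt (K : AccCurve M) (x : Q) {F G : Q → Q} (hF : M.DefFun₁ F)
    (hG : M.DefFun₁ G) : M.DefPred₁ fun s => ∃ t, K.At x t (F s) (G s) := by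
  refine DefPred.exists ?_
  have hs : M.DefFun fun w : Fin 1 ⊕ Fin 1 → Q => w (.inl 0) := defFun_proj _
  have ht : M.DefFun fun w : Fin 1 ⊕ Fin 1 → Q => w (.inr 0) := defFun_proj _
  exact (K.defJ.comp ht).and ((DefPred.eq (hF.comp hs) ((K.defU.comp ht).add
    ((defFun_const x).mul (K.defr.comp ht)))).and (DefPred.eq (hG.comp hs) ((K.defV.comp ht).sub
    ((defFun_const x).mul (K.defr.comp ht).inv))))

/-- A timelike curve at constant unsigned distance from an accelerated curve stays on one side. -/
theorem TimelikeCurve.not_at_neg (C : TimelikeCurve M) (K : AccCurve M) (hC : M.CONT) {l : Q}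
    (hl : 0 < l)
    (hall : ∀ s ∈ C.J, ∃ t, K.At l t (C.U s) (C.V s) ∨ K.At (-l) t (C.U s) (C.V s))
    {s₁ : Q} (hs₁ : s₁ ∈ C.J) (h₁ : ∃ t, K.At l t (C.U s₁) (C.V s₁)) :
    ∀ s ∈ C.J, ¬ ∃ t, K.At (-l) t (C.U s) (C.V s) := by
  have hg : K.Good l := K.good_of_nonneg hl.le
  have near : ∀ s ∈ C.J, ∀ ε > 0, ∀ ε' > 0, ∃ δ > 0, ∀ s' ∈ C.J, |s' - s| < δ →
      |C.U s' - C.U s| < ε ∧ |C.V s' - C.V s| < ε' := by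
    intro s hs ε hε ε' hε'
    obtain ⟨δ, hδ, h⟩ := (C.hasU s hs).near hε
    obtain ⟨δ', hδ', h'⟩ := (C.hasV s hs).near hε'
    exact ⟨min δ δ', lt_min hδ hδ', fun s' hs' hss => ⟨h s' hs' (hss.trans_le (min_le_left _ _)),
      h' s' hs' (hss.trans_le (min_le_right _ _))⟩⟩
  have hneg : ∀ s ∈ C.J, (∃ t, K.At (-l) t (C.U s) (C.V s)) →
      ∃ δ > 0, ∀ s' ∈ C.J, |s' - s| < δ → ¬ ∃ t, K.At l t (C.U s') (C.V s') := by
    rintro s hs ⟨t, ht, htU, htV⟩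
    have hp := K.r_pos t ht
    have hp' := inv_pos.2 hp
    obtain ⟨δ, hδ, hn⟩ := near s hs (2 * l * K.r t) (by positivity) (2 * l * (K.r t)⁻¹)
      (by positivity)
    refine ⟨δ, hδ, fun s' hs' hss => ?_⟩
    rintro ⟨τ, hτ, hτU, hτV⟩
    obtain ⟨h1, h2⟩ := hn s' hs' hss
    rw [abs_lt] at h1 h2
    rcases le_total τ t with h | h
    · have h3 : K.V τ - l * (K.r τ)⁻¹ ≤ K.V t - l * (K.r t)⁻¹ :=
        (K.monoB hC hg).monotoneOn hτ ht h
      linarith [h2.1]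
    · have h3 : K.U t + l * K.r t ≤ K.U τ + l * K.r τ := (K.monoA hC hg).monotoneOn ht hτ h
      linarith [h1.2]
  have hpos : ∀ s ∈ C.J, (∃ t, K.At l t (C.U s) (C.V s)) →
      ∃ δ > 0, ∀ s' ∈ C.J, |s' - s| < δ → ¬ ∃ t, K.At (-l) t (C.U s') (C.V s') := by
    rintro s hs ⟨t, ht, htU, htV⟩
    -- The distance `-l` need not be good, so monotonicity at that distance is not available. Write
    -- `V + l / r` as `(V - l / r) + 2 l / r`. Up to a later time `T` the last term is at least its
    -- value at `T`, since `r` increases; after `T` the first term has gained a fixed amount. If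
    -- there is no later time, only `t` itself counts.
    have gapV : ∃ ε > 0, ∀ τ ∈ K.J, t ≤ τ → C.V s + ε ≤ K.V τ + l * (K.r τ)⁻¹ := by
      by_cases hex : ∃ T ∈ K.J, t < T
      · obtain ⟨T, hT, htT⟩ := hex
        have hpT := inv_pos.2 (K.r_pos T hT)
        have h3 : K.V t - l * (K.r t)⁻¹ < K.V T - l * (K.r T)⁻¹ := K.monoB hC hg ht hT htT
        refine ⟨min (2 * l * (K.r T)⁻¹) ((K.V T - l * (K.r T)⁻¹) - C.V s),
          lt_min (by positivity) (by linarith), fun τ hτ htτ => ?_⟩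
        have hpτ := mul_pos hl (inv_pos.2 (K.r_pos τ hτ))
        rcases le_total τ T with h | h
        · have h4 : K.V t - l * (K.r t)⁻¹ ≤ K.V τ - l * (K.r τ)⁻¹ :=
            (K.monoB hC hg).monotoneOn ht hτ htτ
          have h5 : (K.r T)⁻¹ ≤ (K.r τ)⁻¹ :=
            inv_anti₀ (K.r_pos τ hτ) ((K.monor hC).monotoneOn hτ hT h)
          have h6 := mul_le_mul_of_nonneg_left h5 hl.le
          have h7 := min_le_left (2 * l * (K.r T)⁻¹) ((K.V T - l * (K.r T)⁻¹) - C.V s)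
          linarith
        · have h4 : K.V T - l * (K.r T)⁻¹ ≤ K.V τ - l * (K.r τ)⁻¹ :=
            (K.monoB hC hg).monotoneOn hT hτ h
          have h7 := min_le_right (2 * l * (K.r T)⁻¹) ((K.V T - l * (K.r T)⁻¹) - C.V s)
          linarith
      · push Not at hex
        have hpt := inv_pos.2 (K.r_pos t ht)
        refine ⟨2 * l * (K.r t)⁻¹, by positivity, fun τ hτ htτ => ?_⟩
        obtain rfl : τ = t := le_antisymm (hex τ hτ) htτ
        linarith
    have gapU : ∃ ε > 0, ∀ τ ∈ K.J, τ ≤ t → K.U τ - l * K.r τ ≤ C.U s - ε := by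
      by_cases hex : ∃ T ∈ K.J, T < t
      · obtain ⟨T, hT, htT⟩ := hex
        have hpT := K.r_pos T hT
        have h3 : K.U T + l * K.r T < K.U t + l * K.r t := K.monoA hC hg hT ht htT
        refine ⟨min (2 * l * K.r T) (C.U s - (K.U T + l * K.r T)),
          lt_min (by positivity) (by linarith), fun τ hτ htτ => ?_⟩
        have hpτ := mul_pos hl (K.r_pos τ hτ)
        rcases le_total T τ with h | h
        · have h4 : K.U τ + l * K.r τ ≤ K.U t + l * K.r t :=
            (K.monoA hC hg).monotoneOn hτ ht htτ
          have h5 : K.r T ≤ K.r τ := (K.monor hC).monotoneOn hT hτ h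
          have h6 := mul_le_mul_of_nonneg_left h5 hl.le
          have h7 := min_le_left (2 * l * K.r T) (C.U s - (K.U T + l * K.r T))
          linarith
        · have h4 : K.U τ + l * K.r τ ≤ K.U T + l * K.r T :=
            (K.monoA hC hg).monotoneOn hτ hT h
          have h7 := min_le_right (2 * l * K.r T) (C.U s - (K.U T + l * K.r T))
          linarith
      · push Not at hex
        have hpt := K.r_pos t ht
        refine ⟨2 * l * K.r t, by positivity, fun τ hτ htτ => ?_⟩
        obtain rfl : τ = t := le_antisymm htτ (hex τ hτ)
        linarith
    obtain ⟨ε, hε, hV⟩ := gapV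
    obtain ⟨ε', hε', hU⟩ := gapU
    obtain ⟨δ, hδ, hn⟩ := near s hs ε' hε' ε hε
    refine ⟨δ, hδ, fun s' hs' hss => ?_⟩
    rintro ⟨τ, hτ, hτU, hτV⟩
    obtain ⟨h1, h2⟩ := hn s' hs' hss
    rw [abs_lt] at h1 h2
    rcases le_total τ t with h | h
    · have := hU τ hτ h
      linarith [h1.1]
    · have := hV τ hτ h
      linarith [h2.2]
  intro s hs hcon
  have hP : ∀ s ∈ C.J, (¬ ∃ t, K.At l t (C.U s) (C.V s)) → ∃ t, K.At (-l) t (C.U s) (C.V s) := by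
    intro s hs h
    obtain ⟨t, h' | h'⟩ := hall s hs
    · exact absurd ⟨t, h'⟩ h
    · exact ⟨t, h'⟩
  have hPs := hC.connected (P := fun s => ∃ t, K.At l t (C.U s) (C.V s)) (K.defAt l C.defU C.defV)
    C.ordConnected (fun s hs h => by
      obtain ⟨δ, hδ, hn⟩ := hpos s hs h
      refine ⟨δ, hδ, fun s' hs' hss => ?_⟩
      by_contra h'
      exact hn s' hs' hss (hP s' hs' h')) (fun s hs h => hneg s hs (hP s hs h)) hs₁ hs h₁
  obtain ⟨δ, hδ, hn⟩ := hneg s hs hcon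
  exact hn s hs (by simpa using hδ) hPs

/-- The curve keeps the signed distance `x` from the accelerated curve. -/
def TimelikeCurve.KeepsDist (C : TimelikeCurve M) (K : AccCurve M) (x : Q) : Prop :=
  K.Good x ∧ ∀ s ∈ C.J, ∃ t, K.At x t (C.U s) (C.V s)

/-- One event decides the side. If it is at `-l`, an event at `l` would exclude it by `not_at_neg`,
so the asymmetry of that lemma does no harm. -/
theorem TimelikeCurve.keepsDist_of_at (C : TimelikeCurve M) (K : AccCurve M) (hC : M.CONT)
    {l : Q} (hl : 0 ≤ l)
    (hall : ∀ s ∈ C.J, ∃ t, K.At l t (C.U s) (C.V s) ∨ K.At (-l) t (C.U s) (C.V s))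
    {s₁ t₁ x : Q} (hs₁ : s₁ ∈ C.J) (h₁ : K.At x t₁ (C.U s₁) (C.V s₁)) (hx : K.Good x) :
    C.KeepsDist K x := by
  have hxl : x = l ∨ x = -l := by
    obtain ⟨t, h | h⟩ := hall s₁ hs₁
    · exact Or.inl (h₁.unique hC hx h).1
    · exact Or.inr (h₁.unique hC hx h).1
  refine ⟨hx, fun s hs => ?_⟩
  rcases hl.eq_or_lt with rfl | hl
  · simp only [neg_zero, or_self] at hall hxl
    rw [hxl]
    exact hall s hs
  · obtain ⟨t, ht⟩ := hall s hs
    rcases hxl with rfl | rfl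
    · have := C.not_at_neg K hC hl hall hs₁ ⟨_, h₁⟩ s hs
      rcases ht with h | h
      · exact ⟨t, h⟩
      · exact absurd ⟨t, h⟩ this
    · rcases ht with h | h
      · exact absurd ⟨_, h₁⟩ (C.not_at_neg K hC hl hall hs ⟨_, h⟩ s₁ hs₁)
      · exact ⟨t, h⟩

theorem AccCurve.keepsDist_zero (K : AccCurve M) : K.toTimelikeCurve.KeepsDist K 0 :=
  ⟨K.good_zero, fun s hs => ⟨s, hs, by simp, by simp⟩⟩

open Classical in
/-- The time of the point of the accelerated curve simultaneous with a point of a curve. -/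
noncomputable def TimelikeCurve.tm (C : TimelikeCurve M) (K : AccCurve M) (x s : Q) : Q :=
  if h : s ∈ C.J ∧ ∃ t, K.At x t (C.U s) (C.V s) then h.2.choose else 0

variable {C D : TimelikeCurve M}

theorem TimelikeCurve.KeepsDist.at_tm (h : C.KeepsDist K x) {s : Q} (hs : s ∈ C.J) :
    K.At x (C.tm K x s) (C.U s) (C.V s) := by
  have h1 : s ∈ C.J ∧ ∃ t, K.At x t (C.U s) (C.V s) := ⟨hs, h.2 s hs⟩
  rw [TimelikeCurve.tm, dif_pos h1]
  exact h1.2.choose_spec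

theorem TimelikeCurve.KeepsDist.def_tm (hC : M.CONT) (h : C.KeepsDist K x) :
    M.DefFun₁ (C.tm K x) := by
  have hs : M.DefFun fun w : Fin 1 ⊕ Fin 1 → Q => w (.inl 0) := defFun_proj _
  have ht : M.DefFun fun w : Fin 1 ⊕ Fin 1 → Q => w (.inr 0) := defFun_proj _
  refine DefFun.of_graph (G := fun v y => (v 0 ∈ C.J ∧ (y ∈ K.J ∧ C.U (v 0) = K.U y + x * K.r y ∧
    C.V (v 0) = K.V y - x * (K.r y)⁻¹)) ∨ (v 0 ∉ C.J ∧ y = 0)) ?_ ?_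
  · exact ((C.defJ.comp hs).and ((K.defJ.comp ht).and ((DefPred.eq (C.defU.comp hs)
      ((K.defU.comp ht).add ((defFun_const x).mul (K.defr.comp ht)))).and
      (DefPred.eq (C.defV.comp hs) ((K.defV.comp ht).sub
      ((defFun_const x).mul (K.defr.comp ht).inv)))))).or
      ((C.defJ.comp hs).not.and (DefPred.eq ht (defFun_const 0)))
  · intro v y
    by_cases hv : v 0 ∈ C.J
    · simp only [hv, true_and, not_true_eq_false, false_and, or_false]
      constructor
      · intro hy
        exact ((h.at_tm hv).unique hC h.1 hy).2.symm
      · rintro rfl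
        exact h.at_tm hv
    · simp [hv, TimelikeCurve.tm]

theorem TimelikeCurve.KeepsDist.strictMonoOn_tm (hC : M.CONT) (h : C.KeepsDist K x) :
    StrictMonoOn (C.tm K x) C.J := by
  intro s hs s' hs' hss
  by_contra hle
  have h1 := (K.monoA hC h.1).monotoneOn (h.at_tm hs').1 (h.at_tm hs).1 (not_lt.1 hle)
  simp only [← (h.at_tm hs).2.1, ← (h.at_tm hs').2.1] at h1
  exact absurd (C.monoU hC hs hs' hss) (not_lt.2 h1)

/-- The matching time inverts the increasing function `U + x r` of `K`: it stays below `T` as long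
as `C.U` stays below the value at `T`. If `K.J` has no such `T` within `ε`, order-convexity already
keeps the matching time in bounds. -/
theorem TimelikeCurve.KeepsDist.tendsto_tm (hC : M.CONT) (h : C.KeepsDist K x) {s : Q}
    (hs : s ∈ C.J) : Tendsto (C.tm K x) (𝓝[C.J \ {s}] s) (𝓝[K.J \ {C.tm K x s}] (C.tm K x s)) := by
  refine tendsto_nhdsWithin_of_tendsto_nhds_of_eventually_within _ ?_ ?_
  · refine (tendsto_nhdsWithin_iff_abs.2 fun ε hε => ?_)
    have hup : ∃ δ > 0, ∀ s' ∈ C.J, |s' - s| < δ → C.tm K x s' < C.tm K x s + ε := by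
      by_cases hex : ∃ T ∈ K.J, C.tm K x s < T ∧ T < C.tm K x s + ε
      · obtain ⟨T, hT, h1, h2⟩ := hex
        have h3 := K.monoA hC h.1 (h.at_tm hs).1 hT h1
        simp only [← (h.at_tm hs).2.1] at h3
        obtain ⟨δ, hδ, hn⟩ := (C.hasU s hs).near (sub_pos.2 h3)
        refine ⟨δ, hδ, fun s' hs' hss => ?_⟩
        by_contra hge
        have h4 := (K.monoA hC h.1).monotoneOn hT (h.at_tm hs').1 (h2.le.trans (not_lt.1 hge))
        simp only [← (h.at_tm hs').2.1] at h4
        have h5 := (abs_lt.1 (hn s' hs' hss)).2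
        linarith
      · push Not at hex
        refine ⟨1, one_pos, fun s' hs' _ => ?_⟩
        by_contra hge
        obtain ⟨T, h1, h2⟩ := exists_between (lt_add_of_pos_right (C.tm K x s) hε)
        exact absurd h2 (not_lt.2 (hex T (K.ordConnected.out (h.at_tm hs).1 (h.at_tm hs').1
          ⟨h1.le, h2.le.trans (not_lt.1 hge)⟩) h1))
    have hdown : ∃ δ > 0, ∀ s' ∈ C.J, |s' - s| < δ → C.tm K x s - ε < C.tm K x s' := by
      by_cases hex : ∃ T ∈ K.J, C.tm K x s - ε < T ∧ T < C.tm K x s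
      · obtain ⟨T, hT, h1, h2⟩ := hex
        have h3 := K.monoA hC h.1 hT (h.at_tm hs).1 h2
        simp only [← (h.at_tm hs).2.1] at h3
        obtain ⟨δ, hδ, hn⟩ := (C.hasU s hs).near (sub_pos.2 h3)
        refine ⟨δ, hδ, fun s' hs' hss => ?_⟩
        by_contra hge
        have h4 := (K.monoA hC h.1).monotoneOn (h.at_tm hs').1 hT ((not_lt.1 hge).trans h1.le)
        simp only [← (h.at_tm hs').2.1] at h4
        have h5 := (abs_lt.1 (hn s' hs' hss)).1
        linarith
      · push Not at hex
        refine ⟨1, one_pos, fun s' hs' _ => ?_⟩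
        by_contra hge
        obtain ⟨T, h1, h2⟩ := exists_between (sub_lt_self (C.tm K x s) hε)
        exact absurd h2 (not_lt.2 (hex T (K.ordConnected.out (h.at_tm hs').1 (h.at_tm hs).1
          ⟨(not_lt.1 hge).trans h1.le, h2.le⟩) h1))
    obtain ⟨δ, hδ, h1⟩ := hup
    obtain ⟨δ', hδ', h2⟩ := hdown
    refine ⟨min δ δ', lt_min hδ hδ', fun s' hs' hss => ?_⟩
    have h3 := h1 s' hs'.1 (hss.trans_le (min_le_left _ _))
    have h4 := h2 s' hs'.1 (hss.trans_le (min_le_right _ _))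
    rw [abs_lt]
    constructor <;> linarith
  · filter_upwards [self_mem_nhdsWithin] with s' hs'
    exact ⟨(h.at_tm hs'.1).1, fun e => hs'.2 ((h.strictMonoOn_tm hC).injOn hs'.1 hs e)⟩

/-- The two null coordinates give the derivative of the matching time twice, as `C.r / (K.r (1 + α
x))` and as `K.r / (C.r (1 + α x))`. Equality forces `C.r = K.r`, and then the derivative is `1 / (1
+ α x)`. -/
theorem TimelikeCurve.KeepsDist.hasD_tm (hC : M.CONT) (h : C.KeepsDist K x) {s : Q}
    (hs : s ∈ C.J) : C.r s = K.r (C.tm K x s) ∧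
      HasD (C.tm K x) C.J (1 + K.α (C.tm K x s) * x)⁻¹ s := by
  set t := C.tm K x s with ht
  have htJ : t ∈ K.J := (h.at_tm hs).1
  have hp := K.r_pos t htJ
  have hg := h.1 t htJ
  have hr := C.r_pos s hs
  have hne : (𝓝[C.J \ {s}] s).NeBot :=
    nhdsWithin_diff_neBot C.ordConnected hs (C.nontrivial s hs)
  have hA := Tendsto.comp (K.hasA x htJ) (h.tendsto_tm hC hs)
  have hB := Tendsto.comp (K.hasB x htJ) (h.tendsto_tm hC hs)
  have h1 : HasD (C.tm K x) C.J (C.r s / (K.r t * (1 + K.α t * x))) s := by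
    refine (Tendsto.div (C.hasU s hs) hA (mul_pos hp hg).ne').congr' ?_
    filter_upwards [self_mem_nhdsWithin] with s' hs'
    have h2 : C.tm K x s' - t ≠ 0 := sub_ne_zero.2 fun e =>
      hs'.2 ((h.strictMonoOn_tm hC).injOn hs'.1 hs e)
    have h3 : C.U s' - C.U s ≠ 0 := sub_ne_zero.2 fun e =>
      hs'.2 ((C.monoU hC).injOn hs'.1 hs e)
    simp only [Pi.div_apply, Function.comp_apply, ← ht]
    rw [← (h.at_tm hs'.1).2.1, ← (h.at_tm hs).2.1]
    field_simp
  have h2 : HasD (C.tm K x) C.J ((C.r s)⁻¹ / ((K.r t)⁻¹ * (1 + K.α t * x))) s := by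
    refine (Tendsto.div (C.hasV s hs) hB (mul_pos (inv_pos.2 hp) hg).ne').congr' ?_
    filter_upwards [self_mem_nhdsWithin] with s' hs'
    have h2 : C.tm K x s' - t ≠ 0 := sub_ne_zero.2 fun e =>
      hs'.2 ((h.strictMonoOn_tm hC).injOn hs'.1 hs e)
    have h3 : C.V s' - C.V s ≠ 0 := sub_ne_zero.2 fun e =>
      hs'.2 ((C.monoV hC).injOn hs'.1 hs e)
    simp only [Pi.div_apply, Function.comp_apply, ← ht]
    rw [← (h.at_tm hs'.1).2.2, ← (h.at_tm hs).2.2]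
    field_simp
  have h3 := h1.unique h2 hne
  have hg' := hg.ne'
  have h4 : C.r s ^ 2 = K.r t ^ 2 := by
    field_simp at h3
    linear_combination h3
  have h5 : C.r s = K.r t := (pow_left_inj₀ hr.le hp.le two_ne_zero).1 h4
  refine ⟨h5, ?_⟩
  convert h1 using 1
  rw [h5]
  field_simp

/-- Clock comparison for matched pairs of events on two curves. -/
theorem CONT.abs_clock_comparison (hC : M.CONT) {G H g h : Q → Q} (hG : M.DefFun₁ G)
    (hH : M.DefFun₁ H) {J J' : Set Q} (hJ : J.OrdConnected) (hJ' : J'.OrdConnected)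
    (hGD : ∀ s ∈ J, HasD G J (g s) s) (hHD : ∀ s ∈ J', HasD H J' (h s) s)
    (hGm : StrictMonoOn G J) (hHm : StrictMonoOn H J')
    (hgh : ∀ s ∈ J, ∀ σ ∈ J', G s = H σ → h σ < g s)
    {s₁ s₂ σ₁ σ₂ : Q} (hs₁ : s₁ ∈ J) (hs₂ : s₂ ∈ J) (hσ₁ : σ₁ ∈ J') (hσ₂ : σ₂ ∈ J')
    (h1 : G s₁ = H σ₁) (h2 : G s₂ = H σ₂) (hne : s₁ ≠ s₂ ∨ σ₁ ≠ σ₂) :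
    |s₁ - s₂| < |σ₁ - σ₂| := by
  have key : ∀ s₁ ∈ J, ∀ s₂ ∈ J, ∀ σ₁ ∈ J', ∀ σ₂ ∈ J', G s₁ = H σ₁ → G s₂ = H σ₂ → s₁ < s₂ →
      |s₁ - s₂| < |σ₁ - σ₂| := by
    intro s₁ hs₁ s₂ hs₂ σ₁ hσ₁ σ₂ hσ₂ h1 h2 hlt
    have hσ : σ₁ < σ₂ := by
      rw [← hHm.lt_iff_lt hσ₁ hσ₂, ← h1, ← h2]
      exact hGm hs₁ hs₂ hlt
    have := hC.clock_comparison hG hH hσ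
      (fun s hs => (hGD s (hJ.out hs₁ hs₂ hs)).mono (hJ.out hs₁ hs₂))
      (fun s hs => (hHD s (hJ'.out hσ₁ hσ₂ hs)).mono (hJ'.out hσ₁ hσ₂))
      (hGm.mono (hJ.out hs₁ hs₂)) h1 h2
      fun s hs σ hσ => hgh s (hJ.out hs₁ hs₂ hs) σ (hJ'.out hσ₁ hσ₂ hσ)
    rw [abs_sub_comm, abs_sub_comm σ₁, abs_of_pos (sub_pos.2 hlt), abs_of_pos (sub_pos.2 hσ)]
    exact this
  rcases lt_trichotomy s₁ s₂ with h | h | h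
  · exact key s₁ hs₁ s₂ hs₂ σ₁ hσ₁ σ₂ hσ₂ h1 h2 h
  · exfalso
    rcases hne with h' | h'
    · exact h' h
    · refine h' (hHm.injOn hσ₁ hσ₂ ?_)
      rw [← h1, ← h2, h]
  · rw [abs_sub_comm, abs_sub_comm σ₁]
    exact key s₂ hs₂ s₁ hs₁ σ₂ hσ₂ σ₁ hσ₁ h2 h1 h

section Comparison

variable {s₁ s₂ σ₁ σ₂ : Q}

/-- A right-going ray meets the right curve at a later time of `K`, where `r` is greater and the
rate `1 / r` of `V` smaller. -/
theorem TimelikeCurve.KeepsDist.slower_of_V_eq (hC : M.CONT) (h : C.KeepsDist K x)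
    (h' : D.KeepsDist K y) (hxy : x < y) (hs₁ : s₁ ∈ C.J) (hs₂ : s₂ ∈ C.J) (hσ₁ : σ₁ ∈ D.J)
    (hσ₂ : σ₂ ∈ D.J) (h1 : C.V s₁ = D.V σ₁) (h2 : C.V s₂ = D.V σ₂) (hne : s₁ ≠ s₂ ∨ σ₁ ≠ σ₂) :
    |s₁ - s₂| < |σ₁ - σ₂| := by
  refine hC.abs_clock_comparison C.defV D.defV C.ordConnected D.ordConnected C.hasV D.hasV
    (C.monoV hC) (D.monoV hC) ?_ hs₁ hs₂ hσ₁ hσ₂ h1 h2 hne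
  intro s hs σ hσ e
  have h3 := h.at_tm hs
  have h4 := h'.at_tm hσ
  rw [← e] at h4
  rw [(h.hasD_tm hC hs).1, (h'.hasD_tm hC hσ).1]
  exact inv_strictAnti₀ (K.r_pos _ h3.1)
    (K.monor hC h3.1 h4.1 (h3.time_lt_of_V_eq hC h.1 hxy h4))

/-- A left-going ray meets the left curve at a later time of `K`, where the rate `r` of `U` is
greater. -/
theorem TimelikeCurve.KeepsDist.slower_of_U_eq (hC : M.CONT) (h : C.KeepsDist K x)
    (h' : D.KeepsDist K y) (hxy : x < y) (hs₁ : s₁ ∈ C.J) (hs₂ : s₂ ∈ C.J) (hσ₁ : σ₁ ∈ D.J)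
    (hσ₂ : σ₂ ∈ D.J) (h1 : C.U s₁ = D.U σ₁) (h2 : C.U s₂ = D.U σ₂) (hne : s₁ ≠ s₂ ∨ σ₁ ≠ σ₂) :
    |s₁ - s₂| < |σ₁ - σ₂| := by
  refine hC.abs_clock_comparison C.defU D.defU C.ordConnected D.ordConnected C.hasU D.hasU
    (C.monoU hC) (D.monoU hC) ?_ hs₁ hs₂ hσ₁ hσ₂ h1 h2 hne
  intro s hs σ hσ e
  have h3 := h.at_tm hs
  have h4 := h'.at_tm hσ
  rw [← e] at h4
  rw [(h.hasD_tm hC hs).1, (h'.hasD_tm hC hσ).1]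
  exact K.monor hC h4.1 h3.1 (h3.time_lt_of_U_eq hC h.1 hxy h4)

/-- At equal times of `K` the rates to compare are `1 / (1 + α x)` and `1 / (1 + α y)`. -/
theorem TimelikeCurve.KeepsDist.slower_of_tm_eq (hC : M.CONT) (h : C.KeepsDist K x)
    (h' : D.KeepsDist K y) (hxy : x < y) (hs₁ : s₁ ∈ C.J) (hs₂ : s₂ ∈ C.J) (hσ₁ : σ₁ ∈ D.J)
    (hσ₂ : σ₂ ∈ D.J) (h1 : C.tm K x s₁ = D.tm K y σ₁) (h2 : C.tm K x s₂ = D.tm K y σ₂)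
    (hne : s₁ ≠ s₂ ∨ σ₁ ≠ σ₂) : |s₁ - s₂| < |σ₁ - σ₂| := by
  refine hC.abs_clock_comparison (h.def_tm hC) (h'.def_tm hC) C.ordConnected D.ordConnected
    (fun s hs => (h.hasD_tm hC hs).2) (fun s hs => (h'.hasD_tm hC hs).2)
    (h.strictMonoOn_tm hC) (h'.strictMonoOn_tm hC) ?_ hs₁ hs₂ hσ₁ hσ₂ h1 h2 hne
  intro s hs σ hσ e
  have h3 := (h.at_tm hs).1
  rw [← e]
  refine inv_strictAnti₀ (h.1 _ h3) ?_
  have := mul_lt_mul_of_pos_left hxy (K.α_pos _ h3)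
  linarith

end Comparison

/-- A null related pair of events, the first one being later, becomes spacelike by moving the
first event to the past. -/
theorem TimelikeCurve.exists_spacelike_down (C : TimelikeCurve M) (hC : M.CONT) {s s' : Q}
    (hs : s ∈ C.J) (hs' : s' ∈ C.J) (hlt : s' < s)
    (h : (C.U s = u ∧ v < C.V s) ∨ (C.V s = v ∧ u < C.U s)) :
    ∃ z ∈ C.J, (C.U z - u) * (C.V z - v) < 0 := by
  rcases h with ⟨h1, h2⟩ | ⟨h1, h2⟩
  · obtain ⟨δ, hδ, hn⟩ := (C.hasV s hs).near (sub_pos.2 h2)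
    obtain ⟨z, hz1, hz2⟩ := exists_between (max_lt hlt (sub_lt_self s hδ))
    have hz3 := (le_max_left _ _).trans_lt hz1
    have hz4 := (le_max_right _ _).trans_lt hz1
    have hzJ : z ∈ C.J := C.ordConnected.out hs' hs ⟨hz3.le, hz2.le⟩
    have h3 := (abs_lt.1 (hn z hzJ (by rw [abs_lt]; constructor <;> linarith))).1
    have h4 := C.monoU hC hzJ hs hz2
    exact ⟨z, hzJ, mul_neg_of_neg_of_pos (by linarith) (by linarith)⟩
  · obtain ⟨δ, hδ, hn⟩ := (C.hasU s hs).near (sub_pos.2 h2)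
    obtain ⟨z, hz1, hz2⟩ := exists_between (max_lt hlt (sub_lt_self s hδ))
    have hz3 := (le_max_left _ _).trans_lt hz1
    have hz4 := (le_max_right _ _).trans_lt hz1
    have hzJ : z ∈ C.J := C.ordConnected.out hs' hs ⟨hz3.le, hz2.le⟩
    have h3 := (abs_lt.1 (hn z hzJ (by rw [abs_lt]; constructor <;> linarith))).1
    have h4 := C.monoV hC hzJ hs hz2
    exact ⟨z, hzJ, mul_neg_of_pos_of_neg (by linarith) (by linarith)⟩

theorem TimelikeCurve.exists_spacelike_up (C : TimelikeCurve M) (hC : M.CONT) {s s' : Q}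
    (hs : s ∈ C.J) (hs' : s' ∈ C.J) (hlt : s < s')
    (h : (C.U s = u ∧ C.V s < v) ∨ (C.V s = v ∧ C.U s < u)) :
    ∃ z ∈ C.J, (C.U z - u) * (C.V z - v) < 0 := by
  rcases h with ⟨h1, h2⟩ | ⟨h1, h2⟩
  · obtain ⟨δ, hδ, hn⟩ := (C.hasV s hs).near (sub_pos.2 h2)
    obtain ⟨z, hz1, hz2⟩ := exists_between (lt_min hlt (lt_add_of_pos_right s hδ))
    have hz3 := hz2.trans_le (min_le_left _ _)
    have hz4 := hz2.trans_le (min_le_right _ _)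
    have hzJ : z ∈ C.J := C.ordConnected.out hs hs' ⟨hz1.le, hz3.le⟩
    have h3 := (abs_lt.1 (hn z hzJ (by rw [abs_lt]; constructor <;> linarith))).2
    have h4 := C.monoU hC hs hzJ hz1
    exact ⟨z, hzJ, mul_neg_of_pos_of_neg (by linarith) (by linarith)⟩
  · obtain ⟨δ, hδ, hn⟩ := (C.hasU s hs).near (sub_pos.2 h2)
    obtain ⟨z, hz1, hz2⟩ := exists_between (lt_min hlt (lt_add_of_pos_right s hδ))
    have hz3 := hz2.trans_le (min_le_left _ _)
    have hz4 := hz2.trans_le (min_le_right _ _)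
    have hzJ : z ∈ C.J := C.ordConnected.out hs hs' ⟨hz1.le, hz3.le⟩
    have h3 := (abs_lt.1 (hn z hzJ (by rw [abs_lt]; constructor <;> linarith))).2
    have h4 := C.monoV hC hs hzJ hz1
    exact ⟨z, hzJ, mul_neg_of_neg_of_pos (by linarith) (by linarith)⟩

/-- If two timelike curves have two pairs of distinct null related events, then they have a pair
of spacelike related events. -/
theorem TimelikeCurve.exists_spacelike (C D : TimelikeCurve M) (hC : M.CONT) {s₁ s₂ σ₁ σ₂ : Q}
    (hs₁ : s₁ ∈ C.J) (hs₂ : s₂ ∈ C.J) (hσ₁ : σ₁ ∈ D.J) (hσ₂ : σ₂ ∈ D.J)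
    (h1 : (C.U s₁ - D.U σ₁) * (C.V s₁ - D.V σ₁) = 0) (h1' : C.U s₁ ≠ D.U σ₁ ∨ C.V s₁ ≠ D.V σ₁)
    (h2 : (C.U s₂ - D.U σ₂) * (C.V s₂ - D.V σ₂) = 0) (h2' : C.U s₂ ≠ D.U σ₂ ∨ C.V s₂ ≠ D.V σ₂)
    (hne : s₁ ≠ s₂ ∨ σ₁ ≠ σ₂) :
    ∃ s ∈ C.J, ∃ σ ∈ D.J, (C.U s - D.U σ) * (C.V s - D.V σ) < 0 := by
  have cases : ∀ s σ, (C.U s - D.U σ) * (C.V s - D.V σ) = 0 →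
      (C.U s ≠ D.U σ ∨ C.V s ≠ D.V σ) →
      ((C.U s = D.U σ ∧ D.V σ < C.V s) ∨ (C.V s = D.V σ ∧ D.U σ < C.U s)) ∨
      ((C.U s = D.U σ ∧ C.V s < D.V σ) ∨ (C.V s = D.V σ ∧ C.U s < D.U σ)) := by
    intro s σ h h'
    rcases mul_eq_zero.1 h with h | h
    · have e := sub_eq_zero.1 h
      rcases h' with h' | h'
      · exact absurd e h'
      · rcases lt_or_gt_of_ne h' with h' | h' <;> simp [e, h']
    · have e := sub_eq_zero.1 h
      rcases h' with h' | h'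
      · rcases lt_or_gt_of_ne h' with h' | h' <;> simp [e, h']
      · exact absurd e h'
  have down : ∀ s ∈ C.J, ∀ s' ∈ C.J, ∀ σ ∈ D.J, s' < s →
      ((C.U s = D.U σ ∧ D.V σ < C.V s) ∨ (C.V s = D.V σ ∧ D.U σ < C.U s)) →
      ∃ s ∈ C.J, ∃ σ ∈ D.J, (C.U s - D.U σ) * (C.V s - D.V σ) < 0 := by
    intro s hs s' hs' σ hσ hlt h
    obtain ⟨z, hz, h⟩ := C.exists_spacelike_down hC hs hs' hlt h
    exact ⟨z, hz, σ, hσ, h⟩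
  have up : ∀ s ∈ C.J, ∀ s' ∈ C.J, ∀ σ ∈ D.J, s < s' →
      ((C.U s = D.U σ ∧ C.V s < D.V σ) ∨ (C.V s = D.V σ ∧ C.U s < D.U σ)) →
      ∃ s ∈ C.J, ∃ σ ∈ D.J, (C.U s - D.U σ) * (C.V s - D.V σ) < 0 := by
    intro s hs s' hs' σ hσ hlt h
    obtain ⟨z, hz, h⟩ := C.exists_spacelike_up hC hs hs' hlt h
    exact ⟨z, hz, σ, hσ, h⟩
  have up' : ∀ s ∈ C.J, ∀ σ ∈ D.J, ∀ σ' ∈ D.J, σ < σ' →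
      ((C.U s = D.U σ ∧ D.V σ < C.V s) ∨ (C.V s = D.V σ ∧ D.U σ < C.U s)) →
      ∃ s ∈ C.J, ∃ σ ∈ D.J, (C.U s - D.U σ) * (C.V s - D.V σ) < 0 := by
    intro s hs σ hσ σ' hσ' hlt h
    obtain ⟨z, hz, h⟩ := D.exists_spacelike_up hC hσ hσ' hlt (u := C.U s) (v := C.V s)
      (h.imp (fun h => ⟨h.1.symm, h.2⟩) fun h => ⟨h.1.symm, h.2⟩)
    exact ⟨s, hs, z, hz, by linarith⟩
  have down' : ∀ s ∈ C.J, ∀ σ ∈ D.J, ∀ σ' ∈ D.J, σ' < σ →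
      ((C.U s = D.U σ ∧ C.V s < D.V σ) ∨ (C.V s = D.V σ ∧ C.U s < D.U σ)) →
      ∃ s ∈ C.J, ∃ σ ∈ D.J, (C.U s - D.U σ) * (C.V s - D.V σ) < 0 := by
    intro s hs σ hσ σ' hσ' hlt h
    obtain ⟨z, hz, h⟩ := D.exists_spacelike_down hC hσ hσ' hlt (u := C.U s) (v := C.V s)
      (h.imp (fun h => ⟨h.1.symm, h.2⟩) fun h => ⟨h.1.symm, h.2⟩)
    exact ⟨s, hs, z, hz, by linarith⟩
  -- The other pair shows in which direction there is room on a curve. The event on `C` is moved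
  -- towards the past if it is the later one and towards the future if it is the earlier one. If `C`
  -- is later in the first pair and earlier in the second, then `σ₁ < σ₂` and `D` has room instead.
  have key : ∀ s₁ ∈ C.J, ∀ s₂ ∈ C.J, ∀ σ₁ ∈ D.J, ∀ σ₂ ∈ D.J,
      (C.U s₁ - D.U σ₁) * (C.V s₁ - D.V σ₁) = 0 → (C.U s₁ ≠ D.U σ₁ ∨ C.V s₁ ≠ D.V σ₁) →
      (C.U s₂ - D.U σ₂) * (C.V s₂ - D.V σ₂) = 0 → (C.U s₂ ≠ D.U σ₂ ∨ C.V s₂ ≠ D.V σ₂) →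
      (s₁ < s₂ ∨ s₁ = s₂ ∧ σ₁ < σ₂) →
      ∃ s ∈ C.J, ∃ σ ∈ D.J, (C.U s - D.U σ) * (C.V s - D.V σ) < 0 := by
    intro s₁ hs₁ s₂ hs₂ σ₁ hσ₁ σ₂ hσ₂ h1 h1' h2 h2' hlt
    rcases hlt with hlt | ⟨rfl, hlt⟩
    · rcases cases s₁ σ₁ h1 h1' with hF | hP
      · rcases cases s₂ σ₂ h2 h2' with hF' | hP'
        · exact down s₂ hs₂ s₁ hs₁ σ₂ hσ₂ hlt hF'
        · refine up' s₁ hs₁ σ₁ hσ₁ σ₂ hσ₂ ?_ hF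
          rw [← (D.monoU hC).lt_iff_lt hσ₁ hσ₂]
          have := C.monoU hC hs₁ hs₂ hlt
          rcases hF with ⟨a, b⟩ | ⟨a, b⟩ <;> rcases hP' with ⟨c, d⟩ | ⟨c, d⟩ <;> linarith
      · exact up s₁ hs₁ s₂ hs₂ σ₁ hσ₁ hlt hP
    · rcases cases s₁ σ₁ h1 h1' with hF | hP
      · exact up' s₁ hs₁ σ₁ hσ₁ σ₂ hσ₂ hlt hF
      · rcases cases s₁ σ₂ h2 h2' with hF' | hP'
        · exfalso
          have := D.monoU hC hσ₁ hσ₂ hlt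
          rcases hF' with ⟨a, b⟩ | ⟨a, b⟩ <;> rcases hP with ⟨c, d⟩ | ⟨c, d⟩ <;> linarith
        · exact down' s₁ hs₁ σ₂ hσ₂ σ₁ hσ₁ hlt hP'
  rcases lt_trichotomy s₁ s₂ with h | h | h
  · exact key s₁ hs₁ s₂ hs₂ σ₁ hσ₁ σ₂ hσ₂ h1 h1' h2 h2' (Or.inl h)
  · have hσ : σ₁ ≠ σ₂ := by
      rcases hne with h' | h'
      · exact absurd h h'
      · exact h'
    rcases lt_or_gt_of_ne hσ with h' | h'
    · exact key s₁ hs₁ s₂ hs₂ σ₁ hσ₁ σ₂ hσ₂ h1 h1' h2 h2' (Or.inr ⟨h, h'⟩)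
    · exact key s₂ hs₂ s₁ hs₁ σ₂ hσ₂ σ₁ hσ₁ h2 h2' h1 h1' (Or.inr ⟨h.symm, h'⟩)
  · exact key s₂ hs₂ s₁ hs₁ σ₂ hσ₂ σ₁ hσ₁ h2 h2' h1 h1' (Or.inl h)

end Planar

end RelFrame

/-! ### Euclidean and Minkowski lengths through the quadratic form. -/

section EuclideanLength

variable {Q : Type*} [Field Q] [LinearOrder Q] [IsStrictOrderedRing Q]

theorem eucSqrt_spec (hE : ∀ x : Q, 0 < x → ∃ y : Q, y ^ 2 = x) {x : Q} (hx : 0 ≤ x) :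
    0 ≤ eucSqrt x ∧ eucSqrt x ^ 2 = x := by
  have h : ∃ y : Q, 0 ≤ y ∧ y ^ 2 = x := by
    rcases hx.eq_or_lt with rfl | hx
    · exact ⟨0, le_rfl, by simp⟩
    · obtain ⟨y, hy⟩ := hE x hx
      exact ⟨|y|, abs_nonneg _, by rw [sq_abs, hy]⟩
  rw [eucSqrt, dif_pos h]
  exact h.choose_spec

variable {m : ℕ}

theorem sum_sq_eq_dotProduct (v : Fin m → Q) : ∑ i, v i ^ 2 = v ⬝ᵥ v := by
  simp only [dotProduct, sq]

theorem eucLen_nonneg (hE : ∀ x : Q, 0 < x → ∃ y : Q, y ^ 2 = x) (v : Fin m → Q) :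
    0 ≤ eucLen v :=
  (eucSqrt_spec hE (Finset.sum_nonneg fun _ _ => sq_nonneg _)).1

theorem eucLen_sq (hE : ∀ x : Q, 0 < x → ∃ y : Q, y ^ 2 = x) (v : Fin m → Q) :
    eucLen v ^ 2 = v ⬝ᵥ v := by
  rw [← sum_sq_eq_dotProduct]
  exact (eucSqrt_spec hE (Finset.sum_nonneg fun _ _ => sq_nonneg _)).2

theorem abs_le_eucLen (hE : ∀ x : Q, 0 < x → ∃ y : Q, y ^ 2 = x) (v : Fin m → Q) (i : Fin m) :
    |v i| ≤ eucLen v := by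
  refine abs_le_of_sq_le_sq ?_ (eucLen_nonneg hE v)
  rw [eucLen_sq hE, ← sum_sq_eq_dotProduct]
  exact Finset.single_le_sum (f := fun i => v i ^ 2) (fun _ _ => sq_nonneg _) (Finset.mem_univ i)

theorem eucLen_single (hE : ∀ x : Q, 0 < x → ∃ y : Q, y ^ 2 = x) (i : Fin m) (x : Q) :
    eucLen (Pi.single i x) = |x| := by
  refine (pow_left_inj₀ (eucLen_nonneg hE _) (abs_nonneg _) two_ne_zero).1 ?_
  rw [eucLen_sq hE, sq_abs]
  simp [sq]

variable {n : ℕ}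

theorem spacelike_iff (hE : ∀ x : Q, 0 < x → ∃ y : Q, y ^ 2 = x) (p : Coord Q n) :
    Spacelike p ↔ mink p p < 0 := by
  unfold Spacelike mink
  rw [← abs_of_nonneg (eucLen_nonneg hE (spaceComp p)), ← sq_lt_sq, eucLen_sq hE, sq]
  constructor <;> intro h <;> linarith

theorem not_timelike_of_spacelike {p : Coord Q n} (h : Spacelike p) : ¬ Timelike p :=
  fun h' => lt_asymm h h'

theorem minkLen_of_neg (hE : ∀ x : Q, 0 < x → ∃ y : Q, y ^ 2 = x) {p : Coord Q n} {x : Q}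
    (hx : 0 < x) (h : mink p p = -x ^ 2) : minkLen p = -x := by
  have h1 : eucLen (spaceComp p) ^ 2 - p 0 ^ 2 = x ^ 2 := by
    rw [eucLen_sq hE]
    simp only [mink] at h
    linarith
  have hpos : 0 < x ^ 2 := by positivity
  rw [minkLen, if_neg (by linarith), h1]
  have h2 := eucSqrt_spec hE hpos.le
  rw [(pow_left_inj₀ h2.1 hx.le two_ne_zero).1 h2.2]

theorem mink_of_minkLen_neg (hE : ∀ x : Q, 0 < x → ∃ y : Q, y ^ 2 = x) {p : Coord Q n} {x : Q}
    (hx : 0 < x) (h : x = -minkLen p) : mink p p = -x ^ 2 := by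
  rw [minkLen] at h
  split_ifs at h with h1
  · have := (eucSqrt_spec hE (sub_nonneg.2 h1)).1
    linarith
  · have h2 := (eucSqrt_spec hE (x := eucLen (spaceComp p) ^ 2 - p 0 ^ 2) (by linarith)).2
    rw [neg_neg] at h
    rw [← h, eucLen_sq hE] at h2
    simp only [mink]
    linarith

end EuclideanLength

namespace RelFrame

/-! ### Inertial frames, life-curves, velocities and accelerations. -/

section Frames

variable {B Q : Type*} {n : ℕ} [Field Q] [LinearOrder Q] [IsStrictOrderedRing Q]
  {M : RelFrame B Q n}

theorem AccRel.lightlike_iff (hM : M.AccRel) {m : B} (hm : m ∈ M.IOb) (p q : Coord Q n) :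
    Lightlike p q ↔ (M.Ph ∩ M.ev m p ∩ M.ev m q).Nonempty := by
  rw [← hM.axPh m hm p q, ← pow_left_inj₀ (eucLen_nonneg hM.axEOF _) (abs_nonneg _) two_ne_zero,
    eucLen_sq hM.axEOF, sq_abs]
  simp only [Lightlike, mink, spaceComp_sub, Pi.sub_apply]
  constructor <;> intro h <;> linarith

/-- `AxPh` with `p = q` provides a photon at every point. -/
theorem AccRel.ev_nonempty (hM : M.AccRel) {m : B} (hm : m ∈ M.IOb) (p : Coord Q n) :
    (M.ev m p).Nonempty := by
  obtain ⟨x, hx⟩ := (hM.lightlike_iff hm p p).1 (lightlike_refl p)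
  exact ⟨x, hx.2⟩

/-- Points with the same event are null related to the same points, so their difference is null and
orthogonal to every null vector. Two opposite null directions annihilate its time component. -/
theorem AccRel.ev_injective (hM : M.AccRel) (hn : 2 ≤ n) {m : B} (hm : m ∈ M.IOb)
    {p q : Coord Q n} (h : M.ev m p = M.ev m q) : p = q := by
  have key : ∀ r, Lightlike p r ↔ Lightlike q r := fun r => by
    rw [hM.lightlike_iff hm, hM.lightlike_iff hm, h]
  have h1 : mink (q - p) (q - p) = 0 := ((key q).2 (lightlike_refl q)).symm
  by_contra hne
  obtain ⟨s, hs⟩ := exists_null_vector (Q := Q) hn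
  have h2 : ∀ u : Coord Q n, mink u u = 0 → mink (q - p) u = 0 := by
    intro u hu
    have h3 := (key (p + u)).1 (lightlike_add_self.2 hu).symm
    unfold Lightlike at h3
    rw [show q - (p + u) = (q - p) - u by abel, mink_self_sub, h1, hu] at h3
    linarith
  have h3 := h2 _ (mink_nullVec_self 1 hs)
  have h4 := h2 _ (mink_nullVec_self 1 (s := -s) (by simpa using hs))
  rw [mink_nullVec_right] at h3 h4
  rw [dotProduct_neg] at h4
  exact hne (sub_eq_zero.1 (eq_zero_of_mink_self h1 (by linarith))).symm

/-- The worldview transformation between inertial observers is a Poincaré transformation. -/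
theorem AccRel.poincare (hM : M.AccRel) (hn : 2 ≤ n) {m k : B} (hm : m ∈ M.IOb)
    (hk : k ∈ M.IOb) : ∃ (w : Coord Q n ≃ Coord Q n) (L : Coord Q n →ₗ[Q] Coord Q n),
      (∀ p, M.ev m p = M.ev k (w p)) ∧ (∀ x y, mink (L x) (L y) = mink x y) ∧
      ∀ p q, w p - w q = L (p - q) := by
  have hex : ∀ m ∈ M.IOb, ∀ k ∈ M.IOb, ∀ p, ∃ q, M.ev m p = M.ev k q := by
    intro m hm k hk p
    have h : M.ev m p ∈ M.Ev m := ⟨hM.ev_nonempty hm p, p, rfl⟩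
    rw [hM.axEv m hm k hk] at h
    obtain ⟨_, q, hq⟩ := h
    exact ⟨q, hq.symm⟩
  choose w hw using hex m hm k hk
  choose w' hw' using hex k hk m hm
  let W : Coord Q n ≃ Coord Q n :=
    { toFun := w
      invFun := w'
      left_inv := fun p => hM.ev_injective hn hm (by rw [← hw', ← hw])
      right_inv := fun p => hM.ev_injective hn hk (by rw [← hw, ← hw']) }
  have hW : ∀ p, M.ev m p = M.ev k (W p) := hw
  have hf : PreservesNull W := fun p q => by
    rw [hM.lightlike_iff hm, hM.lightlike_iff hk, hW, hW]
  obtain ⟨L, hL, hWL⟩ := hf.poincare hM.axEOF hn (by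
    intro p q h1 h2
    have hE : ∀ r, M.ev m r ∈ M.Ev m ∩ M.Ev k := fun r =>
      ⟨⟨hM.ev_nonempty hm r, r, rfl⟩, ⟨hM.ev_nonempty hm r, W r, (hW r).symm⟩⟩
    obtain ⟨x, ⟨p₁, q₁, hp₁, hq₁, hx₁⟩, ⟨p₂, q₂, hp₂, hq₂, hx₂⟩⟩ :=
      hM.axSymDist m hm k hk _ (hE p) _ (hE q) ⟨p, q, rfl, rfl, h1⟩
        ⟨W p, W q, (hW p).symm, (hW q).symm, h2⟩
    rw [← (hp₁ p).1 rfl, ← (hq₁ q).1 rfl] at hx₁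
    rw [← (hp₂ (W p)).1 (hW p).symm, ← (hq₂ (W q)).1 (hW q).symm] at hx₂
    rw [← eucLen_sq hM.axEOF, ← eucLen_sq hM.axEOF, spaceComp_sub, spaceComp_sub, ← hx₁, hx₂])
  exact ⟨W, L, hW, hL, hWL⟩

/-- The point on the time axis with time coordinate `t`. -/
def tpt (n : ℕ) (t : Q) : Coord Q n := Pi.single 0 t

theorem tpt_zero (t : Q) : tpt n t 0 = t := by simp [tpt]

theorem spaceComp_tpt (t : Q) : spaceComp (tpt n t) = 0 := by
  ext i; simp [tpt, spaceComp]

theorem tpt_sub (s t : Q) : tpt n s - tpt n t = Pi.single 0 (s - t) := by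
  rw [tpt, tpt, ← Pi.single_sub]

/-- The set of times at which an observer coordinatizes itself. -/
def life (M : RelFrame B Q n) (o : B) : Set Q := {t | o ∈ M.ev o (tpt n t)}

theorem AccRel.eq_tpt (hM : M.AccRel) {o : B} (ho : o ∈ M.Ob) {p : Coord Q n}
    (h : o ∈ M.ev o p) : p = tpt n (p 0) :=
  coord_ext (tpt_zero _).symm (by rw [spaceComp_tpt]; exact ((hM.axSelf₀ o ho p).1 h).2)

theorem AccRel.mem_life_of_mem_ev (hM : M.AccRel) {o : B} (ho : o ∈ M.Ob) {p : Coord Q n}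
    (h : o ∈ M.ev o p) : p 0 ∈ M.life o := by
  have := h
  rwa [hM.eq_tpt ho h] at this

theorem AccRel.ordConnected_life (hM : M.AccRel) {o : B} (ho : o ∈ M.Ob) :
    (M.life o).OrdConnected := by
  convert (hM.axSelfPlus₀ o ho).2 using 1
  ext t
  constructor
  · intro h
    exact ⟨tpt n t, h, tpt_zero t⟩
  · rintro ⟨r, hr, rfl⟩
    exact hM.mem_life_of_mem_ev ho hr

theorem AccRel.nontrivial_life (hM : M.AccRel) {o : B} (ho : o ∈ M.Ob) (t : Q) :
    ∃ s ∈ M.life o, s ≠ t := by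
  obtain ⟨p, q, hpq, hp, hq⟩ := (hM.axSelfPlus₀ o ho).1
  by_cases h : p 0 = t
  · exact ⟨q 0, hM.mem_life_of_mem_ev ho hq, fun h' => hpq (h.trans h'.symm)⟩
  · exact ⟨p 0, hM.mem_life_of_mem_ev ho hp, h⟩

theorem AccRel.exists_ev_eq (hM : M.AccRel) {o m : B} (ho : o ∈ M.Ob) (hm : m ∈ M.IOb) {t : Q}
    (ht : t ∈ M.life o) : ∃ p, M.ev o (tpt n t) = M.ev m p := by
  obtain ⟨m', hm', hc⟩ := hM.axCmv o ho (tpt n t) ht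
  obtain ⟨y, hy, hne⟩ := hc.1
  have h : M.ev o (tpt n t) ∈ M.Ev m' := ⟨hne, y, hy.symm⟩
  rw [hM.axEv m' hm' m hm] at h
  obtain ⟨_, p, hp⟩ := h
  exact ⟨p, hp.symm⟩

/-- An event on the time axis seen by `m` is nonempty, so `AxSelf₀` places `o` in it. This
description of the life span is the one shown to be definable. -/
theorem AccRel.mem_life_iff (hM : M.AccRel) {o m : B} (ho : o ∈ M.Ob) (hm : m ∈ M.IOb) {t : Q} :
    t ∈ M.life o ↔ ∃ p, M.ev o (tpt n t) = M.ev m p := by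
  refine ⟨hM.exists_ev_eq ho hm, ?_⟩
  rintro ⟨p, hp⟩
  refine (hM.axSelf₀ o ho _).2 ⟨?_, spaceComp_tpt t⟩
  change (M.ev o (tpt n t)).Nonempty
  rw [hp]
  exact hM.ev_nonempty hm p

/-- Every event encountered by an observer is coordinatized by it on its time axis. -/
theorem AccRel.exists_life (hM : M.AccRel) {o : B} (ho : o ∈ M.Ob) {e : Set B} (he : e ∈ M.AllEv)
    (hoe : o ∈ e) : ∃ t ∈ M.life o, e = M.ev o (tpt n t) := by
  obtain ⟨_, p, rfl⟩ := hM.axEvTr o ho e he hoe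
  exact ⟨p 0, hM.mem_life_of_mem_ev ho hoe, by rw [← hM.eq_tpt ho hoe]⟩

theorem AccRel.ev_mem_allEv (hM : M.AccRel) {m : B} (hm : m ∈ M.IOb) (p : Coord Q n) :
    M.ev m p ∈ M.AllEv :=
  ⟨m, M.iob_subset hm, hM.ev_nonempty hm p, p, rfl⟩

open Classical in
/-- The position of the observer `o` at its proper time `t`, according to `m`. -/
noncomputable def pos (M : RelFrame B Q n) (o m : B) (t : Q) : Coord Q n :=
  if h : ∃ p, M.ev o (tpt n t) = M.ev m p then h.choose else 0

theorem AccRel.ev_pos (hM : M.AccRel) {o m : B} (ho : o ∈ M.Ob) (hm : m ∈ M.IOb) {t : Q}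
    (ht : t ∈ M.life o) : M.ev m (M.pos o m t) = M.ev o (tpt n t) := by
  have h := hM.exists_ev_eq ho hm ht
  rw [pos, dif_pos h]
  exact h.choose_spec.symm

theorem AccRel.pos_eq (hM : M.AccRel) (hn : 2 ≤ n) {o m : B} (ho : o ∈ M.Ob) (hm : m ∈ M.IOb)
    {t : Q} (ht : t ∈ M.life o) {p : Coord Q n} (h : M.ev o (tpt n t) = M.ev m p) :
    p = M.pos o m t :=
  hM.ev_injective hn hm (by rw [hM.ev_pos ho hm ht, h])

theorem AccRel.pos_mem_wl (hM : M.AccRel) {o m : B} (ho : o ∈ M.Ob) (hm : m ∈ M.IOb)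
    {t : Q} (ht : t ∈ M.life o) : M.pos o m t ∈ M.wl m o := by
  change o ∈ M.ev m (M.pos o m t)
  rw [hM.ev_pos ho hm ht]
  exact ht

theorem DefPred.subst_finite {ι κ : Type*} [Finite κ] {P : (κ → Q) → Prop} (h : M.DefPred P)
    {f : κ → (ι → Q) → Q} (hf : ∀ j, M.DefFun (f j)) : M.DefPred fun v => P fun j => f j v := by
  obtain ⟨m, ⟨e⟩⟩ := Finite.exists_equiv_fin κ
  have h1 : M.DefPred fun v : Fin m → Q => P fun j => v (e j) := h.comap e
  have h2 := h1.subst (f := fun j => f (e.symm j)) fun j => hf _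
  simpa using h2

theorem defPred_ev_tpt (o m : B) : M.DefPred fun v : Fin 1 ⊕ Fin (n + 1) → Q =>
    M.ev o (tpt n (v (.inl 0))) = M.ev m fun i => v (.inr i) := by
  refine DefPred.subst_finite (defPred_ev_eq o m)
    (f := Sum.elim (fun i v => tpt n (v (Sum.inl 0)) i) fun i v => v (Sum.inr i)) ?_
  rintro (i | i)
  · refine Fin.cases ?_ (fun j => ?_) i
    · simpa [tpt] using defFun_proj _
    · simpa [tpt] using defFun_const 0
  · exact defFun_proj _

theorem AccRel.def_life (hM : M.AccRel) {o m : B} (ho : o ∈ M.Ob) (hm : m ∈ M.IOb) :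
    M.DefPred₁ fun t => t ∈ M.life o := by
  have h : M.DefPred fun v : Fin 1 → Q => ∃ p, M.ev o (tpt n (v 0)) = M.ev m p :=
    DefPred.exists_tuple (defPred_ev_tpt o m)
  exact h.congr fun v => (hM.mem_life_iff ho hm).symm

theorem AccRel.def_pos (hM : M.AccRel) (hn : 2 ≤ n) {o m : B} (ho : o ∈ M.Ob) (hm : m ∈ M.IOb)
    (i : Fin (n + 1)) : M.DefFun₁ fun t => M.pos o m t i := by
  refine DefFun.of_graph (G := fun v y => (∃ p, M.ev o (tpt n (v 0)) = M.ev m p ∧ y = p i) ∨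
    (v 0 ∉ M.life o ∧ y = 0)) ?_ ?_
  · refine DefPred.or (DefPred.exists_tuple (DefPred.and ?_ ?_)) (DefPred.and ?_ ?_)
    · exact (defPred_ev_tpt o m).comap (Sum.elim (fun i => Sum.inl (Sum.inl i)) fun i => Sum.inr i)
    · exact DefPred.eq (defFun_proj _) (defFun_proj _)
    · exact ((hM.def_life ho hm).comp (defFun_proj (Sum.inl 0))).not
    · exact DefPred.eq (defFun_proj _) (defFun_const 0)
  · intro v y
    by_cases ht : v 0 ∈ M.life o
    · constructor
      · rintro (⟨p, hp, rfl⟩ | h)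
        · rw [hM.pos_eq hn ho hm ht hp]
        · exact absurd ht h.1
      · rintro rfl
        exact Or.inl ⟨_, (hM.ev_pos ho hm ht).symm, rfl⟩
    · have hno : ¬ ∃ p, M.ev o (tpt n (v 0)) = M.ev m p := fun h =>
        ht ((hM.mem_life_iff ho hm).2 h)
      have e : M.pos o m (v 0) = 0 := by rw [pos, dif_neg hno]
      constructor
      · rintro (⟨p, hp, rfl⟩ | h)
        · exact absurd ⟨p, hp⟩ hno
        · simp [h.2, e]
      · rintro rfl
        exact Or.inr ⟨ht, by simp [e]⟩

variable [TopologicalSpace Q] [OrderTopology Q]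

theorem AccRel.neBot_life (hM : M.AccRel) {o : B} (ho : o ∈ M.Ob) {t : Q} (ht : t ∈ M.life o) :
    (𝓝[M.life o \ {t}] t).NeBot :=
  nhdsWithin_diff_neBot (hM.ordConnected_life ho) ht (hM.nontrivial_life ho t)

/-- The velocity of an observer is a unit timelike vector, which determines the time coordinates
of the co-moving inertial observers. -/
theorem AccRel.exists_vel_of_coMoving (hM : M.AccRel) (hn : 2 ≤ n) {o m₀ m : B} (ho : o ∈ M.Ob)
    (hm₀ : m₀ ∈ M.IOb) (hm : m ∈ M.IOb) {t : Q} (ht : t ∈ M.life o)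
    (hc : M.CoMoving m o (tpt n t)) :
    ∃ v : Coord Q n, mink v v = 1 ∧
      (∀ i, HasD (fun s => M.pos o m₀ s i) (M.life o) (v i) t) ∧
      ∃ w : Coord Q n ≃ Coord Q n, (∀ p, M.ev m p = M.ev m₀ (w p)) ∧
        ∀ p q, p 0 - q 0 = mink (w p - w q) v ∧
          mink (p - q) (p - q) = mink (w p - w q) (w p - w q) := by
  obtain ⟨w, L, hw, hL, hwL⟩ := hM.poincare hn hm hm₀
  have hmink0 : ∀ p : Coord Q n, mink p (tpt n 1) = p 0 := fun p => by
    simp [mink, spaceComp_tpt, tpt_zero]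
  refine ⟨L (tpt n 1), ?_, ?_, w, hw, fun p q => ⟨?_, ?_⟩⟩
  · rw [hL, hmink0, tpt_zero]
  -- In the coordinates of the co-moving `m` the life-curve agrees with the time axis to first
  -- order. The affine map `w` then carries the time unit vector to the velocity `L (tpt n 1)`.
  · set y : Q → Coord Q n := fun s => w.symm (M.pos o m₀ s) with hy
    have hyev : ∀ s ∈ M.life o, M.ev o (tpt n s) = M.ev m (y s) := by
      intro s hs
      rw [hw, hy, ← hM.ev_pos ho hm₀ hs]
      simp
    have hbound : ∀ ε : Q, 0 < ε → ∃ δ : Q, 0 < δ ∧ ∀ s ∈ M.life o, |s - t| < δ →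
        eucLen (y s - tpt n s) ≤ ε * |s - t| := by
      intro ε hε
      obtain ⟨δ, hδ, h⟩ := hc.2 ε hε
      refine ⟨δ, hδ, fun s hs hst => ?_⟩
      have hl : eucLen (tpt n s - tpt n t) = |s - t| := by
        rw [tpt_sub, eucLen_single hM.axEOF]
      obtain ⟨p', hp', hle⟩ := h (tpt n s) ⟨y s, hyev s hs, ⟨o, hs⟩⟩ (by rwa [hl])
      rw [hl, ← (hp' (y s)).1 ⟨hyev s hs, ⟨o, hs⟩⟩] at hle
      exact hle
    have hyt : y t = tpt n t := by
      obtain ⟨δ, hδ, h⟩ := hbound 1 one_pos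
      have h1 := h t ht (by simpa using hδ)
      rw [sub_self, abs_zero, mul_zero] at h1
      refine sub_eq_zero.1 (eq_zero_of_dotProduct_self ?_)
      rw [← eucLen_sq hM.axEOF, le_antisymm h1 (eucLen_nonneg hM.axEOF _)]
      simp
    have hyD : ∀ j, HasD (fun s => y s j) (M.life o) (tpt n 1 j) t := by
      intro j
      rw [hasD_iff]
      intro ε hε
      obtain ⟨δ, hδ, h⟩ := hbound ε hε
      refine ⟨δ, hδ, fun s hs hst => ?_⟩
      have e : y s j - y t j - (s - t) * tpt n (1 : Q) j = (y s - tpt n s) j := by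
        rw [hyt]
        refine Fin.cases ?_ (fun i => ?_) j
        · simp [tpt]
        · simp [tpt]
      rw [e]
      exact (abs_le_eucLen hM.axEOF _ _).trans (h s hs hst)
    intro i
    have hLsum : ∀ x : Coord Q n, L x i = ∑ j, L (Pi.single j 1) i * x j := by
      intro x
      rw [LinearMap.pi_apply_eq_sum_univ L x, Finset.sum_apply]
      refine Finset.sum_congr rfl fun j _ => ?_
      have e : (fun k => if j = k then (1 : Q) else 0) = Pi.single j 1 := by
        ext k
        simp [Pi.single_apply, eq_comm]
      rw [e, Pi.smul_apply, smul_eq_mul, mul_comm]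
    have hpos : ∀ s, M.pos o m₀ s i = w 0 i + ∑ j, L (Pi.single j 1) i * y s j := by
      intro s
      rw [← hLsum]
      have := hwL (y s) 0
      rw [sub_zero] at this
      rw [← this]
      simp [hy]
    rw [hLsum]
    have h1 := (hasD_const (w 0 i) (S := M.life o) (t := t)).add
      (HasD.sum fun j => (hyD j).const_mul (L (Pi.single j 1) i))
    rw [zero_add] at h1
    simpa only [hpos] using h1
  · rw [hwL, hL, hmink0]
    rfl
  · rw [hwL, hL]

theorem AccRel.exists_vel (hM : M.AccRel) (hn : 2 ≤ n) {o m₀ : B} (ho : o ∈ M.Ob)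
    (hm₀ : m₀ ∈ M.IOb) {t : Q} (ht : t ∈ M.life o) :
    ∃ v : Coord Q n, mink v v = 1 ∧
      (∀ i, HasD (fun s => M.pos o m₀ s i) (M.life o) (v i) t) := by
  obtain ⟨m, hm, hc⟩ := hM.axCmv o ho (tpt n t) ht
  obtain ⟨v, h1, h2, _⟩ := hM.exists_vel_of_coMoving hn ho hm₀ hm ht hc
  exact ⟨v, h1, h2⟩

open Classical in
/-- The velocity of the observer `o` at its proper time `t`, according to `m`. -/
noncomputable def vel (M : RelFrame B Q n) (o m : B) (t : Q) : Coord Q n :=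
  if h : t ∈ M.life o ∧ ∃ v : Coord Q n, mink v v = 1 ∧
      (∀ i, HasD (fun s => M.pos o m s i) (M.life o) (v i) t) then h.2.choose else 0

theorem AccRel.mink_vel (hM : M.AccRel) (hn : 2 ≤ n) {o m : B} (ho : o ∈ M.Ob)
    (hm : m ∈ M.IOb) {t : Q} (ht : t ∈ M.life o) : mink (M.vel o m t) (M.vel o m t) = 1 := by
  have h := And.intro ht (hM.exists_vel hn ho hm ht)
  rw [vel, dif_pos h]
  exact h.2.choose_spec.1

theorem AccRel.hasD_pos (hM : M.AccRel) (hn : 2 ≤ n) {o m : B} (ho : o ∈ M.Ob)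
    (hm : m ∈ M.IOb) {t : Q} (ht : t ∈ M.life o) (i : Fin (n + 1)) :
    HasD (fun s => M.pos o m s i) (M.life o) (M.vel o m t i) t := by
  have h := And.intro ht (hM.exists_vel hn ho hm ht)
  rw [vel, dif_pos h]
  exact h.2.choose_spec.2 i

theorem AccRel.vel_eq (hM : M.AccRel) (hn : 2 ≤ n) {o m : B} (ho : o ∈ M.Ob)
    (hm : m ∈ M.IOb) {t : Q} (ht : t ∈ M.life o) {v : Coord Q n}
    (h : ∀ i, HasD (fun s => M.pos o m s i) (M.life o) (v i) t) : v = M.vel o m t :=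
  funext fun i => (h i).unique (hM.hasD_pos hn ho hm ht i) (hM.neBot_life ho ht)

theorem AccRel.def_vel (hM : M.AccRel) (hn : 2 ≤ n) {o m : B} (ho : o ∈ M.Ob) (hm : m ∈ M.IOb)
    (i : Fin (n + 1)) : M.DefFun₁ fun t => M.vel o m t i := by
  have ht : M.DefFun fun w : Fin 1 ⊕ Fin 1 → Q => w (.inl 0) := defFun_proj _
  have hy : M.DefFun fun w : Fin 1 ⊕ Fin 1 → Q => w (.inr 0) := defFun_proj _
  refine DefFun.of_graph (G := fun v y => (v 0 ∈ M.life o ∧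
    HasD (fun s => M.pos o m s i) (M.life o) y (v 0)) ∨ (v 0 ∉ M.life o ∧ y = 0)) ?_ ?_
  · exact (((hM.def_life ho hm).comp ht).and ((hM.def_life ho hm).hasD (hM.def_pos hn ho hm i)
      hy ht)).or (((hM.def_life ho hm).comp ht).not.and (DefPred.eq hy (defFun_const 0)))
  · intro v y
    by_cases hv : v 0 ∈ M.life o
    · simp only [hv, true_and, not_true_eq_false, false_and, or_false]
      constructor
      · intro h
        exact h.unique (hM.hasD_pos hn ho hm hv i) (hM.neBot_life ho hv)
      · rintro rfl
        exact hM.hasD_pos hn ho hm hv i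
    · simp [hv, vel]

/-- The coordinates of an inertial observer co-moving with `o`. -/
theorem AccRel.coMoving_coords (hM : M.AccRel) (hn : 2 ≤ n) {o m₀ m : B} (ho : o ∈ M.Ob)
    (hm₀ : m₀ ∈ M.IOb) (hm : m ∈ M.IOb) {t : Q} (ht : t ∈ M.life o)
    (hc : M.CoMoving m o (tpt n t)) :
    ∃ w : Coord Q n ≃ Coord Q n, (∀ p, M.ev m p = M.ev m₀ (w p)) ∧
      ∀ p q, p 0 - q 0 = mink (w p - w q) (M.vel o m₀ t) ∧
        mink (p - q) (p - q) = mink (w p - w q) (w p - w q) := by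
  obtain ⟨v, h1, h2, h3⟩ := hM.exists_vel_of_coMoving hn ho hm₀ hm ht hc
  rwa [hM.vel_eq hn ho hm₀ ht h2] at h3

theorem AccRel.mem_lc_iff (hM : M.AccRel) (hn : 2 ≤ n) {o m : B} (ho : o ∈ M.Ob)
    (hm : m ∈ M.IOb) {s : Q} {p : Coord Q n} :
    (s, p) ∈ M.lc o m ↔ s ∈ M.life o ∧ p = M.pos o m s := by
  constructor
  · rintro ⟨q, h1, h2, h3⟩
    have h3 : q 0 = s := h3
    have h4 := hM.mem_life_of_mem_ev ho h1
    rw [hM.eq_tpt ho h1] at h2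
    rw [h3] at h2 h4
    exact ⟨h4, hM.pos_eq hn ho hm h4 h2⟩
  · rintro ⟨h1, rfl⟩
    exact ⟨tpt n s, h1, (hM.ev_pos ho hm h1).symm, tpt_zero s⟩

theorem hasD_of_isDerivRel (hE : ∀ x : Q, 0 < x → ∃ y : Q, y ^ 2 = x)
    {f : Set (Q × Coord Q n)} {S : Set Q} {F : Q → Coord Q n}
    (hf : ∀ s p, (s, p) ∈ f ↔ s ∈ S ∧ p = F s) {t : Q} {v : Coord Q n} (h : IsDerivRel f t v) :
    t ∈ S ∧ ∀ i, HasD (fun s => F s i) S (v i) t := by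
  obtain ⟨p, hp, h⟩ := h
  obtain ⟨ht, rfl⟩ := (hf _ _).1 hp
  refine ⟨ht, fun i => hasD_iff.2 fun ε hε => ?_⟩
  obtain ⟨δ, hδ, h⟩ := h ε hε
  refine ⟨δ, hδ, fun s hs hst => ?_⟩
  exact (abs_le_eucLen hE (F s - F t - (s - t) • v) i).trans (h s (F s) ((hf _ _).2 ⟨hs, rfl⟩) hst)

theorem AccRel.mem_relVel (hM : M.AccRel) (hn : 2 ≤ n) {o m : B} (ho : o ∈ M.Ob)
    (hm : m ∈ M.IOb) {s : Q} {p : Coord Q n} (h : (s, p) ∈ M.relVel o m) :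
    s ∈ M.life o ∧ p = M.vel o m s := by
  obtain ⟨h1, h2⟩ := hasD_of_isDerivRel hM.axEOF (fun s p => hM.mem_lc_iff hn ho hm) h.2.1
  exact ⟨h1, hM.vel_eq hn ho hm h1 h2⟩

/-- That the velocity is defined is read off from the acceleration: a second derivative at `s`
presupposes a first derivative at `s`. -/
theorem AccRel.mem_relVel_iff (hM : M.AccRel) (hn : 2 ≤ n) {o m : B} (ho : o ∈ M.Ob)
    (hm : m ∈ M.IOb) (hacc : M.PositivelyAccelerated o) {s : Q} {p : Coord Q n} :
    (s, p) ∈ M.relVel o m ↔ s ∈ M.life o ∧ p = M.vel o m s := by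
  refine ⟨hM.mem_relVel hn ho hm, ?_⟩
  rintro ⟨hs, rfl⟩
  obtain ⟨x, hx, -⟩ := hacc s ⟨tpt n s, tpt n s, hs, rfl, tpt_zero s⟩
  obtain ⟨a, ha, -⟩ := hx m hm
  obtain ⟨p, hp, -⟩ := ha.2.1
  rwa [← (hM.mem_relVel hn ho hm hp).2]

theorem AccRel.mem_relAcc (hM : M.AccRel) (hn : 2 ≤ n) {o m : B} (ho : o ∈ M.Ob)
    (hm : m ∈ M.IOb) (hacc : M.PositivelyAccelerated o) {t : Q} {a : Coord Q n}
    (h : (t, a) ∈ M.relAcc o m) :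
    t ∈ M.life o ∧ ∀ i, HasD (fun s => M.vel o m s i) (M.life o) (a i) t :=
  hasD_of_isDerivRel hM.axEOF (fun _ _ => hM.mem_relVel_iff hn ho hm hacc) h.2.1

theorem AccRel.exists_acc (hM : M.AccRel) {o m : B}
    (hm : m ∈ M.IOb) (hacc : M.PositivelyAccelerated o) {t : Q} (ht : t ∈ M.life o) :
    ∃ (a : Coord Q n) (x : Q), (t, a) ∈ M.relAcc o m ∧ 0 < x ∧ mink a a = -x ^ 2 := by
  obtain ⟨x, hx, hpos⟩ := hacc t ⟨tpt n t, tpt n t, ht, rfl, tpt_zero t⟩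
  obtain ⟨a, ha, hax⟩ := hx m hm
  exact ⟨a, x, ha, hpos, mink_of_minkLen_neg hM.axEOF hpos hax⟩

end Frames

end RelFrame

/-! ### Null coordinates of a vertical plane. -/

section NullCoordinates

variable {Q : Type*} [Field Q] [LinearOrder Q] [IsStrictOrderedRing Q] {n : ℕ}

/-- The first null coordinate of the projection to the plane spanned by the time axis and the
spatial unit vector `w`; the time orientation is `ε`. -/
def nullU (ε : Q) (w : Fin n → Q) (p : Coord Q n) : Q := ε * p 0 + spaceComp p ⬝ᵥ w

/-- The second null coordinate. -/
def nullV (ε : Q) (w : Fin n → Q) (p : Coord Q n) : Q := ε * p 0 - spaceComp p ⬝ᵥ w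

/-- The vector is in the plane spanned by the time axis and the spatial unit vector `w`. -/
def Planar (w : Fin n → Q) (p : Coord Q n) : Prop := spaceComp p = (spaceComp p ⬝ᵥ w) • w

variable {ε : Q} {w : Fin n → Q} {p q : Coord Q n}

theorem nullU_sub : nullU ε w (p - q) = nullU ε w p - nullU ε w q := by
  simp [nullU, sub_dotProduct]; ring

theorem nullV_sub : nullV ε w (p - q) = nullV ε w p - nullV ε w q := by
  simp [nullV, sub_dotProduct]; ring

theorem nullU_sub_nullV : nullU ε w p - nullV ε w p = 2 * (spaceComp p ⬝ᵥ w) := by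
  simp only [nullU, nullV]; ring

theorem Planar.sub (hp : Planar w p) (hq : Planar w q) : Planar w (p - q) := by
  unfold Planar at *
  rw [spaceComp_sub, sub_dotProduct, sub_smul, ← hp, ← hq]

theorem Planar.neg (hp : Planar w p) : Planar (-w) p := by
  unfold Planar at *
  rwa [dotProduct_neg, neg_smul_neg]

/-- Only one factor has to be planar, since the form then sees just the projection of the other. -/
theorem Planar.mink_eq (hε : ε = 1 ∨ ε = -1) (hp : Planar w p) (q : Coord Q n) :
    2 * mink p q = nullU ε w p * nullV ε w q + nullV ε w p * nullU ε w q := by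
  have h : spaceComp p ⬝ᵥ spaceComp q = (spaceComp p ⬝ᵥ w) * (spaceComp q ⬝ᵥ w) := by
    conv_lhs => rw [hp]
    rw [smul_dotProduct, smul_eq_mul, dotProduct_comm w]
  rw [mink, h]
  simp only [nullU, nullV]
  rcases hε with rfl | rfl <;> ring

theorem Planar.mink_self (hε : ε = 1 ∨ ε = -1) (hp : Planar w p) :
    mink p p = nullU ε w p * nullV ε w p := by
  linarith [hp.mink_eq hε p]

theorem Planar.eq_zero (hε : ε = 1 ∨ ε = -1) (hp : Planar w p) (hU : nullU ε w p = 0)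
    (hV : nullV ε w p = 0) : p = 0 := by
  have h1 := nullU_sub_nullV (ε := ε) (w := w) (p := p)
  rw [hU, hV] at h1
  have h2 : spaceComp p ⬝ᵥ w = 0 := by linarith
  refine coord_ext ?_ (by rw [hp, h2, zero_smul]; rfl)
  rw [nullU, h2] at hU
  rcases hε with rfl | rfl <;> simpa using hU

variable [TopologicalSpace Q] [OrderTopology Q]

theorem HasD.dotProduct {F : Q → Coord Q n} {S : Set Q} {v : Coord Q n} {t : Q}
    (h : ∀ i, HasD (fun s => F s i) S (v i) t) (w : Fin n → Q) :
    HasD (fun s => spaceComp (F s) ⬝ᵥ w) S (spaceComp v ⬝ᵥ w) t := by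
  simp only [_root_.dotProduct, mul_comm _ (w _)]
  exact HasD.sum fun i => (h i.succ).const_mul (w i)

theorem HasD.nullU {F : Q → Coord Q n} {S : Set Q} {v : Coord Q n} {t : Q}
    (h : ∀ i, HasD (fun s => F s i) S (v i) t) (ε : Q) (w : Fin n → Q) :
    HasD (fun s => nullU ε w (F s)) S (nullU ε w v) t :=
  ((h 0).const_mul ε).add (HasD.dotProduct h w)

theorem HasD.nullV {F : Q → Coord Q n} {S : Set Q} {v : Coord Q n} {t : Q}
    (h : ∀ i, HasD (fun s => F s i) S (v i) t) (ε : Q) (w : Fin n → Q) :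
    HasD (fun s => nullV ε w (F s)) S (nullV ε w v) t :=
  ((h 0).const_mul ε).sub (HasD.dotProduct h w)

theorem planar_of_hasD {F : Q → Coord Q n} {S : Set Q} {v : Coord Q n} {t : Q}
    (h : ∀ i, HasD (fun s => F s i) S (v i) t) (ht : t ∈ S) (hne : (𝓝[S \ {t}] t).NeBot)
    (hF : ∀ s ∈ S, Planar w (F s - F t)) : Planar w v := by
  ext i
  have h1 : HasD (fun s => w i * (spaceComp (F s) ⬝ᵥ w)) S (w i * (spaceComp v ⬝ᵥ w)) t :=
    (HasD.dotProduct h w).const_mul _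
  have h2 := h1.add (hasD_const (F t i.succ - w i * (spaceComp (F t) ⬝ᵥ w)))
  rw [add_zero] at h2
  have h3 : HasD (fun s => F s i.succ) S (w i * (spaceComp v ⬝ᵥ w)) t := by
    refine h2.congr (fun s hs => ?_) ht
    have h4 := congrFun (hF s hs) i
    rw [spaceComp_sub, sub_dotProduct] at h4
    have h5 : F s i.succ - F t i.succ = _ := h4
    simp only [Pi.smul_apply, smul_eq_mul] at h5
    linear_combination -h5
  have h4 := (h i.succ).unique h3 hne
  simp only [Pi.smul_apply, smul_eq_mul]
  rw [mul_comm]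
  exact h4

end NullCoordinates

namespace RelFrame

/-! ### World-lines of observers as planar timelike curves. -/

section ObserverCurves

variable {B Q : Type*} {n : ℕ} [Field Q] [LinearOrder Q] [IsStrictOrderedRing Q]
  {M : RelFrame B Q n}

/-- The set lies in a vertical plane with the spatial direction `w`. -/
def PlanarOn (S : Set (Coord Q n)) (w : Fin n → Q) : Prop := ∀ p ∈ S, ∀ q ∈ S, Planar w (p - q)

theorem InVerticalPlane.exists_planarOn (hE : ∀ x : Q, 0 < x → ∃ y : Q, y ^ 2 = x)
    {S : Set (Coord Q n)} (h : InVerticalPlane S) : ∃ w : Fin n → Q, PlanarOn S w := by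
  obtain ⟨o, w, hw0, h⟩ := h
  set l := eucLen (spaceComp w)
  have hl : l ≠ 0 := fun e => hw0 (eq_zero_of_dotProduct_self (by
    rw [← eucLen_sq hE]; change l ^ 2 = 0; rw [e]; simp))
  have hl2 : spaceComp w ⬝ᵥ spaceComp w = l ^ 2 := (eucLen_sq hE _).symm
  refine ⟨l⁻¹ • spaceComp w, fun p hp q hq => ?_⟩
  obtain ⟨s, r, rfl⟩ := h p hp
  obtain ⟨s', r', rfl⟩ := h q hq
  have e0 : spaceComp (Pi.single 0 1 : Coord Q n) = 0 := by ext i; simp [spaceComp]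
  have e : spaceComp (o + s • (Pi.single 0 1 : Coord Q n) + r • w -
      (o + s' • (Pi.single 0 1 : Coord Q n) + r' • w)) = (r - r') • spaceComp w := by
    simp only [spaceComp_sub, spaceComp_add, spaceComp_smul, e0, smul_zero, add_zero, sub_smul]
    abel
  unfold Planar
  rw [e, smul_dotProduct, dotProduct_smul, hl2, smul_smul]
  congr 1
  simp only [smul_eq_mul]
  field_simp

variable [TopologicalSpace Q] [OrderTopology Q]

/-- The curve `C` is the world-line of `o` according to `m` in null coordinates; it runs backward
in the proper time of `o` if `η = -1`. -/
structure IsCurveOf (M : RelFrame B Q n) (o m : B) (ε : Q) (w : Fin n → Q) (η : Q)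
    (C : TimelikeCurve M) : Prop where
  sign : η = 1 ∨ η = -1
  mem_J : ∀ s, s ∈ C.J ↔ η * s ∈ M.life o
  U_eq : ∀ s, C.U s = nullU ε w (M.pos o m (η * s))
  V_eq : ∀ s, C.V s = nullV ε w (M.pos o m (η * s))
  vel_U : ∀ s, nullU ε w (M.vel o m (η * s)) = η * C.r s
  vel_V : ∀ s ∈ C.J, nullV ε w (M.vel o m (η * s)) = η * (C.r s)⁻¹

variable {o m : B} {ε : Q} {w : Fin n → Q} {η : Q}

theorem DefFun.nullU {ι : Type*} {F : (ι → Q) → Coord Q n}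
    (h : ∀ i, M.DefFun fun v => F v i) (ε : Q) (w : Fin n → Q) :
    M.DefFun fun v => nullU ε w (F v) :=
  ((defFun_const ε).mul (h 0)).add (DefFun.sum fun i => (h i.succ).mul (defFun_const (w i)))

theorem DefFun.nullV {ι : Type*} {F : (ι → Q) → Coord Q n}
    (h : ∀ i, M.DefFun fun v => F v i) (ε : Q) (w : Fin n → Q) :
    M.DefFun fun v => nullV ε w (F v) :=
  ((defFun_const ε).mul (h 0)).sub (DefFun.sum fun i => (h i.succ).mul (defFun_const (w i)))

theorem AccRel.planar_vel (hM : M.AccRel) (hn : 2 ≤ n) (ho : o ∈ M.Ob) (hm : m ∈ M.IOb)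
    (hpl : PlanarOn (M.wl m o) w) {t : Q} (ht : t ∈ M.life o) : Planar w (M.vel o m t) :=
  planar_of_hasD (hM.hasD_pos hn ho hm ht) ht (hM.neBot_life ho ht) fun _ hs =>
    hpl _ (hM.pos_mem_wl ho hm hs) _ (hM.pos_mem_wl ho hm ht)

theorem AccRel.nullU_mul_nullV_vel (hM : M.AccRel) (hn : 2 ≤ n) (ho : o ∈ M.Ob) (hm : m ∈ M.IOb)
    (hpl : PlanarOn (M.wl m o) w) (hε : ε = 1 ∨ ε = -1) {t : Q} (ht : t ∈ M.life o) :
    nullU ε w (M.vel o m t) * nullV ε w (M.vel o m t) = 1 := by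
  rw [← (hM.planar_vel hn ho hm hpl ht).mink_self hε, hM.mink_vel hn ho hm ht]

theorem hasD_comp_sign {f : Q → Q} {S T : Set Q} {y t : Q} (hη : η = 1 ∨ η = -1)
    (hf : HasD f S y (η * t)) (hT : ∀ s ∈ T, η * s ∈ S) :
    HasD (fun s => f (η * s)) T (η * y) t := by
  rcases hη with rfl | rfl
  · simp only [one_mul] at *
    exact hf.mono hT
  · simp only [neg_one_mul] at *
    exact hf.comp_neg hT

theorem AccRel.def_nullU_pos (hM : M.AccRel) (hn : 2 ≤ n) (ho : o ∈ M.Ob) (hm : m ∈ M.IOb)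
    {ι : Type*} {f : (ι → Q) → Q} (hf : M.DefFun f) (ε : Q) (w : Fin n → Q) :
    M.DefFun fun v => nullU ε w (M.pos o m (f v)) :=
  DefFun.nullU (F := fun v => M.pos o m (f v))
    (fun i => DefFun.comp (F := fun t => M.pos o m t i) (hM.def_pos hn ho hm i) hf) ε w

theorem AccRel.def_nullV_pos (hM : M.AccRel) (hn : 2 ≤ n) (ho : o ∈ M.Ob) (hm : m ∈ M.IOb)
    {ι : Type*} {f : (ι → Q) → Q} (hf : M.DefFun f) (ε : Q) (w : Fin n → Q) :
    M.DefFun fun v => nullV ε w (M.pos o m (f v)) :=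
  DefFun.nullV (F := fun v => M.pos o m (f v))
    (fun i => DefFun.comp (F := fun t => M.pos o m t i) (hM.def_pos hn ho hm i) hf) ε w

/-- The null coordinates of the velocity have product `1`, so the derivative of `U` never vanishes
and by `CONT.deriv_pos` keeps its sign. No continuity of the velocity is assumed. -/
theorem AccRel.nullU_vel_pos (hM : M.AccRel) (hn : 2 ≤ n) (ho : o ∈ M.Ob)
    (hm : m ∈ M.IOb) (hpl : PlanarOn (M.wl m o) w) (hε : ε = 1 ∨ ε = -1) (hη : η = 1 ∨ η = -1)
    {t : Q} (ht : t ∈ M.life o) (hpos : 0 < η * nullU ε w (M.vel o m t)) :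
    ∀ s ∈ M.life o, 0 < η * nullU ε w (M.vel o m s) := by
  have hη0 : η ≠ 0 := by rcases hη with rfl | rfl <;> simp
  have hd : M.DefFun₁ fun s => η * nullU ε w (M.pos o m s) :=
    (defFun_const η).mul (hM.def_nullU_pos hn ho hm (defFun_proj 0) ε w)
  have hD : ∀ s ∈ M.life o, HasD (fun s => η * nullU ε w (M.pos o m s)) (M.life o)
      (η * nullU ε w (M.vel o m s)) s := fun s hs =>
    (HasD.nullU (hM.hasD_pos hn ho hm hs) ε w).const_mul η
  exact hM.cont.deriv_pos (f' := fun s => η * nullU ε w (M.vel o m s)) hd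
    (hM.ordConnected_life ho) hD (fun s hs => mul_ne_zero hη0 (left_ne_zero_of_mul_eq_one
      (hM.nullU_mul_nullV_vel hn ho hm hpl hε hs))) ht hpos

theorem AccRel.exists_isCurveOf_of_pos (hM : M.AccRel) (hn : 2 ≤ n) (ho : o ∈ M.Ob)
    (hm : m ∈ M.IOb) (hpl : PlanarOn (M.wl m o) w) (hε : ε = 1 ∨ ε = -1) (hη : η = 1 ∨ η = -1)
    {t : Q} (ht : t ∈ M.life o) (hpos : 0 < η * nullU ε w (M.vel o m t)) :
    ∃ C : TimelikeCurve M, M.IsCurveOf o m ε w η C := by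
  have hη2 : η * η = 1 := by rcases hη with rfl | rfl <;> norm_num
  have hηη : ∀ s, η * (η * s) = s := fun s => by rw [← mul_assoc, hη2, one_mul]
  have hr := hM.nullU_vel_pos hn ho hm hpl hε hη ht hpos
  have hV : ∀ s ∈ M.life o, (η * nullU ε w (M.vel o m s))⁻¹ = η * nullV ε w (M.vel o m s) :=
    fun s hs => inv_eq_of_mul_eq_one_right (by
      rw [mul_mul_mul_comm, hη2, hM.nullU_mul_nullV_vel hn ho hm hpl hε hs, one_mul])
  have hdef : M.DefFun fun v : Fin 1 → Q => η * v 0 := (defFun_const η).mul (defFun_proj 0)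
  have hUD : ∀ s ∈ {s | η * s ∈ M.life o}, HasD (fun s => nullU ε w (M.pos o m (η * s)))
      {s | η * s ∈ M.life o} (η * nullU ε w (M.vel o m (η * s))) s := fun s hs =>
    hasD_comp_sign (f := fun s => nullU ε w (M.pos o m s)) hη
      (HasD.nullU (hM.hasD_pos hn ho hm hs) ε w) fun _ h => h
  have hVD : ∀ s ∈ {s | η * s ∈ M.life o}, HasD (fun s => nullV ε w (M.pos o m (η * s)))
      {s | η * s ∈ M.life o} (η * nullU ε w (M.vel o m (η * s)))⁻¹ s := fun s hs => by
    rw [hV _ hs]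
    exact hasD_comp_sign (f := fun s => nullV ε w (M.pos o m s)) hη
      (HasD.nullV (hM.hasD_pos hn ho hm hs) ε w) fun _ h => h
  have hord : {s | η * s ∈ M.life o}.OrdConnected := by
    have := hM.ordConnected_life ho
    refine ⟨fun a ha b hb z hz => ?_⟩
    rcases hη with rfl | rfl
    · simp only [one_mul, mem_ofPred_eq] at *
      exact this.out ha hb hz
    · simp only [neg_one_mul, mem_ofPred_eq] at *
      exact this.out hb ha ⟨neg_le_neg hz.2, neg_le_neg hz.1⟩
  have hnt : ∀ s ∈ {s | η * s ∈ M.life o}, ∃ s' ∈ {s | η * s ∈ M.life o}, s' ≠ s := by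
    intro s hs
    obtain ⟨s', hs', hne⟩ := hM.nontrivial_life ho (η * s)
    refine ⟨η * s', by simpa [hηη] using hs', fun e => hne ?_⟩
    rw [← e, hηη]
  have hdU : M.DefFun₁ fun s => nullU ε w (M.pos o m (η * s)) :=
    hM.def_nullU_pos hn ho hm hdef ε w
  have hdV : M.DefFun₁ fun s => nullV ε w (M.pos o m (η * s)) :=
    hM.def_nullV_pos hn ho hm hdef ε w
  have hdJ : M.DefPred₁ fun s => s ∈ {s | η * s ∈ M.life o} := (hM.def_life ho hm).comp hdef
  exact ⟨⟨{s | η * s ∈ M.life o}, _, _, fun s => η * nullU ε w (M.vel o m (η * s)), hord, hnt,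
      hdJ, hdU, hdV, hUD, hVD, fun s hs => hr _ hs⟩,
    ⟨hη, fun _ => Iff.rfl, fun _ => rfl, fun _ => rfl, fun _ => (hηη _).symm,
      fun s hs => ((congrArg (η * ·) (hV _ hs)).trans (hηη _)).symm⟩⟩

theorem AccRel.exists_isCurveOf (hM : M.AccRel) (hn : 2 ≤ n) (ho : o ∈ M.Ob)
    (hm : m ∈ M.IOb) (hpl : PlanarOn (M.wl m o) w) (hε : ε = 1 ∨ ε = -1) :
    ∃ (η : Q) (C : TimelikeCurve M), M.IsCurveOf o m ε w η C := by
  obtain ⟨t, ht, -⟩ := hM.nontrivial_life ho 0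
  have h := left_ne_zero_of_mul_eq_one (hM.nullU_mul_nullV_vel hn ho hm hpl hε ht)
  rcases lt_or_gt_of_ne h with h | h
  · exact ⟨-1, hM.exists_isCurveOf_of_pos hn ho hm hpl hε (Or.inr rfl) ht (by linarith)⟩
  · exact ⟨1, hM.exists_isCurveOf_of_pos hn ho hm hpl hε (Or.inl rfl) ht (by linarith)⟩

/-- The time orientation of a vertical plane can be chosen to agree with an observer's. -/
theorem AccRel.exists_isCurveOf_one (hM : M.AccRel) (hn : 2 ≤ n) (ho : o ∈ M.Ob)
    (hm : m ∈ M.IOb) (hpl : PlanarOn (M.wl m o) w) :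
    ∃ (ε : Q) (C : TimelikeCurve M), (ε = 1 ∨ ε = -1) ∧ M.IsCurveOf o m ε w 1 C := by
  obtain ⟨t, ht, -⟩ := hM.nontrivial_life ho 0
  have h := hM.nullU_mul_nullV_vel hn ho hm hpl (Or.inl rfl) ht
  rcases lt_or_gt_of_ne (right_ne_zero_of_mul_eq_one h) with h' | h'
  · refine ⟨-1, (hM.exists_isCurveOf_of_pos hn ho hm hpl (Or.inr rfl) (Or.inl rfl) ht
      ?_).imp fun C hC => ⟨Or.inr rfl, hC⟩⟩
    have : nullU (-1) w (M.vel o m t) = -nullV 1 w (M.vel o m t) := by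
      simp only [nullU, nullV]; ring
    rw [this]; linarith
  · refine ⟨1, (hM.exists_isCurveOf_of_pos hn ho hm hpl (Or.inl rfl) (Or.inl rfl) ht
      ?_).imp fun C hC => ⟨Or.inl rfl, hC⟩⟩
    rw [one_mul]
    exact pos_of_mul_pos_left (by rw [h]; exact one_pos) h'.le

namespace IsCurveOf

variable {C : TimelikeCurve M}

theorem sign_mul (h : M.IsCurveOf o m ε w η C) (s : Q) : η * (η * s) = s := by
  rcases h.sign with rfl | rfl <;> ring

theorem exists_param (h : M.IsCurveOf o m ε w η C) (hM : M.AccRel) (ho : o ∈ M.Ob)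
    (hm : m ∈ M.IOb) {e : Set B} (he : e ∈ M.AllEv) (hoe : o ∈ e) :
    ∃ s ∈ C.J, e = M.ev m (M.pos o m (η * s)) := by
  obtain ⟨t, ht, rfl⟩ := hM.exists_life ho he hoe
  refine ⟨η * t, (h.mem_J _).2 (by rwa [h.sign_mul]), ?_⟩
  rw [h.sign_mul, hM.ev_pos ho hm ht]

theorem exists_param_of_mem (h : M.IsCurveOf o m ε w η C) (hM : M.AccRel) (hn : 2 ≤ n)
    (ho : o ∈ M.Ob) (hm : m ∈ M.IOb) {p : Coord Q n} (hp : p ∈ M.wl m o) :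
    ∃ s ∈ C.J, p = M.pos o m (η * s) := by
  obtain ⟨s, hs, e⟩ := h.exists_param hM ho hm (hM.ev_mem_allEv hm p) hp
  exact ⟨s, hs, hM.ev_injective hn hm e⟩

theorem pos_mem (h : M.IsCurveOf o m ε w η C) (hM : M.AccRel) (ho : o ∈ M.Ob) (hm : m ∈ M.IOb)
    {s : Q} (hs : s ∈ C.J) : M.pos o m (η * s) ∈ M.wl m o :=
  hM.pos_mem_wl ho hm ((h.mem_J s).1 hs)

/-- An observer sees its own event at one point only: a second one would be on its time axis at
another time, against the strict monotonicity of `U`. -/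
theorem locIs (h : M.IsCurveOf o m ε w η C) (hM : M.AccRel) (hn : 2 ≤ n) (ho : o ∈ M.Ob)
    (hm : m ∈ M.IOb) {s : Q} (hs : s ∈ C.J) :
    M.LocIs o (M.ev m (M.pos o m (η * s))) (tpt n (η * s)) := by
  have hl := (h.mem_J s).1 hs
  rw [hM.ev_pos ho hm hl]
  refine fun q => ⟨fun e => ?_, fun e => by rw [e]⟩
  have hq : o ∈ M.ev o q := by rw [e]; exact hl
  have hq' := hM.mem_life_of_mem_ev ho hq
  rw [hM.eq_tpt ho hq] at e
  rw [hM.eq_tpt ho hq]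
  have h1 : M.pos o m (q 0) = M.pos o m (η * s) :=
    hM.ev_injective hn hm (by rw [hM.ev_pos ho hm hq', hM.ev_pos ho hm hl, e])
  have hs' : η * q 0 ∈ C.J := (h.mem_J _).2 (by rwa [h.sign_mul])
  have h2 : η * q 0 = s := (C.monoU hM.cont).injOn hs' hs (by
    rw [h.U_eq, h.U_eq, h.sign_mul, h1])
  rw [← h2, h.sign_mul]

theorem timeIs (h : M.IsCurveOf o m ε w η C) (hM : M.AccRel) (hn : 2 ≤ n) (ho : o ∈ M.Ob)
    (hm : m ∈ M.IOb) {s s' : Q} (hs : s ∈ C.J) (hs' : s' ∈ C.J) :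
    M.TimeIs o (M.ev m (M.pos o m (η * s))) (M.ev m (M.pos o m (η * s'))) |s - s'| := by
  refine ⟨_, _, h.locIs hM hn ho hm hs, h.locIs hM hn ho hm hs', ?_⟩
  rw [tpt_zero, tpt_zero, ← mul_sub, abs_mul]
  rcases h.sign with rfl | rfl <;> simp

end IsCurveOf

end ObserverCurves

end RelFrame

namespace RelFrame

/-! ### Simultaneity, precedence and Minkowski distance in null coordinates. -/

section Simultaneity

variable {B Q : Type*} {n : ℕ} [Field Q] [LinearOrder Q] [IsStrictOrderedRing Q]
  [TopologicalSpace Q] [OrderTopology Q] {M : RelFrame B Q n}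

variable {o m m' : B} {ε : Q} {w : Fin n → Q} {η : Q}

/-- The time difference for a co-moving observer is the product with the velocity of `o`, so all
observers co-moving at the same event agree on simultaneity. -/
theorem AccRel.simult_iff (hM : M.AccRel) (hn : 2 ≤ n) (ho : o ∈ M.Ob)
    (hm : m ∈ M.IOb) (hm' : m' ∈ M.IOb) {t : Q} (ht : t ∈ M.life o)
    (hc : M.CoMoving m' o (tpt n t)) {p q : Coord Q n} :
    M.Simult m' (M.ev m p) (M.ev m q) ↔ mink (p - q) (M.vel o m t) = 0 := by
  obtain ⟨f, hf, h⟩ := hM.coMoving_coords hn ho hm hm' ht hc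
  constructor
  · rintro ⟨p', q', hp, hq, e⟩
    rw [hf] at hp hq
    rw [← hM.ev_injective hn hm hp, ← hM.ev_injective hn hm hq, ← (h p' q').1, e, sub_self]
  · intro e
    refine ⟨f.symm p, f.symm q, by simp [hf], by simp [hf], sub_eq_zero.1 ?_⟩
    rw [(h _ _).1]
    simpa using e

theorem AccRel.mink_nonneg_of_precedes (hM : M.AccRel) (hn : 2 ≤ n) (ho : o ∈ M.Ob)
    (hm : m ∈ M.IOb) {t : Q} (ht : t ∈ M.life o) {p q : Coord Q n}
    (h : M.Precedes o (M.ev m p) (M.ev m q)) : 0 ≤ mink (q - p) (M.vel o m t) := by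
  obtain ⟨m', hm', hc⟩ := hM.axCmv o ho (tpt n t) ht
  obtain ⟨f, hf, hfm⟩ := hM.coMoving_coords hn ho hm hm' ht hc
  obtain ⟨p', q', hp, hq, hle⟩ := h m' hm' ⟨M.ev o (tpt n t), ht, tpt n t, rfl, hc⟩
  have hp := (hp p').2 rfl
  have hq := (hq q').2 rfl
  rw [hf] at hp hq
  rw [← hM.ev_injective hn hm hp, ← hM.ev_injective hn hm hq, ← (hfm q' p').1]
  linarith

/-- The point with null coordinates `(u', v')` is in the past light cone of `(u, v)`, where the
time orientation is `η`. -/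
def PastNull (η u v u' v' : Q) : Prop :=
  (u - u') * (v - v') = 0 ∧ 0 ≤ η * (u - u') ∧ 0 ≤ η * (v - v')

namespace IsCurveOf

variable {C : TimelikeCurve M}

theorem coMoving_of_at (h : M.IsCurveOf o m ε w η C) (hM : M.AccRel) (hn : 2 ≤ n)
    (ho : o ∈ M.Ob) (hm : m ∈ M.IOb) {s : Q} (hs : s ∈ C.J)
    (hc : M.CoMovingAt m' o (M.ev m (M.pos o m (η * s)))) : M.CoMoving m' o (tpt n (η * s)) := by
  obtain ⟨q, hq, hc⟩ := hc
  rwa [(h.locIs hM hn ho hm hs q).1 hq] at hc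

theorem exists_coMovingAt (h : M.IsCurveOf o m ε w η C) (hM : M.AccRel)
    (ho : o ∈ M.Ob) (hm : m ∈ M.IOb) {s : Q} (hs : s ∈ C.J) :
    ∃ m' ∈ M.IOb, M.CoMoving m' o (tpt n (η * s)) ∧
      M.CoMovingAt m' o (M.ev m (M.pos o m (η * s))) := by
  have hl := (h.mem_J s).1 hs
  obtain ⟨m', hm', hc⟩ := hM.axCmv o ho (tpt n (η * s)) hl
  exact ⟨m', hm', hc, _, (hM.ev_pos ho hm hl).symm, hc⟩

theorem mink_vel (h : M.IsCurveOf o m ε w η C) (hε : ε = 1 ∨ ε = -1) {s : Q} (hs : s ∈ C.J)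
    {p : Coord Q n} (hp : Planar w (p - M.pos o m (η * s))) :
    2 * mink (p - M.pos o m (η * s)) (M.vel o m (η * s)) =
      η * ((nullU ε w p - C.U s) * (C.r s)⁻¹ + (nullV ε w p - C.V s) * C.r s) := by
  rw [hp.mink_eq hε, h.vel_U s, h.vel_V s hs, h.U_eq, h.V_eq, nullU_sub, nullV_sub]
  ring

/-- The null relation makes one coordinate difference vanish. Precedence, used only for an observer
co-moving at the receiving event, gives the sign of the other. -/
theorem pastNull (h : M.IsCurveOf o m ε w η C) (hM : M.AccRel) (hn : 2 ≤ n)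
    (ho : o ∈ M.Ob) (hm : m ∈ M.IOb) (hε : ε = 1 ∨ ε = -1) {s : Q} (hs : s ∈ C.J)
    {p : Coord Q n} (hp : Planar w (p - M.pos o m (η * s)))
    (hnull : Lightlike (M.pos o m (η * s)) p)
    (hpr : M.Precedes o (M.ev m p) (M.ev m (M.pos o m (η * s)))) :
    PastNull η (C.U s) (C.V s) (nullU ε w p) (nullV ε w p) := by
  have h1 := hM.mink_nonneg_of_precedes hn ho hm ((h.mem_J s).1 hs) hpr
  rw [← neg_sub, mink_neg_left] at h1
  have h2 := h.mink_vel hε hs hp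
  have h3 := hnull.symm
  unfold Lightlike at h3
  rw [hp.mink_self hε, nullU_sub, nullV_sub, ← h.U_eq, ← h.V_eq] at h3
  have hr := C.r_pos s hs
  have hr' := inv_pos.2 hr
  have h4 : 0 ≤ (η * (C.U s - nullU ε w p)) * (C.r s)⁻¹ +
    (η * (C.V s - nullV ε w p)) * C.r s := by linarith
  refine ⟨by linarith, ?_⟩
  rcases mul_eq_zero.1 h3 with h5 | h5
  · have e : C.U s - nullU ε w p = 0 := by linarith
    rw [e, mul_zero, zero_mul, zero_add] at h4
    exact ⟨by rw [e, mul_zero], nonneg_of_mul_nonneg_left h4 hr⟩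
  · have e : C.V s - nullV ε w p = 0 := by linarith
    rw [e, mul_zero, zero_mul, add_zero] at h4
    exact ⟨nonneg_of_mul_nonneg_left h4 hr', by rw [e, mul_zero]⟩

theorem exists_of_photonSim (h : M.IsCurveOf o m ε w η C) (hM : M.AccRel) (hn : 2 ≤ n)
    (ho : o ∈ M.Ob) (hm : m ∈ M.IOb) (hε : ε = 1 ∨ ε = -1) {S : Set (Coord Q n)}
    (hS : PlanarOn S w) (hoS : M.wl m o ⊆ S) {p q : Coord Q n} (hp : p ∈ S) (hq : q ∈ S)
    (hsim : M.PhotonSim o (M.ev m p) (M.ev m q)) :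
    ∃ s ∈ C.J, PastNull η (C.U s) (C.V s) (nullU ε w p) (nullV ε w p) ∧
      PastNull η (C.U s) (C.V s) (nullU ε w q) (nullV ε w q) := by
  obtain ⟨e, he, hoe, ⟨ph, hph, h1, h2⟩, ⟨ph', hph', h1', h2'⟩, h3, h4⟩ := hsim
  obtain ⟨s, hs, rfl⟩ := h.exists_param hM ho hm he hoe
  have hsS := hoS (h.pos_mem hM ho hm hs)
  exact ⟨s, hs, h.pastNull hM hn ho hm hε hs (hS _ hp _ hsS)
      ((hM.lightlike_iff hm _ _).2 ⟨ph, ⟨hph, h1⟩, h2⟩) h3,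
    h.pastNull hM hn ho hm hε hs (hS _ hq _ hsS)
      ((hM.lightlike_iff hm _ _).2 ⟨ph', ⟨hph', h1'⟩, h2'⟩) h4⟩

theorem eq_zero_of_simult (h : M.IsCurveOf o m ε w η C) (hM : M.AccRel) (hn : 2 ≤ n)
    (ho : o ∈ M.Ob) (hm : m ∈ M.IOb) (hε : ε = 1 ∨ ε = -1) {s : Q} (hs : s ∈ C.J)
    {p : Coord Q n} (hp : Planar w (p - M.pos o m (η * s))) (hm' : m' ∈ M.IOb)
    (hc : M.CoMoving m' o (tpt n (η * s)))
    (hsim : M.Simult m' (M.ev m p) (M.ev m (M.pos o m (η * s)))) :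
    (nullU ε w p - C.U s) * (C.r s)⁻¹ + (nullV ε w p - C.V s) * C.r s = 0 := by
  have h1 := h.mink_vel hε hs hp
  rw [(hM.simult_iff hn ho hm hm' ((h.mem_J s).1 hs) hc).1 hsim, mul_zero] at h1
  rcases h.sign with rfl | rfl <;> linarith

theorem exists_of_minkSim (h : M.IsCurveOf o m ε w η C) (hM : M.AccRel) (hn : 2 ≤ n)
    (ho : o ∈ M.Ob) (hm : m ∈ M.IOb) (hε : ε = 1 ∨ ε = -1) {S : Set (Coord Q n)}
    (hS : PlanarOn S w) (hoS : M.wl m o ⊆ S) {p q : Coord Q n} (hp : p ∈ S) (hq : q ∈ S)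
    (hsim : M.MinkSim o (M.ev m p) (M.ev m q)) :
    ∃ s ∈ C.J, (nullU ε w p - C.U s) * (C.r s)⁻¹ + (nullV ε w p - C.V s) * C.r s = 0 ∧
      (nullU ε w q - C.U s) * (C.r s)⁻¹ + (nullV ε w q - C.V s) * C.r s = 0 := by
  obtain ⟨e, he, hoe, hsim⟩ := hsim
  obtain ⟨s, hs, rfl⟩ := h.exists_param hM ho hm he hoe
  have hsS := hoS (h.pos_mem hM ho hm hs)
  obtain ⟨m', hm', hc, hc'⟩ := h.exists_coMovingAt hM ho hm hs
  have swap : ∀ {e e'}, M.Simult m' e e' → M.Simult m' e' e :=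
    fun ⟨p, q, h1, h2, h3⟩ => ⟨q, p, h2, h1, h3.symm⟩
  obtain ⟨h1, h2, -⟩ := hsim m' hm' hc'
  exact ⟨s, hs, h.eq_zero_of_simult hM hn ho hm hε hs (hS _ hp _ hsS) hm' hc (swap h1),
    h.eq_zero_of_simult hM hn ho hm hε hs (hS _ hq _ hsS) hm' hc (swap h2)⟩

theorem minkSim (h : M.IsCurveOf o m ε w η C) (hM : M.AccRel) (hn : 2 ≤ n)
    (ho : o ∈ M.Ob) (hm : m ∈ M.IOb) (hε : ε = 1 ∨ ε = -1) {s : Q} (hs : s ∈ C.J)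
    {p : Coord Q n} (hp : Planar w (p - M.pos o m (η * s)))
    (e : (nullU ε w p - C.U s) * (C.r s)⁻¹ + (nullV ε w p - C.V s) * C.r s = 0) :
    M.MinkSim o (M.ev m (M.pos o m (η * s))) (M.ev m p) := by
  have h1 := h.mink_vel hε hs hp
  rw [e, mul_zero] at h1
  have h2 : mink (p - M.pos o m (η * s)) (M.vel o m (η * s)) = 0 := by linarith
  have h3 : mink (M.pos o m (η * s) - p) (M.vel o m (η * s)) = 0 := by
    rw [← neg_sub, mink_neg_left, h2, neg_zero]
  have h4 : mink (M.pos o m (η * s) - M.pos o m (η * s)) (M.vel o m (η * s)) = 0 := by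
    rw [sub_self, mink_zero_left]
  refine ⟨M.ev m (M.pos o m (η * s)), hM.ev_mem_allEv hm _, h.pos_mem hM ho hm hs,
    fun m' hm' hc => ?_⟩
  have hc := h.coMoving_of_at hM hn ho hm hs hc
  have hl := (h.mem_J s).1 hs
  exact ⟨(hM.simult_iff hn ho hm hm' hl hc).2 h4, (hM.simult_iff hn ho hm hm' hl hc).2 h3,
    (hM.simult_iff hn ho hm hm' hl hc).2 h3⟩

/-- Orthogonality to the velocity puts the event at `(U + x r, V - x / r)` for some `x`. Its
Minkowski square relative to `k` is `-x ^ 2`, while a co-moving observer finds `-l ^ 2`. -/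
theorem exists_at_of_atMinkDist {K : AccCurve M} (h : M.IsCurveOf o m ε w η K.toTimelikeCurve)
    (hM : M.AccRel) (hn : 2 ≤ n) (ho : o ∈ M.Ob) (hm : m ∈ M.IOb) (hε : ε = 1 ∨ ε = -1)
    {S : Set (Coord Q n)} (hS : PlanarOn S w) (hoS : M.wl m o ⊆ S) {p : Coord Q n} (hp : p ∈ S)
    {l : Q} (hl : M.AtMinkDist o (M.ev m p) l) :
    0 ≤ l ∧ ∃ t, K.At l t (nullU ε w p) (nullV ε w p) ∨
      K.At (-l) t (nullU ε w p) (nullV ε w p) := by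
  obtain ⟨e, he, hoe, hl⟩ := hl
  obtain ⟨s, hs, rfl⟩ := h.exists_param hM ho hm he hoe
  have hpl := hS _ hp _ (hoS (h.pos_mem hM ho hm hs))
  obtain ⟨m', hm', hc, hc'⟩ := h.exists_coMovingAt hM ho hm hs
  obtain ⟨hsim, p', q', hp', hq', hd⟩ := hl m' hm' hc'
  have h1 := h.eq_zero_of_simult hM hn ho hm hε hs hpl hm' hc hsim
  obtain ⟨p'', q'', hp'', hq'', e0⟩ := hsim
  rw [(hp' p'').1 hp'', (hq' q'').1 hq''] at e0
  obtain ⟨f, hf, hfm⟩ := hM.coMoving_coords hn ho hm hm' ((h.mem_J s).1 hs) hc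
  have ep := (hp' p').2 rfl
  have eq := (hq' q').2 rfl
  rw [hf] at ep eq
  have h2 := (hfm p' q').2
  rw [hM.ev_injective hn hm ep, hM.ev_injective hn hm eq, hpl.mink_self hε, nullU_sub, nullV_sub,
    ← h.U_eq, ← h.V_eq, mink, spaceComp_sub, ← eucLen_sq hM.axEOF, ← hd, Pi.sub_apply, e0] at h2
  have hr := (K.r_pos s hs).ne'
  obtain ⟨x, hx⟩ : ∃ x, x = (nullU ε w p - K.U s) * (K.r s)⁻¹ := ⟨_, rfl⟩
  rw [← hx] at h1
  have hU : nullU ε w p = K.U s + x * K.r s := by rw [hx]; field_simp; ring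
  have hV : nullV ε w p = K.V s - x * (K.r s)⁻¹ := by field_simp; linear_combination h1
  have hxl : x ^ 2 = l ^ 2 := by
    rw [hU, hV] at h2
    linear_combination h2 - x ^ 2 * mul_inv_cancel₀ hr
  refine ⟨by rw [hd]; exact eucLen_nonneg hM.axEOF _, s, ?_⟩
  rcases sq_eq_sq_iff_eq_or_eq_neg.1 hxl with e | e <;> rw [← e]
  · exact Or.inl ⟨hs, hU, hV⟩
  · exact Or.inr ⟨hs, hU, hV⟩

end IsCurveOf

variable {b c : B} {ηb ηc : Q} {Cb Cc : TimelikeCurve M}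

theorem AccRel.runsSlower_of_curves (hM : M.AccRel) (hn : 2 ≤ n) (hb : b ∈ M.Ob) (hc : c ∈ M.Ob)
    (hm : m ∈ M.IOb) (hCb : M.IsCurveOf b m ε w ηb Cb) (hCc : M.IsCurveOf c m ε w ηc Cc)
    {R : Set B → Set B → Prop}
    (h : ∀ s₁ ∈ Cb.J, ∀ s₂ ∈ Cb.J, ∀ σ₁ ∈ Cc.J, ∀ σ₂ ∈ Cc.J,
      R (M.ev m (M.pos b m (ηb * s₁))) (M.ev m (M.pos c m (ηc * σ₁))) →
      R (M.ev m (M.pos b m (ηb * s₂))) (M.ev m (M.pos c m (ηc * σ₂))) →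
      (s₁ ≠ s₂ ∨ σ₁ ≠ σ₂) → |s₁ - s₂| < |σ₁ - σ₂|) : M.RunsSlower R b c := by
  intro e₁ he₁ e₁' he₁' e₂ he₂ e₂' he₂' hb₁ hb₁' hc₂ hc₂' h1 h2 hne
  obtain ⟨s₁, hs₁, rfl⟩ := hCb.exists_param hM hb hm he₁ hb₁
  obtain ⟨s₂, hs₂, rfl⟩ := hCb.exists_param hM hb hm he₁' hb₁'
  obtain ⟨σ₁, hσ₁, rfl⟩ := hCc.exists_param hM hc hm he₂ hc₂
  obtain ⟨σ₂, hσ₂, rfl⟩ := hCc.exists_param hM hc hm he₂' hc₂'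
  refine ⟨_, _, hCb.timeIs hM hn hb hm hs₁ hs₂, hCc.timeIs hM hn hc hm hσ₁ hσ₂,
    h s₁ hs₁ s₂ hs₂ σ₁ hσ₁ σ₂ hσ₂ h1 h2 (hne.imp ?_ ?_)⟩ <;> exact mt fun e => by rw [e]

end Simultaneity

end RelFrame

namespace RelFrame

/-! ### The spaceship as curves at constant signed distances. -/

section Spaceship

variable {B Q : Type*} {n : ℕ} [Field Q] [LinearOrder Q] [IsStrictOrderedRing Q]
  [TopologicalSpace Q] [OrderTopology Q] {M : RelFrame B Q n}

variable {m b k c : B} {ε : Q} {w : Fin n → Q} {η : Q}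

/-- The relative acceleration in null coordinates. -/
theorem IsCurveOf.acc_null {C : TimelikeCurve M} (h : M.IsCurveOf k m ε w 1 C) (hM : M.AccRel)
    (hn : 2 ≤ n) (hk : k ∈ M.Ob) (hm : m ∈ M.IOb)
    (hacc : M.PositivelyAccelerated k) (hpl : PlanarOn (M.wl m k) w) {t : Q}
    {a : Coord Q n} (ha : (t, a) ∈ M.relAcc k m) :
    t ∈ C.J ∧ Planar w a ∧ HasD C.r C.J (nullU ε w a) t ∧
      nullV ε w a = -nullU ε w a / C.r t ^ 2 := by
  obtain ⟨ht, hD⟩ := hM.mem_relAcc hn hk hm hacc ha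
  have hJ : C.J = M.life k := by ext s; simpa using h.mem_J s
  have hU : ∀ s, nullU ε w (M.vel k m s) = C.r s := fun s => by simpa using h.vel_U s
  have hV : ∀ s ∈ C.J, nullV ε w (M.vel k m s) = (C.r s)⁻¹ := fun s hs => by
    simpa using h.vel_V s hs
  have htJ : t ∈ C.J := by rwa [hJ]
  rw [← hJ] at hD
  have hne : (𝓝[C.J \ {t}] t).NeBot :=
    nhdsWithin_diff_neBot C.ordConnected htJ (C.nontrivial t htJ)
  have h1 : HasD C.r C.J (nullU ε w a) t := (HasD.nullU hD ε w).congr (fun s _ => hU s) htJ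
  have h2 : HasD (fun s => (C.r s)⁻¹) C.J (nullV ε w a) t := (HasD.nullV hD ε w).congr hV htJ
  refine ⟨htJ, ?_, h1, h2.unique (h1.inv (C.r_pos t htJ).ne') hne⟩
  refine planar_of_hasD hD htJ hne fun s hs => Planar.sub ?_ ?_
  · exact hM.planar_vel hn hk hm hpl (hJ ▸ hs)
  · exact hM.planar_vel hn hk hm hpl ht

/-- Since the null coordinates of the velocity are `r` and `1 / r`, those of the acceleration are
`r'` and `-r' / r ^ 2`. Its Minkowski square `-x ^ 2` then gives `r' = ± x r`, and `hpos` selects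
the positive sign. -/
theorem IsCurveOf.exists_accCurve {C : TimelikeCurve M} (h : M.IsCurveOf k m ε w 1 C)
    (hM : M.AccRel) (hn : 2 ≤ n) (hk : k ∈ M.Ob) (hm : m ∈ M.IOb)
    (hacc : M.PositivelyAccelerated k) (hpl : PlanarOn (M.wl m k) w) (hε : ε = 1 ∨ ε = -1)
    (hpos : ∀ t a, (t, a) ∈ M.relAcc k m → 0 < spaceComp a ⬝ᵥ w) :
    ∃ K : AccCurve M, K.toTimelikeCurve = C ∧ ∀ t ∈ K.J, ∃ a, (t, a) ∈ M.relAcc k m ∧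
      Planar w a ∧ nullU ε w a = K.α t * K.r t ∧ nullV ε w a = -(K.α t * (K.r t)⁻¹) := by
  have hex : ∀ t ∈ C.J, ∃ x : Q, 0 < x ∧ ∃ a, (t, a) ∈ M.relAcc k m ∧ Planar w a ∧
      HasD C.r C.J (nullU ε w a) t ∧
      nullU ε w a = x * C.r t ∧ nullV ε w a = -(x * (C.r t)⁻¹) := by
    intro t ht
    obtain ⟨a, x, ha, hx, hax⟩ := hM.exists_acc hm hacc (by simpa using (h.mem_J t).1 ht)
    obtain ⟨-, hpla, h1, h2⟩ := h.acc_null hM hn hk hm hacc hpl ha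
    have hr := C.r_pos t ht
    have h3 := nullU_sub_nullV (ε := ε) (w := w) (p := a)
    have h4 := hpos t a ha
    have h5 : nullU ε w a = x * C.r t := by
      rw [hpla.mink_self hε, h2] at hax
      have h6 : 0 < nullU ε w a := by
        by_contra hle
        have : 0 ≤ -nullU ε w a / C.r t ^ 2 := by
          apply div_nonneg
          · linarith
          · positivity
        linarith
      have h7 : nullU ε w a ^ 2 = (x * C.r t) ^ 2 := by
        field_simp at hax
        linear_combination -hax
      exact (pow_left_inj₀ h6.le (by positivity) two_ne_zero).1 h7
    refine ⟨x, hx, a, ha, hpla, h1, h5, ?_⟩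
    rw [h2, h5]
    field_simp
  choose! α hα hαa using hex
  refine ⟨⟨C, α, ?_, fun t ht => ?_, hα⟩, rfl, fun t ht => ?_⟩
  · have e : C.r = fun s => nullU ε w (M.vel k m s) := by
      ext s
      simpa using (h.vel_U s).symm
    rw [e]
    exact DefFun.nullU (F := fun v => M.vel k m (v 0)) (hM.def_vel hn hk hm) ε w
  · obtain ⟨a, -, -, h1, h2, -⟩ := hαa t ht
    rwa [h2] at h1
  · obtain ⟨a, h1, h2, -, h3⟩ := hαa t ht
    exact ⟨a, h1, h2, h3⟩

theorem AccRel.eq_of_accIs (hM : M.AccRel) {K : AccCurve M} (hm : m ∈ M.IOb)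
    (hε : ε = 1 ∨ ε = -1) {t x : Q} (ht : t ∈ K.J) {a : Coord Q n} (ha : (t, a) ∈ M.relAcc k m)
    (hpl : Planar w a) (hU : nullU ε w a = K.α t * K.r t)
    (hV : nullV ε w a = -(K.α t * (K.r t)⁻¹)) (hx : M.AccIs k t x) (hx0 : 0 < x) :
    x = K.α t := by
  obtain ⟨a', ha', e⟩ := hx m hm
  have h1 := mink_of_minkLen_neg hM.axEOF hx0 e
  obtain rfl : a' = a := ha.2.2 a' ha'.2.1
  have hr := (K.r_pos t ht).ne'
  rw [hpl.mink_self hε, hU, hV] at h1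
  have h2 : x ^ 2 = K.α t ^ 2 := by
    linear_combination h1 + K.α t ^ 2 * mul_inv_cancel₀ hr
  exact (pow_left_inj₀ hx0.le (K.α_pos t ht).le two_ne_zero).1 h2

/-- The spaceship `b`, `k`, `c` in null coordinates: `b` and `c` keep the signed distances
`x < y` from the accelerated observer `k`. -/
structure IsShip (M : RelFrame B Q n) (m b k c : B) (ε : Q) (w : Fin n → Q) (K : AccCurve M)
    (Cb Cc : TimelikeCurve M) (ηb ηc x y : Q) : Prop where
  planar : PlanarOn (M.wl m b ∪ M.wl m k ∪ M.wl m c) w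
  orient : ε = 1 ∨ ε = -1
  curve_k : M.IsCurveOf k m ε w 1 K.toTimelikeCurve
  curve_b : M.IsCurveOf b m ε w ηb Cb
  curve_c : M.IsCurveOf c m ε w ηc Cc
  keeps_b : Cb.KeepsDist K x
  keeps_c : Cc.KeepsDist K y
  lt : x < y

theorem PlanarOn.mono {S T : Set (Coord Q n)} (h : PlanarOn T w) (hST : S ⊆ T) : PlanarOn S w :=
  fun p hp q hq => h p (hST hp) q (hST hq)

theorem exists_planarOn_pos (hE : ∀ x : Q, 0 < x → ∃ y : Q, y ^ 2 = x) {S : Set (Coord Q n)}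
    (h : InVerticalPlane S) {p q : Coord Q n} (hp : p ∈ S) (hq : q ∈ S)
    (hpq : mink (p - q) (p - q) < 0) :
    ∃ w : Fin n → Q, PlanarOn S w ∧ 0 < spaceComp (p - q) ⬝ᵥ w := by
  obtain ⟨w, hw⟩ := InVerticalPlane.exists_planarOn hE h
  rcases lt_trichotomy (spaceComp (p - q) ⬝ᵥ w) 0 with h | h | h
  · exact ⟨-w, fun p hp q hq => (hw p hp q hq).neg, by rw [dotProduct_neg]; linarith⟩
  · have h1 := hw p hp q hq
    unfold Planar at h1
    rw [h, zero_smul] at h1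
    rw [mink, h1, zero_dotProduct, sub_zero] at hpq
    exact absurd (mul_self_nonneg _) (not_le.2 hpq)
  · exact ⟨w, hw, h⟩

theorem dot_pos_of_sameDir {a p : Coord Q n} (h : SameDir a p) (hp : Spacelike p)
    (hw : 0 < spaceComp p ⬝ᵥ w) : 0 < spaceComp a ⬝ᵥ w := by
  rcases h with ⟨-, -, l, hl, e⟩ | ⟨-, h, -⟩
  · rw [← e, smul_dotProduct, smul_eq_mul] at hw
    exact pos_of_mul_pos_right hw hl.le
  · exact absurd h (not_timelike_of_spacelike hp)

/-- From an event at signed distance `-l` to the simultaneous event of `k` the direction is that of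
the acceleration, so `hfar` applies and gives `l < 1 / α τ` for every `τ`. -/
theorem good_of_notTooFarBehind (hM : M.AccRel) (hn : 2 ≤ n) (hk : k ∈ M.Ob) (hm : m ∈ M.IOb)
    {K : AccCurve M} (hK : M.IsCurveOf k m ε w 1 K.toTimelikeCurve)
    (hacc : ∀ t ∈ K.J, ∃ a, (t, a) ∈ M.relAcc k m ∧ Planar w a ∧
      nullU ε w a = K.α t * K.r t ∧ nullV ε w a = -(K.α t * (K.r t)⁻¹))
    (hfar : M.NotTooFarBehind b k) (hε : ε = 1 ∨ ε = -1) {q : Coord Q n} (hq : q ∈ M.wl m b)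
    (hpl : ∀ t ∈ K.J, Planar w (q - M.pos k m t)) {l t : Q} (hl : 0 < l)
    (h : K.At (-l) t (nullU ε w q) (nullV ε w q)) : K.Good (-l) := by
  obtain ⟨ht, hU, hV⟩ := h
  obtain ⟨a, ha, hpla, haU, haV⟩ := hacc t ht
  have hr := K.r_pos t ht
  have hα := K.α_pos t ht
  have hpl' := hpl t ht
  have hkU := hK.U_eq t
  have hkV := hK.V_eq t
  rw [one_mul] at hkU hkV
  have hplp : Planar w (M.pos k m t - q) := by
    have h0 : Planar w (0 : Coord Q n) := by simp [Planar]
    simpa using h0.sub hpl'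
  have hpU : nullU ε w (M.pos k m t - q) = l * K.r t := by
    rw [nullU_sub, ← hkU, hU]; ring
  have hpV : nullV ε w (M.pos k m t - q) = -(l * (K.r t)⁻¹) := by
    rw [nullV_sub, ← hkV, hV]; ring
  have hminkp : mink (M.pos k m t - q) (M.pos k m t - q) = -l ^ 2 := by
    rw [hplp.mink_self hε, hpU, hpV]
    linear_combination -l ^ 2 * mul_inv_cancel₀ hr.ne'
  have hminka : mink a a = -K.α t ^ 2 := by
    rw [hpla.mink_self hε, haU, haV]
    linear_combination -K.α t ^ 2 * mul_inv_cancel₀ hr.ne'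
  have hdir : SameDir a (M.pos k m t - q) := by
    refine Or.inl ⟨(spacelike_iff hM.axEOF _).2 ?_, (spacelike_iff hM.axEOF _).2 ?_, l / K.α t,
      by positivity, ?_⟩
    · rw [hminka, neg_lt_zero]; positivity
    · rw [hminkp, neg_lt_zero]; positivity
    · have h1 := nullU_sub_nullV (ε := ε) (w := w) (p := M.pos k m t - q)
      have h2 := nullU_sub_nullV (ε := ε) (w := w) (p := a)
      rw [hpU, hpV] at h1
      rw [haU, haV] at h2
      rw [hplp, hpla, smul_smul]
      congr 1
      have h3 : 2 * (l / K.α t * (spaceComp a ⬝ᵥ w)) =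
          2 * (spaceComp (M.pos k m t - q) ⬝ᵥ w) := by
        rw [← h1, mul_left_comm, ← h2]
        field_simp
      linarith
  have hlife : ∀ t, t ∈ K.J → t ∈ M.life k := fun t ht => by simpa using (hK.mem_J t).1 ht
  have hsim : M.MinkSim k (M.ev m (M.pos k m t)) (M.ev m q) := by
    have := hK.minkSim hM hn hk hm hε ht (p := q) (by simpa using hpl') (by
      rw [hU, hV]
      field_simp
      ring)
    simpa using this
  intro τ hτ
  obtain ⟨a', ha', hpla', haU', haV'⟩ := hacc τ hτ
  obtain ⟨x, hx, hlx⟩ := hfar m hm t a ha _ (hM.ev_nonempty hm _) q (hM.ev_nonempty hm _)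
    (hM.pos_mem_wl hk hm (hlife t ht)) hq hsim hdir τ ⟨a', ha'⟩
  rw [minkLen_of_neg hM.axEOF hl hminkp, neg_neg] at hlx
  have hx0 : 0 < x := one_div_pos.1 (hl.trans hlx)
  rw [hM.eq_of_accIs hm hε hτ ha' hpla' haU' haV' hx hx0, lt_div_iff₀ (K.α_pos τ hτ)] at hlx
  linarith

/-- A Minkowski spaceship for which the events of `b` and `c` are spacelike separated at least
once. -/
theorem AccRel.exists_isShip (hM : M.AccRel) (hn : 2 ≤ n) (hb : b ∈ M.Ob) (hk : k ∈ M.Ob)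
    (hc : c ∈ M.Ob) (hm : m ∈ M.IOb) (hcop : M.CoplanarFor m b k c) (hdb : M.ConstMinkDist k b)
    (hdc : M.ConstMinkDist k c) (hacc : M.PositivelyAccelerated k)
    (hdir : M.DirectionOfAcceleration b k c) (hfar : M.NotTooFarBehind b k)
    {p q : Coord Q n} (hp : p ∈ M.wl m c) (hq : q ∈ M.wl m b) (hpq : mink (p - q) (p - q) < 0) :
    ∃ ε w K Cb Cc ηb ηc x y, M.IsShip m b k c ε w K Cb Cc ηb ηc x y := by
  obtain ⟨w, hw, hpos⟩ := exists_planarOn_pos hM.axEOF hcop (Or.inr hp) (Or.inl (Or.inl hq)) hpq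
  have hwb : M.wl m b ⊆ M.wl m b ∪ M.wl m k ∪ M.wl m c := fun _ h => Or.inl (Or.inl h)
  have hwk : M.wl m k ⊆ M.wl m b ∪ M.wl m k ∪ M.wl m c := fun _ h => Or.inl (Or.inr h)
  have hwc : M.wl m c ⊆ M.wl m b ∪ M.wl m k ∪ M.wl m c := fun _ h => Or.inr h
  obtain ⟨ε, C, hε, hC⟩ := hM.exists_isCurveOf_one hn hk hm (hw.mono hwk)
  obtain ⟨ηb, Cb, hCb⟩ := hM.exists_isCurveOf hn hb hm (hw.mono hwb) hε
  obtain ⟨ηc, Cc, hCc⟩ := hM.exists_isCurveOf hn hc hm (hw.mono hwc) hε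
  have hsp := (spacelike_iff hM.axEOF (p - q)).2 hpq
  obtain ⟨K, rfl, hK⟩ := hC.exists_accCurve hM hn hk hm hacc (hw.mono hwk) hε fun t a ha =>
    dot_pos_of_sameDir (hdir m hm hcop t a ha p (hM.ev_nonempty hm p) q (hM.ev_nonempty hm q)
      hp hq hsp) hsp hpos
  obtain ⟨lb, hlb⟩ := hdb
  obtain ⟨lc, hlc⟩ := hdc
  have hatb := fun s (hs : s ∈ Cb.J) => hC.exists_at_of_atMinkDist hM hn hk hm hε hw hwk
    (hwb (hCb.pos_mem hM hb hm hs)) (hlb _ (hM.ev_mem_allEv hm _) (hCb.pos_mem hM hb hm hs))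
  have hatc := fun s (hs : s ∈ Cc.J) => hC.exists_at_of_atMinkDist hM hn hk hm hε hw hwk
    (hwc (hCc.pos_mem hM hc hm hs)) (hlc _ (hM.ev_mem_allEv hm _) (hCc.pos_mem hM hc hm hs))
  simp only [← hCb.U_eq, ← hCb.V_eq] at hatb
  simp only [← hCc.U_eq, ← hCc.V_eq] at hatc
  obtain ⟨s, hs, hqs⟩ := hCb.exists_param_of_mem hM hn hb hm hq
  obtain ⟨σ, hσ, hpσ⟩ := hCc.exists_param_of_mem hM hn hc hm hp
  have hqU : nullU ε w q = Cb.U s := by rw [hqs, hCb.U_eq]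
  have hqV : nullV ε w q = Cb.V s := by rw [hqs, hCb.V_eq]
  have hpU : nullU ε w p = Cc.U σ := by rw [hpσ, hCc.U_eq]
  have hpV : nullV ε w p = Cc.V σ := by rw [hpσ, hCc.V_eq]
  obtain ⟨x, t, hat, hgood⟩ : ∃ x t, K.At x t (Cb.U s) (Cb.V s) ∧ K.Good x := by
    obtain ⟨hl, t, h | h⟩ := hatb s hs
    · exact ⟨lb, t, h, K.good_of_nonneg hl⟩
    · rcases hl.eq_or_lt with h0 | hl
      · exact ⟨-lb, t, h, K.good_of_nonneg (by rw [← h0, neg_zero])⟩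
      · refine ⟨-lb, t, h, good_of_notTooFarBehind hM hn hk hm hC hK hfar hε hq ?_ hl
          (by rw [hqU, hqV]; exact h)⟩
        intro t ht
        refine hw _ (hwb hq) _ (hwk (hM.pos_mem_wl hk hm ?_))
        simpa using (hC.mem_J t).1 ht
  obtain ⟨y, τ, hat'⟩ : ∃ y τ, K.At y τ (Cc.U σ) (Cc.V σ) := by
    obtain ⟨-, t, h | h⟩ := hatc σ hσ
    · exact ⟨_, t, h⟩
    · exact ⟨_, t, h⟩
  -- The distance `y` is not known to be good here; its goodness follows afterwards from `x < y`.
  have hxy : x < y := by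
    have h1 := nullU_sub_nullV (ε := ε) (w := w) (p := p - q)
    rw [(hw p (hwc hp) q (hwb hq)).mink_self hε] at hpq
    rw [nullU_sub, nullV_sub, hqU, hqV, hpU, hpV] at h1 hpq
    rcases mul_neg_iff.1 hpq with ⟨h2, h3⟩ | ⟨h2, h3⟩
    · exact hat.lt_of_right hM.cont hgood hat' (by linarith) (by linarith)
        (Or.inl (by linarith [h2] : Cb.U s < Cc.U σ).ne)
    · linarith
  exact ⟨ε, w, K, Cb, Cc, ηb, ηc, x, y, hw, hε, hC, hCb, hCc,
    Cb.keepsDist_of_at K hM.cont (hatb s hs).1 (fun s hs => (hatb s hs).2) hs hat hgood,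
    Cc.keepsDist_of_at K hM.cont (hatc σ hσ).1 (fun s hs => (hatc s hs).2) hσ hat'
      (hgood.mono hxy.le), hxy⟩

end Spaceship

end RelFrame

namespace RelFrame

/-! ### Comparison of the clocks for each simultaneity. -/

section Comparison

variable {B Q : Type*} {n : ℕ} [Field Q] [LinearOrder Q] [IsStrictOrderedRing Q]
  [TopologicalSpace Q] [OrderTopology Q] {M : RelFrame B Q n}

variable {m b k c : B} {ε : Q} {w : Fin n → Q} {η ηb ηc x y : Q} {K : AccCurve M}
  {Cb Cc : TimelikeCurve M}

/-- Points on the same branch of a light cone are null related; on different branches they are null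
or spacelike related. -/
theorem PastNull.mul_nonpos {u v p q p' q' : Q} (hη : η = 1 ∨ η = -1)
    (h : PastNull η u v p q) (h' : PastNull η u v p' q') : (p' - p) * (q' - q) ≤ 0 := by
  obtain ⟨h1, h2, h3⟩ := h
  obtain ⟨h1', h2', h3'⟩ := h'
  have hη2 : η * η = 1 := by rcases hη with rfl | rfl <;> norm_num
  have key : ∀ {a b : Q}, 0 ≤ η * a → 0 ≤ η * b → 0 ≤ a * b := fun {a b} ha hb => by
    have := mul_nonneg ha hb
    rwa [mul_mul_mul_comm, hη2, one_mul] at this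
  rcases mul_eq_zero.1 h1 with e | e <;> rcases mul_eq_zero.1 h1' with e' | e'
  · rw [show p' - p = 0 by linarith, zero_mul]
  · rw [show q' - q = v - q by linarith, show p' - p = -(u - p') by linarith, neg_mul,
      neg_nonpos]
    exact key h2' h3
  · rw [show q' - q = -(v - q') by linarith, show p' - p = u - p by linarith, mul_neg,
      neg_nonpos]
    exact key h2 h3'
  · rw [show q' - q = 0 by linarith, mul_zero]

/-- Two points on a spacelike line are not timelike separated. -/
theorem mul_nonpos_of_orthogonal {u v r p q p' q' : Q} (hr : 0 < r)
    (h : (p - u) * r⁻¹ + (q - v) * r = 0) (h' : (p' - u) * r⁻¹ + (q' - v) * r = 0) :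
    (p' - p) * (q' - q) ≤ 0 := by
  have h1 : q' - q = -((p' - p) * (r⁻¹) ^ 2) := by
    have := mul_inv_cancel₀ hr.ne'
    linear_combination r⁻¹ * (h' - h) - (q' - q) * this
  rw [h1, mul_neg, neg_nonpos, ← mul_assoc]
  exact mul_nonneg (mul_self_nonneg _) (sq_nonneg _)

/-- This supplies the spacelike pair without which the direction hypothesis says nothing. As `b` and
`c` never meet, null related events of theirs are distinct, as `TimelikeCurve.exists_spacelike`
requires. -/
theorem AccRel.exists_spacelike_pair (hM : M.AccRel) (hb : b ∈ M.Ob)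
    (hc : c ∈ M.Ob) (hm : m ∈ M.IOb) (hε : ε = 1 ∨ ε = -1)
    (hpl : PlanarOn (M.wl m b ∪ M.wl m c) w) (hCb : M.IsCurveOf b m ε w ηb Cb)
    (hCc : M.IsCurveOf c m ε w ηc Cc) (hbc : ∀ e ∈ M.AllEv, ¬ (b ∈ e ∧ c ∈ e))
    {s₁ s₂ σ₁ σ₂ : Q} (hs₁ : s₁ ∈ Cb.J) (hs₂ : s₂ ∈ Cb.J) (hσ₁ : σ₁ ∈ Cc.J) (hσ₂ : σ₂ ∈ Cc.J)
    (h1 : (Cc.U σ₁ - Cb.U s₁) * (Cc.V σ₁ - Cb.V s₁) ≤ 0)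
    (h2 : (Cc.U σ₂ - Cb.U s₂) * (Cc.V σ₂ - Cb.V s₂) ≤ 0) (hne : s₁ ≠ s₂ ∨ σ₁ ≠ σ₂) :
    ∃ p ∈ M.wl m c, ∃ q ∈ M.wl m b, mink (p - q) (p - q) < 0 := by
  have hplan : ∀ s ∈ Cb.J, ∀ σ ∈ Cc.J,
      Planar w (M.pos c m (ηc * σ) - M.pos b m (ηb * s)) := fun s hs σ hσ =>
    hpl _ (Or.inr (hCc.pos_mem hM hc hm hσ)) _ (Or.inl (hCb.pos_mem hM hb hm hs))
  have hne' : ∀ s ∈ Cb.J, ∀ σ ∈ Cc.J, Cc.U σ ≠ Cb.U s ∨ Cc.V σ ≠ Cb.V s := by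
    intro s hs σ hσ
    by_contra! h
    rw [hCc.U_eq, hCb.U_eq, hCc.V_eq, hCb.V_eq, ← sub_eq_zero, ← nullU_sub,
      ← sub_eq_zero (a := nullV _ _ _),
      ← nullV_sub] at h
    have e := sub_eq_zero.1 ((hplan s hs σ hσ).eq_zero hε h.1 h.2)
    refine hbc _ (hM.ev_mem_allEv hm _) ⟨hCb.pos_mem hM hb hm hs, ?_⟩
    rw [← e]
    exact hCc.pos_mem hM hc hm hσ
  have fin : (∃ σ ∈ Cc.J, ∃ s ∈ Cb.J, (Cc.U σ - Cb.U s) * (Cc.V σ - Cb.V s) < 0) →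
      ∃ p ∈ M.wl m c, ∃ q ∈ M.wl m b, mink (p - q) (p - q) < 0 := by
    rintro ⟨σ, hσ, s, hs, h⟩
    refine ⟨_, hCc.pos_mem hM hc hm hσ, _, hCb.pos_mem hM hb hm hs, ?_⟩
    rwa [(hplan s hs σ hσ).mink_self hε, nullU_sub, nullV_sub, ← hCc.U_eq, ← hCb.U_eq,
      ← hCc.V_eq, ← hCb.V_eq]
  rcases h1.lt_or_eq with h | h1
  · exact fin ⟨σ₁, hσ₁, s₁, hs₁, h⟩
  rcases h2.lt_or_eq with h | h2
  · exact fin ⟨σ₂, hσ₂, s₂, hs₂, h⟩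
  exact fin (Cc.exists_spacelike Cb hM.cont hσ₁ hσ₂ hs₁ hs₂ h1 (hne' s₁ hs₁ σ₁ hσ₁) h2
    (hne' s₂ hs₂ σ₂ hσ₂) hne.symm)

theorem AccCurve.At.eq_tm {C : TimelikeCurve M} (hC : M.CONT) (h : C.KeepsDist K x) {s t : Q}
    (hs : s ∈ C.J) (ht : t ∈ K.J)
    (e : (C.U s - K.U t) * (K.r t)⁻¹ + (C.V s - K.V t) * K.r t = 0) : C.tm K x s = t := by
  refine ((h.at_tm hs).unique hC h.1 (y := (C.U s - K.U t) * (K.r t)⁻¹) ⟨ht, ?_, ?_⟩).2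
  · have := mul_inv_cancel₀ (K.r_pos t ht).ne'
    linear_combination -(C.U s - K.U t) * this
  · have := mul_inv_cancel₀ (K.r_pos t ht).ne'
    linear_combination (K.r t)⁻¹ * e - (C.V s - K.V t) * this

/-- Light reaching `K` with constant `V` and different `U` comes from the left, that is, from a
negative signed distance. -/
theorem AccCurve.At.U_eq_of_pastNull (hC : M.CONT) (hx : K.Good x) {t t' u v : Q}
    (h : K.At x t' u v) (ht : t ∈ K.J) (hp : PastNull 1 (K.U t) (K.V t) u v) (h0 : 0 ≤ x) :
    K.U t = u := by
  obtain ⟨h1, h2, h3⟩ := hp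
  rw [one_mul] at h2 h3
  by_contra hne
  rcases mul_eq_zero.1 h1 with e | e
  · exact hne (sub_eq_zero.1 e)
  · exact absurd (h.lt_of_right hC hx ⟨ht, by simp, by simp⟩ (sub_nonneg.1 h2)
      (sub_eq_zero.1 e).le (Or.inl (Ne.symm hne))) (not_lt.2 h0)

theorem AccCurve.At.V_eq_of_pastNull (hC : M.CONT) {t t' u v : Q}
    (h : K.At x t' u v) (ht : t ∈ K.J) (hp : PastNull 1 (K.U t) (K.V t) u v) (h0 : x ≤ 0) :
    K.V t = v := by
  obtain ⟨h1, h2, h3⟩ := hp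
  rw [one_mul] at h2 h3
  by_contra hne
  rcases mul_eq_zero.1 h1 with e | e
  · have h4 : K.At 0 t (K.U t) (K.V t) := ⟨ht, by simp, by simp⟩
    exact absurd (h4.lt_of_right hC K.good_zero h (sub_eq_zero.1 e).le (sub_nonneg.1 h3)
      (Or.inr hne)) (not_lt.2 h0)
  · exact hne (sub_eq_zero.1 e)

theorem TimelikeCurve.eq_of_mul_eq_zero {C : TimelikeCurve M} (hC : M.CONT) {s s' : Q}
    (hs : s ∈ C.J) (hs' : s' ∈ C.J) (h : (C.U s - C.U s') * (C.V s - C.V s') = 0) : s = s' := by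
  rcases mul_eq_zero.1 h with e | e
  · exact (C.monoU hC).injOn hs hs' (sub_eq_zero.1 e)
  · exact (C.monoV hC).injOn hs hs' (sub_eq_zero.1 e)

namespace IsShip

variable {s σ : Q}

theorem lt_of_V_eq (h : M.IsShip m b k c ε w K Cb Cc ηb ηc x y) (hC : M.CONT) (hs : s ∈ Cb.J)
    (hσ : σ ∈ Cc.J) (e : Cb.V s = Cc.V σ) : Cb.U s < Cc.U σ := by
  by_contra hle
  exact absurd ((h.keeps_c.at_tm hσ).le_of_right hC h.keeps_c.1 (h.keeps_b.at_tm hs)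
    (not_lt.1 hle) e.le) (not_le.2 h.lt)

theorem lt_of_U_eq (h : M.IsShip m b k c ε w K Cb Cc ηb ηc x y) (hC : M.CONT) (hs : s ∈ Cb.J)
    (hσ : σ ∈ Cc.J) (e : Cb.U s = Cc.U σ) : Cc.V σ < Cb.V s := by
  by_contra hle
  exact absurd ((h.keeps_c.at_tm hσ).le_of_right hC h.keeps_c.1 (h.keeps_b.at_tm hs)
    e.ge (not_lt.1 hle)) (not_le.2 h.lt)

theorem wl_b (_ : M.IsShip m b k c ε w K Cb Cc ηb ηc x y) :
    M.wl m b ⊆ M.wl m b ∪ M.wl m k ∪ M.wl m c := fun _ h => Or.inl (Or.inl h)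

theorem wl_k (_ : M.IsShip m b k c ε w K Cb Cc ηb ηc x y) :
    M.wl m k ⊆ M.wl m b ∪ M.wl m k ∪ M.wl m c := fun _ h => Or.inl (Or.inr h)

theorem wl_c (_ : M.IsShip m b k c ε w K Cb Cc ηb ηc x y) :
    M.wl m c ⊆ M.wl m b ∪ M.wl m k ∪ M.wl m c := fun _ h => Or.inr h

theorem runsSlower_minkSim (h : M.IsShip m b k c ε w K Cb Cc ηb ηc x y) (hM : M.AccRel)
    (hn : 2 ≤ n) (hb : b ∈ M.Ob) (hk : k ∈ M.Ob) (hc : c ∈ M.Ob) (hm : m ∈ M.IOb) :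
    M.RunsSlower (M.MinkSim k) b c := by
  refine hM.runsSlower_of_curves hn hb hc hm h.curve_b h.curve_c
    fun s₁ hs₁ s₂ hs₂ σ₁ hσ₁ σ₂ hσ₂ h1 h2 hne => ?_
  have key : ∀ s ∈ Cb.J, ∀ σ ∈ Cc.J, M.MinkSim k (M.ev m (M.pos b m (ηb * s)))
      (M.ev m (M.pos c m (ηc * σ))) → Cb.tm K x s = Cc.tm K y σ := by
    intro s hs σ hσ hsim
    obtain ⟨t, ht, h1, h2⟩ := h.curve_k.exists_of_minkSim hM hn hk hm h.orient h.planar h.wl_k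
      (h.wl_b (h.curve_b.pos_mem hM hb hm hs)) (h.wl_c (h.curve_c.pos_mem hM hc hm hσ)) hsim
    rw [← h.curve_b.U_eq, ← h.curve_b.V_eq] at h1
    rw [← h.curve_c.U_eq, ← h.curve_c.V_eq] at h2
    rw [AccCurve.At.eq_tm hM.cont h.keeps_b hs ht h1, AccCurve.At.eq_tm hM.cont h.keeps_c hσ ht h2]
  exact h.keeps_b.slower_of_tm_eq hM.cont h.keeps_c h.lt hs₁ hs₂ hσ₁ hσ₂
    (key s₁ hs₁ σ₁ hσ₁ h1) (key s₂ hs₂ σ₂ hσ₂ h2) hne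

theorem exists_pastNull (h : M.IsShip m b k c ε w K Cb Cc ηb ηc x y) (hM : M.AccRel)
    (hn : 2 ≤ n) (hb : b ∈ M.Ob) (hc : c ∈ M.Ob) (hm : m ∈ M.IOb) {o : B} (ho : o ∈ M.Ob)
    {C : TimelikeCurve M} (hC : M.IsCurveOf o m ε w η C)
    (hoS : M.wl m o ⊆ M.wl m b ∪ M.wl m k ∪ M.wl m c) (hs : s ∈ Cb.J) (hσ : σ ∈ Cc.J)
    (hsim : M.PhotonSim o (M.ev m (M.pos b m (ηb * s))) (M.ev m (M.pos c m (ηc * σ)))) :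
    ∃ t ∈ C.J, PastNull η (C.U t) (C.V t) (Cb.U s) (Cb.V s) ∧
      PastNull η (C.U t) (C.V t) (Cc.U σ) (Cc.V σ) := by
  have := hC.exists_of_photonSim hM hn ho hm h.orient h.planar hoS
    (h.wl_b (h.curve_b.pos_mem hM hb hm hs)) (h.wl_c (h.curve_c.pos_mem hM hc hm hσ)) hsim
  rwa [← h.curve_b.U_eq, ← h.curve_b.V_eq, ← h.curve_c.U_eq, ← h.curve_c.V_eq] at this

theorem runsSlower_photonSim_b (h : M.IsShip m b k c ε w K Cb Cc ηb ηc x y) (hM : M.AccRel)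
    (hn : 2 ≤ n) (hb : b ∈ M.Ob) (hc : c ∈ M.Ob) (hm : m ∈ M.IOb) :
    M.RunsSlower (M.PhotonSim b) b c := by
  refine hM.runsSlower_of_curves hn hb hc hm h.curve_b h.curve_c
    fun s₁ hs₁ s₂ hs₂ σ₁ hσ₁ σ₂ hσ₂ h1 h2 hne => ?_
  have key : ∀ s ∈ Cb.J, ∀ σ ∈ Cc.J, M.PhotonSim b (M.ev m (M.pos b m (ηb * s)))
      (M.ev m (M.pos c m (ηc * σ))) →
      (ηb = 1 → Cb.U s = Cc.U σ) ∧ (ηb = -1 → Cb.V s = Cc.V σ) := by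
    intro s hs σ hσ hsim
    obtain ⟨t, ht, h1, h2, h3, h4⟩ :=
      h.exists_pastNull hM hn hb hc hm hb h.curve_b h.wl_b hs hσ hsim
    -- Null related events of one timelike curve coincide, so `b` receives the light from `c` at its
    -- own matched event. The time orientation of `b` then decides which null coordinate is shared.
    obtain rfl := TimelikeCurve.eq_of_mul_eq_zero hM.cont ht hs h1.1
    rcases mul_eq_zero.1 h2 with e | e
    · have e' := sub_eq_zero.1 e
      refine ⟨fun _ => e', fun hη => ?_⟩
      have := h.lt_of_U_eq hM.cont hs hσ e'
      rw [hη] at h4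
      linarith
    · have e' := sub_eq_zero.1 e
      refine ⟨fun hη => ?_, fun _ => e'⟩
      have := h.lt_of_V_eq hM.cont hs hσ e'
      rw [hη] at h3
      linarith
  rcases h.curve_b.sign with hη | hη
  · exact h.keeps_b.slower_of_U_eq hM.cont h.keeps_c h.lt hs₁ hs₂ hσ₁ hσ₂
      ((key s₁ hs₁ σ₁ hσ₁ h1).1 hη) ((key s₂ hs₂ σ₂ hσ₂ h2).1 hη) hne
  · exact h.keeps_b.slower_of_V_eq hM.cont h.keeps_c h.lt hs₁ hs₂ hσ₁ hσ₂
      ((key s₁ hs₁ σ₁ hσ₁ h1).2 hη) ((key s₂ hs₂ σ₂ hσ₂ h2).2 hη) hne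

theorem runsSlower_photonSim_c (h : M.IsShip m b k c ε w K Cb Cc ηb ηc x y) (hM : M.AccRel)
    (hn : 2 ≤ n) (hb : b ∈ M.Ob) (hc : c ∈ M.Ob) (hm : m ∈ M.IOb) :
    M.RunsSlower (M.PhotonSim c) b c := by
  refine hM.runsSlower_of_curves hn hb hc hm h.curve_b h.curve_c
    fun s₁ hs₁ s₂ hs₂ σ₁ hσ₁ σ₂ hσ₂ h1 h2 hne => ?_
  have key : ∀ s ∈ Cb.J, ∀ σ ∈ Cc.J, M.PhotonSim c (M.ev m (M.pos b m (ηb * s)))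
      (M.ev m (M.pos c m (ηc * σ))) →
      (ηc = 1 → Cb.V s = Cc.V σ) ∧ (ηc = -1 → Cb.U s = Cc.U σ) := by
    intro s hs σ hσ hsim
    obtain ⟨t, ht, ⟨h2, h3, h4⟩, h1⟩ :=
      h.exists_pastNull hM hn hb hc hm hc h.curve_c h.wl_c hs hσ hsim
    obtain rfl := TimelikeCurve.eq_of_mul_eq_zero hM.cont ht hσ h1.1
    rcases mul_eq_zero.1 h2 with e | e
    · have e' := (sub_eq_zero.1 e).symm
      refine ⟨fun hη => ?_, fun _ => e'⟩
      have := h.lt_of_U_eq hM.cont hs hσ e'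
      rw [hη] at h4
      linarith
    · have e' := (sub_eq_zero.1 e).symm
      refine ⟨fun _ => e', fun hη => ?_⟩
      have := h.lt_of_V_eq hM.cont hs hσ e'
      rw [hη] at h3
      linarith
  rcases h.curve_c.sign with hη | hη
  · exact h.keeps_b.slower_of_V_eq hM.cont h.keeps_c h.lt hs₁ hs₂ hσ₁ hσ₂
      ((key s₁ hs₁ σ₁ hσ₁ h1).1 hη) ((key s₂ hs₂ σ₂ hσ₂ h2).1 hη) hne
  · exact h.keeps_b.slower_of_U_eq hM.cont h.keeps_c h.lt hs₁ hs₂ hσ₁ hσ₂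
      ((key s₁ hs₁ σ₁ hσ₁ h1).2 hη) ((key s₂ hs₂ σ₂ hσ₂ h2).2 hη) hne

theorem runsSlower_photonSim_k (h : M.IsShip m b k c ε w K Cb Cc ηb ηc x y) (hM : M.AccRel)
    (hn : 2 ≤ n) (hb : b ∈ M.Ob) (hk : k ∈ M.Ob) (hc : c ∈ M.Ob) (hm : m ∈ M.IOb) :
    M.RunsSlower (M.PhotonSim k) b c := by
  refine hM.runsSlower_of_curves hn hb hc hm h.curve_b h.curve_c
    fun s₁ hs₁ s₂ hs₂ σ₁ hσ₁ σ₂ hσ₂ h1 h2 hne => ?_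
  obtain ⟨t₁, ht₁, hb₁, hc₁⟩ :=
    h.exists_pastNull hM hn hb hc hm hk h.curve_k h.wl_k hs₁ hσ₁ h1
  obtain ⟨t₂, ht₂, hb₂, hc₂⟩ :=
    h.exists_pastNull hM hn hb hc hm hk h.curve_k h.wl_k hs₂ hσ₂ h2
  have hbU := fun {s t} (hs : s ∈ Cb.J) => (h.keeps_b.at_tm hs).U_eq_of_pastNull hM.cont
    h.keeps_b.1 (t := t)
  have hcU := fun {s t} (hs : s ∈ Cc.J) => (h.keeps_c.at_tm hs).U_eq_of_pastNull hM.cont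
    h.keeps_c.1 (t := t)
  have hbV := fun {s t} (hs : s ∈ Cb.J) => (h.keeps_b.at_tm hs).V_eq_of_pastNull hM.cont (t := t)
  have hcV := fun {s t} (hs : s ∈ Cc.J) => (h.keeps_c.at_tm hs).V_eq_of_pastNull hM.cont (t := t)
  have hlt := h.lt
  rcases le_or_gt 0 x with hx | hx
  · have hy : 0 ≤ y := hx.trans hlt.le
    exact h.keeps_b.slower_of_U_eq hM.cont h.keeps_c hlt hs₁ hs₂ hσ₁ hσ₂
      ((hbU hs₁ ht₁ hb₁ hx).symm.trans (hcU hσ₁ ht₁ hc₁ hy))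
      ((hbU hs₂ ht₂ hb₂ hx).symm.trans (hcU hσ₂ ht₂ hc₂ hy)) hne
  rcases le_or_gt y 0 with hy | hy
  · exact h.keeps_b.slower_of_V_eq hM.cont h.keeps_c hlt hs₁ hs₂ hσ₁ hσ₂
      ((hbV hs₁ ht₁ hb₁ hx.le).symm.trans (hcV hσ₁ ht₁ hc₁ hy))
      ((hbV hs₂ ht₂ hb₂ hx.le).symm.trans (hcV hσ₂ ht₂ hc₂ hy)) hne
  -- Now `k` is strictly between: light from `b` comes along constant `V` and light from `c` along
  -- constant `U`, so the clock of `k` at distance `0` mediates.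
  have e₁ := (hbV hs₁ ht₁ hb₁ hx.le).symm
  have e₂ := (hbV hs₂ ht₂ hb₂ hx.le).symm
  have f₁ := hcU hσ₁ ht₁ hc₁ hy.le
  have f₂ := hcU hσ₂ ht₂ hc₂ hy.le
  -- Each comparison needs a nondegenerate pair, and equal times of `k` would make both observed
  -- pairs equal.
  have ht : t₁ ≠ t₂ := by
    rintro rfl
    rcases hne with hne | hne
    · exact hne ((Cb.monoV hM.cont).injOn hs₁ hs₂ (e₁.trans e₂.symm))
    · exact hne ((Cc.monoU hM.cont).injOn hσ₁ hσ₂ (f₁.symm.trans f₂))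
  exact (h.keeps_b.slower_of_V_eq hM.cont K.keepsDist_zero hx hs₁ hs₂ ht₁ ht₂ e₁ e₂
    (Or.inr ht)).trans (K.keepsDist_zero.slower_of_U_eq hM.cont h.keeps_c hy ht₁ ht₂ hσ₁ hσ₂
      f₁ f₂ (Or.inl ht))

end IsShip

end Comparison

end RelFrame

/-! ### The clock theorem. -/

theorem mainTheorem12 {B Q : Type*} [Field Q] [LinearOrder Q] [IsStrictOrderedRing Q]
    {n : ℕ} (hd : 3 ≤ n + 1)
    (M : RelFrame B Q n) (hM : M.AccRel) (b k c : B)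
    (hb : b ∈ M.Ob) (hk : k ∈ M.Ob) (hc : c ∈ M.Ob)
    (hship : M.MinkowskiSpaceship b k c)
    (hbc : ∀ e ∈ M.AllEv, ¬ (b ∈ e ∧ c ∈ e))
    (hacc : M.PositivelyAccelerated k)
    (hdir : M.DirectionOfAcceleration b k c)
    (hfar : M.NotTooFarBehind b k) :
    M.RunsSlower (M.MinkSim k) b c ∧
      (M.RunsSlower (M.PhotonSim k) b c ∧
        M.RunsSlower (M.PhotonSim b) b c ∧
        M.RunsSlower (M.PhotonSim c) b c) := by
  -- The order topology is auxiliary: it only gives sense to the limits defining `HasD`.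
  let _ : TopologicalSpace Q := Preorder.topology Q
  have : OrderTopology Q := ⟨rfl⟩
  have hn : 2 ≤ n := by omega
  obtain ⟨⟨m, hm, hcop⟩, hdb, hdc⟩ := hship
  obtain ⟨w, hw⟩ := RelFrame.InVerticalPlane.exists_planarOn hM.axEOF hcop
  have hwb : M.wl m b ⊆ M.wl m b ∪ M.wl m k ∪ M.wl m c := fun _ h => Or.inl (Or.inl h)
  have hwk : M.wl m k ⊆ M.wl m b ∪ M.wl m k ∪ M.wl m c := fun _ h => Or.inl (Or.inr h)
  have hwc : M.wl m c ⊆ M.wl m b ∪ M.wl m k ∪ M.wl m c := fun _ h => Or.inr h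
  obtain ⟨ε, Ck, hε, hCk⟩ := hM.exists_isCurveOf_one hn hk hm (hw.mono hwk)
  obtain ⟨ηb, Cb, hCb⟩ := hM.exists_isCurveOf hn hb hm (hw.mono hwb) hε
  obtain ⟨ηc, Cc, hCc⟩ := hM.exists_isCurveOf hn hc hm (hw.mono hwc) hε
  have hpos : ∀ {s σ}, s ∈ Cb.J → σ ∈ Cc.J →
      M.pos b m (ηb * s) ∈ M.wl m b ∪ M.wl m k ∪ M.wl m c ∧
      M.pos c m (ηc * σ) ∈ M.wl m b ∪ M.wl m k ∪ M.wl m c := fun hs hσ =>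
    ⟨hwb (hCb.pos_mem hM hb hm hs), hwc (hCc.pos_mem hM hc hm hσ)⟩
  have key : ∀ R : Set B → Set B → Prop,
      (∀ s ∈ Cb.J, ∀ σ ∈ Cc.J, R (M.ev m (M.pos b m (ηb * s))) (M.ev m (M.pos c m (ηc * σ))) →
        (Cc.U σ - Cb.U s) * (Cc.V σ - Cb.V s) ≤ 0) →
      ((∃ ε w K Cb Cc ηb ηc x y, M.IsShip m b k c ε w K Cb Cc ηb ηc x y) →
        M.RunsSlower R b c) → M.RunsSlower R b c := by
    intro R hR hslower
    -- With a spacelike pair the direction hypothesis orients the plane and the ship exists. Without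
    -- one, two different matched pairs, never timelike separated by `hR`, would create one, so
    -- nothing is left to compare.
    by_cases hsp : ∃ p ∈ M.wl m c, ∃ q ∈ M.wl m b, mink (p - q) (p - q) < 0
    · obtain ⟨p, hp, q, hq, hpq⟩ := hsp
      exact hslower (hM.exists_isShip hn hb hk hc hm hcop hdb hdc hacc hdir hfar hp hq hpq)
    · refine hM.runsSlower_of_curves hn hb hc hm hCb hCc
        fun s₁ hs₁ s₂ hs₂ σ₁ hσ₁ σ₂ hσ₂ h1 h2 hne => absurd ?_ hsp
      exact hM.exists_spacelike_pair hb hc hm hε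
        (hw.mono (Set.union_subset hwb hwc)) hCb hCc hbc hs₁ hs₂ hσ₁ hσ₂
        (hR s₁ hs₁ σ₁ hσ₁ h1) (hR s₂ hs₂ σ₂ hσ₂ h2) hne
  have photon : ∀ (o : B) (η : Q) (C : M.TimelikeCurve), o ∈ M.Ob → M.IsCurveOf o m ε w η C →
      M.wl m o ⊆ M.wl m b ∪ M.wl m k ∪ M.wl m c → ∀ s ∈ Cb.J, ∀ σ ∈ Cc.J,
      M.PhotonSim o (M.ev m (M.pos b m (ηb * s))) (M.ev m (M.pos c m (ηc * σ))) →
        (Cc.U σ - Cb.U s) * (Cc.V σ - Cb.V s) ≤ 0 := by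
    intro o η C ho hC hoS s hs σ hσ hsim
    obtain ⟨t, -, h1, h2⟩ := hC.exists_of_photonSim hM hn ho hm hε hw hoS (hpos hs hσ).1
      (hpos hs hσ).2 hsim
    rw [hCb.U_eq, hCb.V_eq, hCc.U_eq, hCc.V_eq]
    exact h1.mul_nonpos hC.sign h2
  refine ⟨key _ ?_ ?_, key _ (photon k 1 Ck hk hCk hwk) ?_, key _ (photon b ηb Cb hb hCb hwb) ?_,
    key _ (photon c ηc Cc hc hCc hwc) ?_⟩
  · intro s hs σ hσ hsim
    obtain ⟨t, ht, h1, h2⟩ := hCk.exists_of_minkSim hM hn hk hm hε hw hwk (hpos hs hσ).1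
      (hpos hs hσ).2 hsim
    rw [hCb.U_eq, hCb.V_eq, hCc.U_eq, hCc.V_eq]
    exact RelFrame.mul_nonpos_of_orthogonal (Ck.r_pos t ht) h1 h2
  · rintro ⟨ε, w, K, Cb, Cc, ηb, ηc, x, y, h⟩
    exact h.runsSlower_minkSim hM hn hb hk hc hm
  · rintro ⟨ε, w, K, Cb, Cc, ηb, ηc, x, y, h⟩
    exact h.runsSlower_photonSim_k hM hn hb hk hc hm
  · rintro ⟨ε, w, K, Cb, Cc, ηb, ηc, x, y, h⟩
    exact h.runsSlower_photonSim_b hM hn hb hc hm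
  · rintro ⟨ε, w, K, Cb, Cc, ηb, ηc, x, y, h⟩
    exact h.runsSlower_photonSim_c hM hn hb hc hm
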